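/- For a finite set $\mathcal X\subseteq[0,1]^m$ and a dataset $X=(x_1,\dots,x_n)\in\mathcal X^n$ ($m,n\ge 1$) write $\bar X=\frac1n\sum_i x_i$. For a randomized algorithm $\mathcal A$ let $\mathrm{err}^2(\mathcal X,\mathcal A,n)=\max_{X\in\mathcal X^n}\bigl(\mathbb E\,\frac1m\|\mathcal A(X)-\bar X\|_2^2\bigr)^{1/2}$. Let $\mathcal P(\mathcal X,t)$ be the largest size of a subset of $\mathcal X$ whose distinct points are at pairwise Euclidean distance greater than $t\sqrt m$. The algorithm $\mathcal A$ is $\rho$-zCDP if $\mathrm D_\gamma(\mathcal A(X)\|\mathcal A(X'))\le\gamma\rho$ for all $\gamma>1$ and all datasets $X,X'$ that, as multisets, differ by the replacement of one element, where $\mathrm D_\gamma$ is the Rényi divergence of order $\gamma$ in nats. Coarse Projection Mechanism (parameters $\alpha,\rho>0$): choose an inclusion-maximal subset $T\subseteq\mathcal X$ with $\frac1{\sqrt m}\|x-y\|_2\ge\frac\alpha2$ for all distinct $x,y\in T$; round each element of the dataset to a nearest point of $T$; add to the mean of the rounded dataset a Gaussian vector $N\bigl(0,\tfrac{m}{2\rho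 n^2}I_m\bigr)$; output the point of $\mathrm{conv}(T)$ that is closest to the result in $\ell_2$. Theorem. There are absolute constants $C,K>0$ such that, for all $m,n\ge1$, all finite $\mathcal X\subseteq[0,1]^m$ and all $\alpha,\rho>0$, with the condition $$n\ \ge\ K\cdot\frac{\log(1/\alpha)}{\alpha^2\sqrt\rho}\cdot\sup\Bigl\{t\sqrt{\log\mathcal P(\mathcal X,t)}\ :\ t\ge\alpha/C\Bigr\},\qquad(*)$$ the following hold. (1) For every choice of $T$ and of the nearest points, the Coarse Projection Mechanism is $\rho$-zCDP, and if $(*)$ holds then its average error $\mathrm{err}^2(\mathcal X,\cdot,n)$ is at most $\alpha$. (2) The mechanism has a polynomial-time implementation: there is a single program, for a random access machine with exact real arithmetic (in which arithmetic operations, square roots and comparisons of reals, memory accesses, additions and subtractions of indices, and draws of independent standard Gaussians have unit cost), that is given $m$, $n$, $\alpha$, $\rho$, the list of the points of $\mathcal X$ and the dataset, and that outputs a vector of $\mathbb R^m$ such that: its running time is always at most a fixed polynomial in $|\mathcal X|$, $n$ and $m$; it is $\rho$-zCDP; and if $(*)$ holds then its average error is at most $\alpha$, and there is a choice of $T$ and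 of the nearest points such that, for every dataset, the output of the program and the output of the Coarse Projection Mechanism on the same Gaussian noise have root-mean-square distance $\bigl(\mathbb E\,\frac1m\|\cdot\|_2^2\bigr)^{1/2}$ at most $\alpha/2$. -/

import Mathlib

open MeasureTheory ProbabilityTheory
open scoped ENNReal

/-! ## A real RAM with Gaussian sampling

Programs are finite syntax trees. They work on natural-number registers (indices and counters, on
which only addition and truncated subtraction are available), on two-dimensional arrays of exact real
numbers (arithmetic, square root, comparison), and on a source of independent standard Gaussians.
Every operation has unit cost. The only loops are counted loops, so every run terminates. -/

namespace RealRAM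

/-- Expressions over the natural-number registers. -/
inductive NatExpr where
  | const (c : ℕ)
  | reg (r : ℕ)
  | add (a b : NatExpr)
  | sub (a b : NatExpr)

/-- Real expressions; `read A i j` is the entry in row `i`, column `j` of array number `A`. -/
inductive RealExpr where
  | ofNat (a : NatExpr)
  | read (A : ℕ) (i j : NatExpr)
  | add (a b : RealExpr)
  | sub (a b : RealExpr)
  | mul (a b : RealExpr)
  | div (a b : RealExpr)
  | sqrt (a : RealExpr)

/-- Tests. -/
inductive Test where
  | leNat (a b : NatExpr)
  | leReal (a b : RealExpr)

/-- Programs. `gauss A i j` writes a fresh standard Gaussian into an array entry;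
`loop r a c` runs `c` successively with register `r` set to `0, 1, …, k - 1`, where `k` is the value
of `a` on entry. -/
inductive Program where
  | skip
  | setNat (r : ℕ) (a : NatExpr)
  | setReal (A : ℕ) (i j : NatExpr) (a : RealExpr)
  | gauss (A : ℕ) (i j : NatExpr)
  | seq (c d : Program)
  | ite (b : Test) (c d : Program)
  | loop (r : ℕ) (a : NatExpr) (c : Program)

/-- A machine state: registers, arrays, the number of Gaussians drawn so far, and the number of
elementary steps performed so far. -/
structure State where
  nat : ℕ → ℕ
  real : ℕ → ℕ → ℕ → ℝ
  drawn : ℕ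
  steps : ℕ

namespace NatExpr

def eval (s : State) : NatExpr → ℕ
  | const c => c
  | reg r => s.nat r
  | add a b => a.eval s + b.eval s
  | sub a b => a.eval s - b.eval s

/-- The number of elementary operations in an expression. -/
def cost : NatExpr → ℕ
  | const _ => 1
  | reg _ => 1
  | add a b => a.cost + b.cost + 1
  | sub a b => a.cost + b.cost + 1

end NatExpr

namespace RealExpr

noncomputable def eval (s : State) : RealExpr → ℝ
  | ofNat a => (a.eval s : ℝ)
  | read A i j => s.real A (i.eval s) (j.eval s)
  | add a b => a.eval s + b.eval s
  | sub a b => a.eval s - b.eval s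
  | mul a b => a.eval s * b.eval s
  | div a b => a.eval s / b.eval s
  | sqrt a => Real.sqrt (a.eval s)

/-- The number of elementary operations in an expression. -/
def cost : RealExpr → ℕ
  | ofNat a => a.cost + 1
  | read _ i j => i.cost + j.cost + 1
  | add a b => a.cost + b.cost + 1
  | sub a b => a.cost + b.cost + 1
  | mul a b => a.cost + b.cost + 1
  | div a b => a.cost + b.cost + 1
  | sqrt a => a.cost + 1

end RealExpr

namespace Test

def holds (s : State) : Test → Prop
  | leNat a b => a.eval s ≤ b.eval s
  | leReal a b => a.eval s ≤ b.eval s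

/-- The number of elementary operations in a test. -/
def cost : Test → ℕ
  | leNat a b => a.cost + b.cost + 1
  | leReal a b => a.cost + b.cost + 1

end Test

namespace State

def tick (k : ℕ) (s : State) : State := { s with steps := s.steps + k }

def writeNat (r v : ℕ) (s : State) : State := { s with nat := Function.update s.nat r v }

noncomputable def writeReal (A i j : ℕ) (v : ℝ) (s : State) : State :=
  let row := Function.update (s.real A i) j v
  let arr := Function.update (s.real A) i row
  { s with real := Function.update s.real A arr }

end State

open Classical in
/-- The state in which a program ends when it is started in a given state, where `ω k` is the value
of the `k`-th Gaussian drawn. -/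
noncomputable def Program.run (ω : ℕ → ℝ) : Program → State → State
  | skip, s => s.tick 1
  | setNat r a, s => (s.writeNat r (a.eval s)).tick (a.cost + 1)
  | setReal A i j a, s =>
      (s.writeReal A (i.eval s) (j.eval s) (a.eval s)).tick (i.cost + j.cost + a.cost + 1)
  | gauss A i j, s =>
      { (s.writeReal A (i.eval s) (j.eval s) (ω s.drawn)).tick (i.cost + j.cost + 1) with
        drawn := s.drawn + 1 }
  | seq c d, s => d.run ω (c.run ω s)
  | ite b c d, s =>
      if b.holds s then c.run ω (s.tick (b.cost + 1)) else d.run ω (s.tick (b.cost + 1))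
  | loop r a c, s =>
      (List.range (a.eval s)).foldl (fun s' i => c.run ω ((s'.writeNat r i).tick 1))
        (s.tick (a.cost + 1))

end RealRAM

/-! ## The mean point problem and concentrated differential privacy -/

/-- Rényi divergence of order `γ > 1`, in nats; it is infinite if `P` is not absolutely continuous
with respect to `Q`. -/
noncomputable def renyiDiv {Ω : Type*} [MeasurableSpace Ω] (γ : ℝ) (P Q : Measure Ω) : EReal :=
  open Classical in
  if P ≪ Q then (((γ - 1)⁻¹ : ℝ) : EReal) * ENNReal.log (∫⁻ x, P.rnDeriv Q x ^ γ ∂Q) else ⊤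

/-- Two datasets of size `n`, each listed in some order, are neighboring if, as multisets, one
arises from the other by replacing one element. -/
def Neighboring {U : Type*} {n : ℕ} (D D' : Fin n → U) : Prop :=
  ∃ (σ : Equiv.Perm (Fin n)) (i : Fin n), ∀ j, j ≠ i → D' (σ j) = D j

/-- `A D` is the law of the output of a randomized algorithm on the dataset `D`. -/
def IsZCDP {U Ω : Type*} [MeasurableSpace Ω] {n : ℕ} (ρ : ℝ)
    (A : (Fin n → U) → Measure Ω) : Prop :=
  (∀ D, IsProbabilityMeasure (A D)) ∧
    ∀ D D', Neighboring D D' → ∀ γ : ℝ, 1 < γ → renyiDiv γ (A D) (A D') ≤ ((γ * ρ : ℝ) : EReal)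

/-- The mean of `n` points. -/
noncomputable def meanPoint {m n : ℕ} (D : Fin n → EuclideanSpace ℝ (Fin m)) :
    EuclideanSpace ℝ (Fin m) :=
  (n : ℝ)⁻¹ • ∑ i, D i

/-- Average error of an algorithm over all datasets of size `n` from the universe `X`. -/
noncomputable def avgError {m n : ℕ} (X : Finset (EuclideanSpace ℝ (Fin m)))
    (A : (Fin n → X) → Measure (EuclideanSpace ℝ (Fin m))) : ℝ≥0∞ :=
  ⨆ D : Fin n → X,
    (∫⁻ y, ‖y - meanPoint (fun i => (D i : EuclideanSpace ℝ (Fin m)))‖ₑ ^ 2 / (m : ℝ≥0∞) ∂(A D)) ^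
      (1 / 2 : ℝ)

/-- The separation number of a finite set: the largest number of points with pairwise distances
greater than `t * √m`. -/
noncomputable def sepNumber {m : ℕ} (X : Finset (EuclideanSpace ℝ (Fin m))) (t : ℝ) : ℕ :=
  (Metric.packingNumber (Real.toNNReal (t * Real.sqrt m))
    (X : Set (EuclideanSpace ℝ (Fin m)))).toNat

/-- The quantity `log (1/α) / (α² √ρ) · sup {t √(log P(X, t)) : t ≥ α / C}`. -/
noncomputable def coarseBound {m : ℕ} (C : ℝ) (X : Finset (EuclideanSpace ℝ (Fin m)))
    (α ρ : ℝ) : ℝ :=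
  Real.log (1 / α) / (α ^ 2 * Real.sqrt ρ) *
    sSup {s : ℝ | ∃ t : ℝ, α / C ≤ t ∧ s = t * Real.sqrt (Real.log (sepNumber X t))}

/-! ## The Coarse Projection Mechanism -/

/-- `T` is an inclusion-maximal `α/2`-separated subset of `X` in the metric `‖x - y‖ / √m`. -/
def IsCoarseNet {m : ℕ} (X : Finset (EuclideanSpace ℝ (Fin m))) (α : ℝ)
    (T : Finset (EuclideanSpace ℝ (Fin m))) : Prop :=
  Maximal (fun S : Finset (EuclideanSpace ℝ (Fin m)) =>
    S ⊆ X ∧ ∀ x ∈ S, ∀ y ∈ S, x ≠ y → α / 2 ≤ dist x y / Real.sqrt m) T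

/-- `r` rounds every point of `X` to a nearest point of `T`. -/
def IsRounding {m : ℕ} (X T : Finset (EuclideanSpace ℝ (Fin m)))
    (r : X → EuclideanSpace ℝ (Fin m)) : Prop :=
  ∀ x : X, r x ∈ T ∧ ∀ y ∈ T, dist (x : EuclideanSpace ℝ (Fin m)) (r x) ≤ dist x.1 y

/-- The point of the convex hull of `T` that is closest to `y`. -/
noncomputable def hullProj {m : ℕ} (T : Finset (EuclideanSpace ℝ (Fin m)))
    (y : EuclideanSpace ℝ (Fin m)) : EuclideanSpace ℝ (Fin m) :=
  Classical.epsilon fun p =>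
    p ∈ convexHull ℝ (T : Set (EuclideanSpace ℝ (Fin m))) ∧
      ∀ q ∈ convexHull ℝ (T : Set (EuclideanSpace ℝ (Fin m))), dist y p ≤ dist y q

theorem hullProj_spec {m : ℕ} (T : Finset (EuclideanSpace ℝ (Fin m))) (hT : T.Nonempty)
    (y : EuclideanSpace ℝ (Fin m)) :
    hullProj T y ∈ convexHull ℝ (T : Set (EuclideanSpace ℝ (Fin m))) ∧
      ∀ q ∈ convexHull ℝ (T : Set (EuclideanSpace ℝ (Fin m))),
        dist y (hullProj T y) ≤ dist y q := by
  have hc : IsCompact (convexHull ℝ (T : Set (EuclideanSpace ℝ (Fin m)))) :=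
    T.finite_toSet.isCompact_convexHull (𝕜 := ℝ)
  obtain ⟨p, hp, hmin⟩ := hc.exists_isMinOn (hT.to_set.convexHull (𝕜 := ℝ))
    (f := fun q => dist y q) (by fun_prop)
  exact Classical.epsilon_spec
    (p := fun p => p ∈ convexHull ℝ (T : Set (EuclideanSpace ℝ (Fin m))) ∧
      ∀ q ∈ convexHull ℝ (T : Set (EuclideanSpace ℝ (Fin m))), dist y p ≤ dist y q)
    ⟨p, hp, fun q hq => hmin hq⟩

/-- The output of the mechanism when the standard Gaussian vector drawn is `z`: round the dataset to
the net, add `z` scaled by `√m / (n √(2ρ))` to the mean of the rounded dataset, and project onto the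
convex hull of the net. -/
noncomputable def cpmOutput {m n : ℕ} {X : Finset (EuclideanSpace ℝ (Fin m))}
    (T : Finset (EuclideanSpace ℝ (Fin m))) (r : X → EuclideanSpace ℝ (Fin m)) (ρ : ℝ)
    (D : Fin n → X) (z : EuclideanSpace ℝ (Fin m)) : EuclideanSpace ℝ (Fin m) :=
  hullProj T (meanPoint (fun i => r (D i)) + (Real.sqrt m / (n * Real.sqrt (2 * ρ))) • z)

/-- The Coarse Projection Mechanism with net `T` and rounding map `r`. -/
noncomputable def cpm {m n : ℕ} {X : Finset (EuclideanSpace ℝ (Fin m))}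
    (T : Finset (EuclideanSpace ℝ (Fin m))) (r : X → EuclideanSpace ℝ (Fin m)) (ρ : ℝ)
    (D : Fin n → X) : Measure (EuclideanSpace ℝ (Fin m)) :=
  (stdGaussian (EuclideanSpace ℝ (Fin m))).map (cpmOutput T r ρ D)

/-! ## Programs for the mean point problem -/

/-- The law of an infinite sequence of independent standard Gaussians. -/
noncomputable def gaussianTape : Measure (ℕ → ℝ) :=
  Measure.infinitePi fun _ : ℕ => gaussianReal 0 1

/-- The initial state. Registers `0, 1, 2` hold `m`, `|X|`, `n`; array `0` holds the points of the
universe, one per row, in the order `e`; array `1` holds the points of the dataset, one per row;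
entries `0` and `1` of row `0` of array `2` hold `α` and `ρ`. Everything else is zero. -/
noncomputable def initialState {m n : ℕ} {X : Finset (EuclideanSpace ℝ (Fin m))}
    (e : Fin X.card ≃ X) (α ρ : ℝ) (D : Fin n → X) : RealRAM.State where
  nat k := if k = 0 then m else if k = 1 then X.card else if k = 2 then n else 0
  real A i j :=
    if A = 0 then
      if h : i < X.card ∧ j < m then
        (e ⟨i, h.1⟩ : EuclideanSpace ℝ (Fin m)) ⟨j, h.2⟩ else 0
    else if A = 1 then
      if h : i < n ∧ j < m then (D ⟨i, h.1⟩ : EuclideanSpace ℝ (Fin m)) ⟨j, h.2⟩ else 0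
    else if A = 2 ∧ i = 0 ∧ j = 0 then α
    else if A = 2 ∧ i = 0 ∧ j = 1 then ρ
    else 0
  drawn := 0
  steps := 0

/-- The running time of a program on the Gaussian sequence `ω`. -/
noncomputable def runTime {m n : ℕ} {X : Finset (EuclideanSpace ℝ (Fin m))}
    (c : RealRAM.Program) (e : Fin X.card ≃ X) (α ρ : ℝ) (D : Fin n → X) (ω : ℕ → ℝ) : ℕ :=
  (c.run ω (initialState e α ρ D)).steps

/-- The output of a program: the first `m` entries of row `0` of array `3` at the end of the run. -/
noncomputable def progOutput {m n : ℕ} {X : Finset (EuclideanSpace ℝ (Fin m))}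
    (c : RealRAM.Program) (e : Fin X.card ≃ X) (α ρ : ℝ) (D : Fin n → X) (ω : ℕ → ℝ) :
    EuclideanSpace ℝ (Fin m) :=
  WithLp.toLp 2 fun j : Fin m => (c.run ω (initialState e α ρ D)).real 3 0 j

/-- The law of the output of a program. -/
noncomputable def progMechanism {m n : ℕ} {X : Finset (EuclideanSpace ℝ (Fin m))}
    (c : RealRAM.Program) (e : Fin X.card ≃ X) (α ρ : ℝ) (D : Fin n → X) :
    Measure (EuclideanSpace ℝ (Fin m)) :=
  gaussianTape.map (progOutput c e α ρ D)

/-! ## Projection onto a convex hull -/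

/-! Let `σ = √m / (n √(2ρ))` be the noise level, `z` the Gaussian vector, `x` the mean of the
rounded data, `a` the true mean, and `S` (`coarseSup`) the supremum in the sample size condition.

Privacy. All points lie in the unit cube, so the rounded means of neighboring datasets differ by at
most `√m / n`. The Rényi divergence between two translates of a Gaussian is explicit, and whatever
is done to the noisy mean afterwards is post-processing (`renyiDiv_map_le`, `isZCDP_gaussian`).

Accuracy (`lintegral_sq_error_le`). Rounding moves the mean by at most `α/2` in the normalized norm.
The projection `p` of `x + σ z` satisfies `‖p - x‖² ≤ σ ⟨z, p - x⟩`, so its mean square error is at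
most `σ` times the Gaussian width of the net. Chaining over dyadic scales between `1` and `α/4`
costs at most `3 √m S` per scale. The number of scales is `O(log (1/α))` as long as `α` stays away
from `1` (`gaussianWidthLE_of_separated`). For `α` just below `1` the factor `log (1/α)` makes the
condition almost void and geometry replaces it: distinct net points are then about `√m / 2` apart,
and the projections of `x + u` and `x - u` cannot both be at distance nearly `√m` from `a`
(`sq_norm_hullProj_sub_le_or`). Averaging over `z` and `-z` gives an error below `α`. For `α ≥ 1`
the diameter of the cube suffices.

Implementation. The net is found greedily and the projection is approximated by the Frank–Wolfe
method, whose squared error after `k` steps is at most `4 diam² / (k + 2)`. With only the diameter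
of the cube this would take about `1/α²` steps, which is not polynomial in the size of the input.
Two cases avoid the dependence on `α`. If `σ ≤ α/2`, the projection is skipped: the noisy mean is
already accurate, and its root-mean-square distance to its projection is at most `σ`. If `σ > α/2`,
then `n` is small, so the condition forces `S` to be small; since two net points at distance `d √m`
make `S` at least `d/4`, the hull has diameter `O(m α)` (`exists_diam_bound`), and `10^7 + m` steps
are enough. -/

theorem hullProj_mem {m : ℕ} {T : Finset (EuclideanSpace ℝ (Fin m))} (hT : T.Nonempty)
    (w : EuclideanSpace ℝ (Fin m)) :
    hullProj T w ∈ convexHull ℝ (T : Set (EuclideanSpace ℝ (Fin m))) :=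
  (hullProj_spec T hT w).1

theorem inner_sub_hullProj_nonpos {m : ℕ} {T : Finset (EuclideanSpace ℝ (Fin m))}
    (hT : T.Nonempty) (w : EuclideanSpace ℝ (Fin m)) {q : EuclideanSpace ℝ (Fin m)}
    (hq : q ∈ convexHull ℝ (T : Set (EuclideanSpace ℝ (Fin m)))) :
    inner ℝ (w - hullProj T w) (q - hullProj T w) ≤ 0 := by
  obtain ⟨hmem, hmin⟩ := hullProj_spec T hT w
  refine (norm_eq_iInf_iff_real_inner_le_zero (convex_convexHull ℝ _) hmem).1 ?_ q hq
  have : Nonempty (convexHull ℝ (T : Set (EuclideanSpace ℝ (Fin m)))) := ⟨⟨_, hmem⟩⟩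
  refine le_antisymm (le_ciInf fun v => ?_) ?_
  · simpa [dist_eq_norm] using hmin v v.2
  · exact ciInf_le (f := fun v : convexHull ℝ (T : Set (EuclideanSpace ℝ (Fin m))) =>
      ‖w - (v : EuclideanSpace ℝ (Fin m))‖) ⟨0, by rintro _ ⟨v, rfl⟩; positivity⟩
      ⟨_, hmem⟩

/-- The obtuse angle inequality, expanded around `q`. With `w = q + σ z` the right side becomes `σ
⟨z, hullProj T w - q⟩`, which is linear in the noise; this is how the Gaussian width enters. -/
theorem sq_norm_hullProj_sub_le_inner {m : ℕ} {T : Finset (EuclideanSpace ℝ (Fin m))}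
    (hT : T.Nonempty) (w : EuclideanSpace ℝ (Fin m)) {q : EuclideanSpace ℝ (Fin m)}
    (hq : q ∈ convexHull ℝ (T : Set (EuclideanSpace ℝ (Fin m)))) :
    ‖hullProj T w - q‖ ^ 2 ≤ inner ℝ (w - q) (hullProj T w - q) := by
  have h := inner_sub_hullProj_nonpos hT w hq
  have e : inner ℝ (w - hullProj T w) (q - hullProj T w)
      = ‖hullProj T w - q‖ ^ 2 - inner ℝ (w - q) (hullProj T w - q) := by
    rw [← real_inner_self_eq_norm_sq, ← inner_sub_left, ← neg_sub (hullProj T w) q, inner_neg_right,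
      ← inner_neg_left]
    congr 1; abel
  linarith

theorem norm_hullProj_sub_le {m : ℕ} {T : Finset (EuclideanSpace ℝ (Fin m))}
    (hT : T.Nonempty) (w : EuclideanSpace ℝ (Fin m)) {q : EuclideanSpace ℝ (Fin m)}
    (hq : q ∈ convexHull ℝ (T : Set (EuclideanSpace ℝ (Fin m)))) :
    ‖w - hullProj T w‖ ≤ ‖w - q‖ := by
  simpa [dist_eq_norm] using (hullProj_spec T hT w).2 q hq

/-- Adding the obtuse angle inequalities of the two projections gives `‖p - q‖² ≤ ⟨u - v, p - q⟩`.
The resulting continuity makes the projection measurable. -/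
theorem dist_hullProj_le {m : ℕ} {T : Finset (EuclideanSpace ℝ (Fin m))} (hT : T.Nonempty)
    (u v : EuclideanSpace ℝ (Fin m)) : dist (hullProj T u) (hullProj T v) ≤ dist u v := by
  set p := hullProj T u with hp
  set q := hullProj T v with hq
  have h1 : inner ℝ (u - p) (q - p) ≤ 0 := inner_sub_hullProj_nonpos hT u (hullProj_mem hT v)
  have h2 : inner ℝ (v - q) (p - q) ≤ 0 := inner_sub_hullProj_nonpos hT v (hullProj_mem hT u)
  have e : inner ℝ (u - p) (q - p) + inner ℝ (v - q) (p - q)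
      = ‖p - q‖ ^ 2 - inner ℝ (u - v) (p - q) := by
    rw [← real_inner_self_eq_norm_sq, ← inner_sub_left, ← neg_sub p q, inner_neg_right,
      ← inner_neg_left, ← inner_add_left]
    congr 1; abel
  have h3 := real_inner_le_norm (u - v) (p - q)
  rw [dist_eq_norm, dist_eq_norm]
  by_contra hlt
  push Not at hlt
  nlinarith [norm_nonneg (u - v), norm_nonneg (p - q)]

theorem continuous_hullProj {m : ℕ} {T : Finset (EuclideanSpace ℝ (Fin m))} (hT : T.Nonempty) :
    Continuous (hullProj T) :=
  (LipschitzWith.of_dist_le_mul (K := 1) fun u v => by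
    simpa using dist_hullProj_le hT u v).continuous

/-- A projection onto `convexHull T` is a convex combination of points of `T` that lie on its
supporting hyperplane; one of them is at least as far from a given point as the projection. -/
theorem exists_mem_inner_eq_zero_of_hullProj {m : ℕ} {T : Finset (EuclideanSpace ℝ (Fin m))}
    (hT : T.Nonempty) (w a : EuclideanSpace ℝ (Fin m)) :
    ∃ t ∈ T, inner ℝ (w - hullProj T w) (t - hullProj T w) = 0 ∧
      ‖hullProj T w - a‖ ≤ ‖t - a‖ := by
  classical
  set y := hullProj T w with hy
  obtain ⟨c, hc0, hc1, hcy⟩ := Finset.mem_convexHull'.1 (hullProj_mem hT w)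
  set S := T.filter fun t => c t ≠ 0 with hS
  -- The weighted average of `t - y` is zero and no term is positive, so every term vanishes: each
  -- point of positive weight lies on the supporting hyperplane.
  have hsum : ∑ t ∈ T, c t * inner ℝ (w - y) (t - y) = 0 := by
    have : ∑ t ∈ T, c t * inner ℝ (w - y) (t - y) = inner ℝ (w - y) (∑ t ∈ T, c t • (t - y)) := by
      simp [inner_sum, inner_smul_right]
    rw [this]
    have : ∑ t ∈ T, c t • (t - y) = 0 := by
      simp only [smul_sub, Finset.sum_sub_distrib, ← Finset.sum_smul, hc1, one_smul]
      rw [hcy, sub_self]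
    rw [this, inner_zero_right]
  have hzero := (Finset.sum_eq_zero_iff_of_nonpos fun t ht =>
    mul_nonpos_of_nonneg_of_nonpos (hc0 t ht)
      (inner_sub_hullProj_nonpos hT w (subset_convexHull ℝ _ ht))).1 hsum
  have hyS : y ∈ convexHull ℝ (S : Set (EuclideanSpace ℝ (Fin m))) := by
    refine Finset.mem_convexHull'.2 ⟨c, fun t ht => hc0 t (Finset.mem_filter.1 ht).1, ?_, ?_⟩
    · rw [hS, Finset.sum_filter_ne_zero, hc1]
    · refine Eq.trans ?_ hcy
      rw [hS, Finset.sum_filter]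
      refine Finset.sum_congr rfl fun t _ => ?_
      by_cases h : c t = 0 <;> simp [h]
  -- The distance to `a` is convex, so over the hull of the points of nonzero weight it is dominated
  -- by its value at some vertex.
  obtain ⟨t, htS, ht⟩ := ((convexOn_dist a (convex_univ)).subset (Set.subset_univ _)
    (convex_convexHull ℝ (S : Set (EuclideanSpace ℝ (Fin m))))).exists_ge_of_mem_convexHull
    (subset_convexHull ℝ _) hyS
  have htS' := Finset.mem_filter.1 (Finset.mem_coe.1 htS)
  refine ⟨t, htS'.1, ?_, by simpa [dist_eq_norm] using ht⟩
  rcases mul_eq_zero.1 (hzero t htS'.1) with h | h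
  · exact absurd h htS'.2
  · exact h

/-! ## The unit cube -/

def InCube {m : ℕ} (x : EuclideanSpace ℝ (Fin m)) : Prop := ∀ j, x j ∈ Set.Icc (0 : ℝ) 1

theorem convex_inCube {m : ℕ} : Convex ℝ {x : EuclideanSpace ℝ (Fin m) | InCube x} := by
  intro x hx y hy a b ha hb hab j
  have h1 := hx j
  have h2 := hy j
  simp only [PiLp.add_apply, PiLp.smul_apply, smul_eq_mul]
  exact convex_Icc (0 : ℝ) 1 h1 h2 ha hb hab

theorem InCube.of_mem_convexHull {m : ℕ} {T : Set (EuclideanSpace ℝ (Fin m))}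
    (hT : ∀ t ∈ T, InCube t) {x : EuclideanSpace ℝ (Fin m)} (hx : x ∈ convexHull ℝ T) :
    InCube x :=
  convexHull_min (t := {x | InCube x}) hT convex_inCube hx

/-- Coordinatewise, three numbers `p ≤ q ≤ r` in `[0, 1]` satisfy `(q - p)² + (r - q)² ≤ (r - p)² ≤
1`. Consequently two points of the cube that are both almost at distance `√m` from a third one are
close to each other. -/
theorem sq_norm_sub_add_add_le_of_inCube {m : ℕ} {a s t : EuclideanSpace ℝ (Fin m)}
    (ha : InCube a) (hs : InCube s) (ht : InCube t) :
    ‖t - s‖ ^ 2 + ‖t - a‖ ^ 2 + ‖s - a‖ ^ 2 ≤ 2 * m := by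
  simp only [EuclideanSpace.real_norm_sq_eq, PiLp.sub_apply]
  rw [← Finset.sum_add_distrib, ← Finset.sum_add_distrib]
  have : ∀ j ∈ (Finset.univ : Finset (Fin m)),
      (t j - s j) ^ 2 + (t j - a j) ^ 2 + (s j - a j) ^ 2 ≤ 2 := by
    intro j _
    have key : ∀ p q r : ℝ, 0 ≤ p → p ≤ q → q ≤ r → r ≤ 1 →
        (q - p) ^ 2 + (r - q) ^ 2 + (r - p) ^ 2 ≤ 2 := by
      intro p q r h0 h1 h2 h3
      have h4 : (q - p) ^ 2 + (r - q) ^ 2 ≤ (r - p) ^ 2 := by nlinarith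
      have h5 : (r - p) ^ 2 ≤ 1 := by nlinarith
      linarith
    obtain ⟨a0, a1⟩ := ha j
    obtain ⟨s0, s1⟩ := hs j
    obtain ⟨t0, t1⟩ := ht j
    rcases le_total (a j) (s j) with h1 | h1 <;> rcases le_total (a j) (t j) with h2 | h2 <;>
      rcases le_total (s j) (t j) with h3 | h3
    · linarith [key _ _ _ a0 h1 h3 t1]
    · linarith [key _ _ _ a0 h2 h3 s1, sub_sq_comm (t j) (s j)]
    · linarith [key _ _ _ t0 h2 h1 s1, sub_sq_comm (t j) (s j), sub_sq_comm (t j) (a j)]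
    · linarith [key _ _ _ t0 h2 h1 s1, sub_sq_comm (t j) (s j), sub_sq_comm (t j) (a j)]
    · linarith [key _ _ _ s0 h1 h2 t1, sub_sq_comm (s j) (a j)]
    · linarith [key _ _ _ s0 h1 h2 t1, sub_sq_comm (s j) (a j)]
    · linarith [key _ _ _ s0 h3 h2 a1, sub_sq_comm (t j) (a j), sub_sq_comm (s j) (a j)]
    · linarith [key _ _ _ t0 h3 h1 a1, sub_sq_comm (t j) (a j), sub_sq_comm (s j) (a j),
        sub_sq_comm (t j) (s j)]
  refine (Finset.sum_le_sum this).trans ?_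
  simp [mul_comm]

theorem sq_norm_sub_le_of_inCube {m : ℕ} {s t : EuclideanSpace ℝ (Fin m)}
    (hs : InCube s) (ht : InCube t) : ‖t - s‖ ^ 2 ≤ m := by
  have h := sq_norm_sub_add_add_le_of_inCube hs hs ht
  simp only [sub_self, norm_zero] at h
  linarith

/-- If the points of `T` are well separated then the projections of a point perturbed in two opposite
directions cannot both be close to the corner of the cube opposite to `a`. -/
theorem sq_norm_hullProj_sub_le_or {m : ℕ} (hm : 0 < m) {T : Finset (EuclideanSpace ℝ (Fin m))}
    (hT : T.Nonempty) (hcube : ∀ t ∈ T, InCube t)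
    (hsep : ∀ s ∈ T, ∀ t ∈ T, s ≠ t → (m : ℝ) / 25 < ‖s - t‖ ^ 2)
    {a x : EuclideanSpace ℝ (Fin m)} (ha : InCube a)
    (hx : x ∈ convexHull ℝ (T : Set (EuclideanSpace ℝ (Fin m)))) (hax : ‖x - a‖ ^ 2 ≤ m / 4)
    (u : EuclideanSpace ℝ (Fin m)) :
    ‖hullProj T (x + u) - a‖ ^ 2 ≤ 49 / 50 * m ∨ ‖hullProj T (x - u) - a‖ ^ 2 ≤ 49 / 50 * m := by
  by_contra hcon
  push Not at hcon
  obtain ⟨hy, hy'⟩ := hcon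
  have hm' : (0 : ℝ) < m := by exact_mod_cast hm
  -- Both projections are assumed to be far from `a`; each is replaced by a net point of its
  -- supporting hyperplane that is at least as far.
  obtain ⟨t, htT, ht0, hta⟩ := exists_mem_inner_eq_zero_of_hullProj hT (x + u) a
  obtain ⟨t', htT', ht0', hta'⟩ := exists_mem_inner_eq_zero_of_hullProj hT (x - u) a
  have hx1 := inner_sub_hullProj_nonpos hT (x + u) hx
  have hx2 := inner_sub_hullProj_nonpos hT (x - u) hx
  have hyc : InCube (hullProj T (x + u)) := InCube.of_mem_convexHull hcube (hullProj_mem hT _)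
  have hyc' : InCube (hullProj T (x - u)) := InCube.of_mem_convexHull hcube (hullProj_mem hT _)
  set y := hullProj T (x + u)
  set y' := hullProj T (x - u)
  have hta2 : ‖y - a‖ ^ 2 ≤ ‖t - a‖ ^ 2 := by gcongr
  have hta2' : ‖y' - a‖ ^ 2 ≤ ‖t' - a‖ ^ 2 := by gcongr
  -- Both squared distances to `a` exceed `49/50 m`, which leaves at most `2m - 98/50 m = m/25` for
  -- `‖t - t'‖²`, less than the separation.
  have htt : t = t' := by
    by_contra hne
    have h1 := hsep t htT t' htT' hne
    have h2 := sq_norm_sub_add_add_le_of_inCube ha (hcube t' htT') (hcube t htT)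
    linarith
  subst htt
  have hyt : ‖y - t‖ ^ 2 ≤ m / 25 := by
    have h2 := sq_norm_sub_add_add_le_of_inCube ha (hcube t htT) hyc
    linarith
  have hyt' : ‖y' - t‖ ^ 2 ≤ m / 25 := by
    have h2 := sq_norm_sub_add_add_le_of_inCube ha (hcube t htT) hyc'
    linarith
  -- On the left the first term is zero and the subtracted one is nonpositive, so `⟨y - x, t - x⟩ ≤
  -- ⟨u, t - x⟩`. With the analogue for `-u`, the vectors `y - x` and `y' - x` have inner products
  -- with `t - x` of nonpositive sum. But `y` and `y'` are within `r/5` of `t`, while `‖t - x‖ ≥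
  -- 2r/5`, so both inner products are positive.
  have e1 : inner ℝ (x + u - y) (t - y) - inner ℝ (x + u - y) (x - y)
      = inner ℝ u (t - x) - inner ℝ (y - x) (t - x) := by
    rw [← inner_sub_right, ← inner_sub_left]; congr 1 <;> abel
  have e2 : inner ℝ (x - u - y') (t - y') - inner ℝ (x - u - y') (x - y')
      = - inner ℝ u (t - x) - inner ℝ (y' - x) (t - x) := by
    rw [← inner_sub_right, ← inner_neg_left, ← inner_sub_left]; congr 1 <;> abel
  have f1 : inner ℝ (y - x) (t - x) = ‖t - x‖ ^ 2 + inner ℝ (y - t) (t - x) := by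
    rw [← real_inner_self_eq_norm_sq, ← inner_add_left]; congr 1; abel
  have f2 : inner ℝ (y' - x) (t - x) = ‖t - x‖ ^ 2 + inner ℝ (y' - t) (t - x) := by
    rw [← real_inner_self_eq_norm_sq, ← inner_add_left]; congr 1; abel
  have g1 := neg_le_of_abs_le (abs_real_inner_le_norm (y - t) (t - x))
  have g2 := neg_le_of_abs_le (abs_real_inner_le_norm (y' - t) (t - x))
  set r := Real.sqrt m
  have hr : r ^ 2 = m := Real.sq_sqrt hm'.le
  have hr0 : 0 < r := Real.sqrt_pos.2 hm'
  have b1 : ‖y - t‖ ≤ r / 5 := abs_le_of_sq_le_sq' (by rw [div_pow, hr]; linarith) (by positivity) |>.2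
  have b2 : ‖y' - t‖ ≤ r / 5 := abs_le_of_sq_le_sq' (by rw [div_pow, hr]; linarith) (by positivity) |>.2
  have b3 : ‖x - a‖ ≤ r / 2 := abs_le_of_sq_le_sq' (by rw [div_pow, hr]; linarith) (by positivity) |>.2
  have b4 : 9 / 10 * r ≤ ‖t - a‖ :=
    abs_le_of_sq_le_sq' (by rw [mul_pow, hr]; linarith) (by positivity) |>.2
  have b5 : ‖t - a‖ ≤ ‖t - x‖ + ‖x - a‖ := by simpa using norm_sub_le_norm_sub_add_norm_sub t x a
  have b6 : 2 / 5 * r ≤ ‖t - x‖ := by linarith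
  nlinarith [mul_le_mul_of_nonneg_right b1 (norm_nonneg (t - x)),
    mul_le_mul_of_nonneg_right b2 (norm_nonneg (t - x)),
    mul_le_mul_of_nonneg_right b6 (norm_nonneg (t - x)), mul_pos hr0 (show 0 < ‖t - x‖ by nlinarith)]

/-! ## The Frank–Wolfe method -/

/-- The usual `1/k` rate for the objective `‖y - w‖²`: the excess `h` over the optimum obeys `h (k +
1) ≤ (1 - γ) h k + γ² D` with `γ = 2 / (k + 2)`. The excess dominates `‖y - p‖²` by the optimality
of `p` (`hgap`), so the rate for the objective is also one for the squared distance. -/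
theorem sq_norm_frankWolfe_sub_le {F : Type*} [NormedAddCommGroup F] [InnerProductSpace ℝ F]
    {K : Set F} (hK : Convex ℝ K) {D : ℝ} (hD : ∀ p ∈ K, ∀ q ∈ K, ‖p - q‖ ^ 2 ≤ D)
    {w p : F} (hp : p ∈ K) (hopt : ∀ q ∈ K, inner ℝ (w - p) (q - p) ≤ 0)
    (y s : ℕ → F) (hy0 : y 0 ∈ K) (hs : ∀ k, s k ∈ K)
    (hstep : ∀ k : ℕ, y (k + 1) = y k + (2 / ((k : ℝ) + 2)) • (s k - y k))
    (hmin : ∀ k, inner ℝ (s k) (y k - w) ≤ inner ℝ p (y k - w)) (k : ℕ) :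
    ‖y k - p‖ ^ 2 ≤ 4 * D / (k + 2) := by
  have hyK : ∀ k, y k ∈ K := by
    intro k
    induction k with
    | zero => exact hy0
    | succ k ih =>
      rw [hstep]
      have h2 : (2 : ℝ) / ((k : ℝ) + 2) ≤ 1 := by rw [div_le_one (by positivity)]; linarith [k.cast_nonneg (α := ℝ)]
      exact hK.add_smul_sub_mem ih (hs k) ⟨by positivity, h2⟩
  have hD0 : 0 ≤ D := (sq_nonneg _).trans (hD p hp p hp)
  have hgap : ∀ q ∈ K, ‖q - p‖ ^ 2 ≤ ‖q - w‖ ^ 2 - ‖p - w‖ ^ 2 := by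
    intro q hq
    have e : ‖q - w‖ ^ 2 = ‖q - p‖ ^ 2 - 2 * inner ℝ (w - p) (q - p) + ‖p - w‖ ^ 2 := by
      have : q - w = (q - p) - (w - p) := by abel
      rw [this, norm_sub_sq_real, real_inner_comm, norm_sub_rev p w]
    linarith [hopt q hq]
  set h : ℕ → ℝ := fun k => ‖y k - w‖ ^ 2 - ‖p - w‖ ^ 2 with hh
  have hrec : ∀ k : ℕ, h (k + 1) ≤ (1 - 2 / ((k : ℝ) + 2)) * h k + (2 / ((k : ℝ) + 2)) ^ 2 * D := by
    intro k
    set γ : ℝ := 2 / ((k : ℝ) + 2)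
    have hγ : 0 ≤ γ := by positivity
    have e1 : ‖y (k + 1) - w‖ ^ 2 = ‖y k - w‖ ^ 2 + 2 * γ * inner ℝ (s k - y k) (y k - w)
        + γ ^ 2 * ‖s k - y k‖ ^ 2 := by
      have : y (k + 1) - w = (y k - w) + γ • (s k - y k) := by rw [hstep]; abel
      rw [this, norm_add_sq_real, inner_smul_right, norm_smul, mul_pow, Real.norm_eq_abs, sq_abs,
        real_inner_comm]
      ring
    have e2 : ‖p - w‖ ^ 2 = ‖y k - w‖ ^ 2 + 2 * inner ℝ (p - y k) (y k - w) + ‖p - y k‖ ^ 2 := by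
      have : p - w = (y k - w) + (p - y k) := by abel
      rw [this, norm_add_sq_real, real_inner_comm]
    have h1 := hmin k
    have h2 : inner ℝ (s k - y k) (y k - w) ≤ inner ℝ (p - y k) (y k - w) := by
      rw [inner_sub_left, inner_sub_left]; linarith
    have h3 := hD _ (hs k) _ (hyK k)
    have h4 : 2 * inner ℝ (p - y k) (y k - w) ≤ - h k := by
      simp only [hh]; nlinarith [sq_nonneg ‖p - y k‖]
    simp only [hh] at h4 ⊢
    rw [e1]
    nlinarith [mul_le_mul_of_nonneg_left h2 hγ, mul_le_mul_of_nonneg_left h4 hγ,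
      mul_le_mul_of_nonneg_left h3 (sq_nonneg γ)]
  -- The induction starts at iterate `1`: the first step has `γ = 1`, so the initial excess, which
  -- `D` does not bound, drops out.
  have hbound : ∀ k : ℕ, h (k + 1) ≤ 4 * D / ((k : ℝ) + 3) := by
    intro k
    induction k with
    | zero =>
      have := hrec 0
      norm_num at this ⊢
      linarith
    | succ k ih =>
      have h1 := hrec (k + 1)
      push_cast at h1 ⊢
      have hk : (0 : ℝ) ≤ k := k.cast_nonneg
      have h2 : (0 : ℝ) ≤ 1 - 2 / ((k : ℝ) + 1 + 2) := by
        rw [sub_nonneg, div_le_one (by positivity)]; linarith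
      have h3 := mul_le_mul_of_nonneg_left ih h2
      refine h1.trans ((add_le_add_left h3 _).trans ?_)
      rw [← sub_nonneg]
      have : 4 * D / ((k : ℝ) + 1 + 3) - ((1 - 2 / ((k : ℝ) + 1 + 2)) * (4 * D / ((k : ℝ) + 3))
          + (2 / ((k : ℝ) + 1 + 2)) ^ 2 * D) = 4 * D / (((k : ℝ) + 4) * ((k : ℝ) + 3) ^ 2) := by
        have a1 : (k : ℝ) + 1 + 3 ≠ 0 := by positivity
        have a2 : (k : ℝ) + 1 + 2 ≠ 0 := by positivity
        have a3 : (k : ℝ) + 3 ≠ 0 := by positivity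
        have a4 : (k : ℝ) + 4 ≠ 0 := by positivity
        field_simp
        ring
      rw [this]; positivity
  cases k with
  | zero =>
    have := hD _ hy0 _ hp
    norm_num
    linarith
  | succ k =>
    refine (hgap _ (hyK _)).trans ((hbound k).trans (le_of_eq ?_))
    push_cast; ring

/-! ## Rényi divergence: data processing and the Gaussian shift -/

/-- Data processing by duality. With `h` and `g` the densities after and before the map, `∫ h^γ` is
the integral of `h^(γ-1)` against the image of `P`, that is `∫ g (h ∘ f)^(γ-1) ∂Q`. Hölder's
inequality bounds this by `B^(1/γ) A^(1-1/γ)`, where `B = ∫ g^γ` and `A` is the integral being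
bounded, and dividing gives `A ≤ B`. -/
theorem lintegral_rnDeriv_map_rpow_le {Ω Ω' : Type*} [MeasurableSpace Ω] [MeasurableSpace Ω']
    {P Q : Measure Ω} [IsProbabilityMeasure P] [IsProbabilityMeasure Q] (hPQ : P ≪ Q)
    {f : Ω → Ω'} (hf : Measurable f) {γ : ℝ} (hγ : 1 < γ) :
    ∫⁻ x, (P.map f).rnDeriv (Q.map f) x ^ γ ∂(Q.map f) ≤ ∫⁻ x, P.rnDeriv Q x ^ γ ∂Q := by
  have : IsProbabilityMeasure (P.map f) := Measure.isProbabilityMeasure_map hf.aemeasurable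
  have : IsProbabilityMeasure (Q.map f) := Measure.isProbabilityMeasure_map hf.aemeasurable
  have hac : P.map f ≪ Q.map f := hPQ.map hf
  set h := (P.map f).rnDeriv (Q.map f) with hh
  have hhm : Measurable h := Measure.measurable_rnDeriv _ _
  set g := P.rnDeriv Q with hg
  have hgm : Measurable g := Measure.measurable_rnDeriv _ _
  set B := ∫⁻ x, g x ^ γ ∂Q with hB
  -- Truncation makes `A` finite, so that the division is legitimate; monotone convergence removes
  -- it at the end.
  set t : ℕ → Ω' → ℝ≥0∞ := fun k x => min (h x) k with ht
  have htm : ∀ k, Measurable (t k) := fun k => hhm.min measurable_const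
  have hγ0 : 0 < γ := by linarith
  have hbound : ∀ k, ∫⁻ x, t k x ^ γ ∂(Q.map f) ≤ B := by
    intro k
    set A := ∫⁻ x, t k x ^ γ ∂(Q.map f) with hA
    have hAtop : A ≠ ⊤ := by
      have : A ≤ ∫⁻ _, (k : ℝ≥0∞) ^ γ ∂(Q.map f) := by
        refine lintegral_mono fun x => ?_
        exact ENNReal.rpow_le_rpow (min_le_right _ _) hγ0.le
      refine ne_top_of_le_ne_top ?_ this
      simp [ENNReal.rpow_eq_top_iff, hγ0.le]
    have hpq : γ.HolderConjugate (γ / (γ - 1)) := by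
      rw [Real.holderConjugate_iff]
      refine ⟨hγ, ?_⟩
      have : γ - 1 ≠ 0 := by linarith
      field_simp
      ring
    have h1 : A ≤ ∫⁻ x, h x * t k x ^ (γ - 1) ∂(Q.map f) := by
      refine lintegral_mono fun x => ?_
      have : t k x ^ γ = t k x * t k x ^ (γ - 1) := by
        nth_rewrite 2 [← ENNReal.rpow_one (t k x)]
        rw [← ENNReal.rpow_add_of_nonneg _ _ zero_le_one (by linarith)]
        ring_nf
      simp only [this]
      gcongr
      exact min_le_left _ _
    have h2 : ∫⁻ x, h x * t k x ^ (γ - 1) ∂(Q.map f) = ∫⁻ x, g x * t k (f x) ^ (γ - 1) ∂Q := by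
      have hm1 : Measurable fun x => t k x ^ (γ - 1) := (htm k).pow_const _
      rw [lintegral_rnDeriv_mul hac hm1.aemeasurable, lintegral_map hm1 hf]
      exact (lintegral_rnDeriv_mul hPQ (hm1.comp hf).aemeasurable).symm
    have h3 : ∫⁻ x, g x * t k (f x) ^ (γ - 1) ∂Q ≤ B ^ (1 / γ) * A ^ (1 / (γ / (γ - 1))) := by
      refine (ENNReal.lintegral_mul_le_Lp_mul_Lq Q hpq hgm.aemeasurable
        (((htm k).comp hf).pow_const _).aemeasurable).trans (le_of_eq ?_)
      congr 2
      rw [hA, lintegral_map ((htm k).pow_const _) hf]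
      refine lintegral_congr fun x => ?_
      simp only [Function.comp]
      rw [← ENNReal.rpow_mul]
      congr 1
      have : γ - 1 ≠ 0 := by linarith
      field_simp
    have h4 : A ≤ B ^ (1 / γ) * A ^ (1 / (γ / (γ - 1))) := h1.trans (h2.trans_le h3)
    rcases eq_or_ne A 0 with hA0 | hA0
    · rw [hA0]; exact zero_le
    have hexp : (1 : ℝ) / (γ / (γ - 1)) = 1 - 1 / γ := by field_simp
    rw [hexp, ENNReal.rpow_sub _ _ hA0 hAtop, ENNReal.rpow_one] at h4
    have hAγ0 : A ^ (1 / γ) ≠ 0 := by simp [ENNReal.rpow_eq_zero_iff, hA0, hAtop]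
    have hAγt : A ^ (1 / γ) ≠ ⊤ := by simp [ENNReal.rpow_eq_top_iff, hA0, hAtop]
    have h5 : A * A ^ (1 / γ) ≤ B ^ (1 / γ) * A := by
      rw [mul_div_assoc'] at h4
      exact (ENNReal.le_div_iff_mul_le (Or.inl hAγ0) (Or.inl hAγt)).1 h4
    rw [mul_comm] at h5
    have h6 := (ENNReal.mul_le_mul_iff_left hA0 hAtop).1 h5
    exact (ENNReal.rpow_le_rpow_iff (by positivity)).1 h6
  have hlim : Filter.Tendsto (fun k => ∫⁻ x, t k x ^ γ ∂(Q.map f)) Filter.atTop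
      (nhds (∫⁻ x, h x ^ γ ∂(Q.map f))) := by
    refine lintegral_tendsto_of_tendsto_of_monotone (fun k => ((htm k).pow_const _).aemeasurable)
      (Filter.Eventually.of_forall fun x => ?_) (Filter.Eventually.of_forall fun x => ?_)
    · intro k l hkl
      have : (k : ℝ≥0∞) ≤ l := by exact_mod_cast hkl
      exact ENNReal.rpow_le_rpow (min_le_min le_rfl this) hγ0.le
    · have h1 : Filter.Tendsto (fun k : ℕ => t k x) Filter.atTop (nhds (min (h x) ⊤)) :=
        tendsto_const_nhds.min ENNReal.tendsto_nat_nhds_top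
      rw [min_top_right] at h1
      exact (ENNReal.continuous_rpow_const.tendsto _).comp h1
  exact le_of_tendsto' hlim hbound

theorem renyiDiv_map_le {Ω Ω' : Type*} [MeasurableSpace Ω] [MeasurableSpace Ω']
    {P Q : Measure Ω} [IsProbabilityMeasure P] [IsProbabilityMeasure Q]
    {f : Ω → Ω'} (hf : Measurable f) {γ : ℝ} (hγ : 1 < γ) :
    renyiDiv γ (P.map f) (Q.map f) ≤ renyiDiv γ P Q := by
  by_cases hPQ : P ≪ Q
  · rw [renyiDiv, renyiDiv, if_pos hPQ, if_pos (hPQ.map hf)]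
    refine mul_le_mul_of_nonneg_left
      (ENNReal.log_monotone (lintegral_rnDeriv_map_rpow_le hPQ hf hγ)) ?_
    have : 0 ≤ (γ - 1)⁻¹ := inv_nonneg.2 (by linarith)
    exact_mod_cast this
  · rw [renyiDiv, renyiDiv, if_neg hPQ]
    exact le_top

/-! ### Translates of the standard Gaussian. -/

theorem pi_withDensity {ι : Type*} [Fintype ι] {X : ι → Type*} [∀ i, MeasurableSpace (X i)]
    (μ : ∀ i, Measure (X i)) [∀ i, IsProbabilityMeasure (μ i)] (f : ∀ i, X i → ℝ≥0∞)
    (hf : ∀ i, Measurable (f i)) [∀ i, SigmaFinite ((μ i).withDensity (f i))] :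
    Measure.pi (fun i => (μ i).withDensity (f i)) =
      (Measure.pi μ).withDensity (fun x => ∏ i, f i (x i)) := by
  classical
  refine (Measure.pi_eq fun s hs => ?_)
  rw [withDensity_apply _ (MeasurableSet.univ_pi hs), ← lintegral_indicator (MeasurableSet.univ_pi hs)]
  have h1 : ∀ x : ∀ i, X i, (Set.univ.pi s).indicator (fun x => ∏ i, f i (x i)) x
      = ∏ i, (s i).indicator (f i) (x i) := by
    intro x
    by_cases hx : x ∈ Set.univ.pi s
    · rw [Set.indicator_of_mem hx]
      refine Finset.prod_congr rfl fun i _ => ?_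
      rw [Set.indicator_of_mem (hx i (Set.mem_univ i))]
    · rw [Set.indicator_of_notMem hx]
      simp only [Set.mem_pi, Set.mem_univ, true_imp_iff, not_forall] at hx
      obtain ⟨i, hi⟩ := hx
      exact (Finset.prod_eq_zero (Finset.mem_univ i) (Set.indicator_of_notMem hi _)).symm
  simp only [h1]
  have hind := lintegral_prod_eq_prod_lintegral_of_indepFun (μ := Measure.pi μ) Finset.univ
    (fun i (x : ∀ i, X i) => (s i).indicator (f i) (x i))
    (iIndepFun_pi (X := fun i => (s i).indicator (f i))
      (fun i => ((hf i).indicator (hs i)).aemeasurable))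
    (fun i => ((hf i).indicator (hs i)).comp (measurable_pi_apply i))
  rw [hind]
  refine Finset.prod_congr rfl fun i _ => ?_
  rw [withDensity_apply _ (hs i), ← lintegral_indicator (hs i)]
  have hmp := (measurePreserving_eval μ i)
  exact (hmp.lintegral_comp ((hf i).indicator (hs i)))

theorem gaussianReal_eq_withDensity (a : ℝ) :
    gaussianReal a 1 = (gaussianReal 0 1).withDensity
      (fun x => ENNReal.ofReal (Real.exp (a * x - a ^ 2 / 2))) := by
  rw [gaussianReal_of_var_ne_zero a one_ne_zero, gaussianReal_of_var_ne_zero 0 one_ne_zero,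
    ← withDensity_mul _ (measurable_gaussianPDF _ _) (by fun_prop)]
  congr 1
  ext x
  simp only [Pi.mul_apply, gaussianPDF]
  rw [← ENNReal.ofReal_mul (gaussianPDFReal_nonneg _ _ _)]
  congr 1
  have h : Real.exp (-(x - a) ^ 2 / (2 * ((1 : NNReal) : ℝ)))
      = Real.exp (-(x - 0) ^ 2 / (2 * ((1 : NNReal) : ℝ))) * Real.exp (a * x - a ^ 2 / 2) := by
    rw [← Real.exp_add]
    congr 1
    simp
    ring
  simp only [gaussianPDFReal, h]
  ring

/-- The Cameron–Martin formula: the one-dimensional density ratios multiply over the coordinates,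
and their exponents add up to `⟨v, z⟩ - ‖v‖² / 2`. -/
theorem stdGaussian_map_add {m : ℕ} (v : EuclideanSpace ℝ (Fin m)) :
    (stdGaussian (EuclideanSpace ℝ (Fin m))).map (fun z => z + v) =
      (stdGaussian (EuclideanSpace ℝ (Fin m))).withDensity
        (fun z => ENNReal.ofReal (Real.exp (inner ℝ v z - ‖v‖ ^ 2 / 2))) := by
  set π := Measure.pi (fun _ : Fin m => gaussianReal 0 1) with hπ
  have hLm : Measurable (WithLp.toLp 2 : (Fin m → ℝ) → EuclideanSpace ℝ (Fin m)) := by fun_prop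
  have hpi : π.map (fun x i => x i + v i) = π.withDensity
      (fun x => ∏ i, ENNReal.ofReal (Real.exp (v i * x i - v i ^ 2 / 2))) := by
    have e1 : π.map (fun x i => x i + v i) = Measure.pi (fun i => gaussianReal (v i) 1) := by
      rw [hπ, Measure.pi_map_pi (μ := fun _ : Fin m => gaussianReal 0 1)
        (f := fun i (x : ℝ) => x + v i) (fun i => by fun_prop)]
      simp [gaussianReal_map_add_const]
    have : ∀ i, SigmaFinite ((gaussianReal 0 1).withDensity
        (fun x => ENNReal.ofReal (Real.exp (v i * x - v i ^ 2 / 2)))) := by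
      intro i; rw [← gaussianReal_eq_withDensity]; infer_instance
    rw [e1, hπ, ← pi_withDensity (fun _ : Fin m => gaussianReal 0 1)
      (fun i x => ENNReal.ofReal (Real.exp (v i * x - v i ^ 2 / 2))) (fun i => by fun_prop)]
    simp only [← gaussianReal_eq_withDensity]
  rw [← map_pi_eq_stdGaussian, Measure.map_map (by fun_prop) hLm]
  have e2 : (fun z : EuclideanSpace ℝ (Fin m) => z + v) ∘ (WithLp.toLp 2)
      = (WithLp.toLp 2) ∘ (fun (x : Fin m → ℝ) i => x i + v i) := by
    funext x; rfl
  rw [e2, ← Measure.map_map hLm (by fun_prop), hpi]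
  refine Measure.ext fun s hs => ?_
  rw [Measure.map_apply hLm hs, withDensity_apply _ (hLm hs), withDensity_apply _ hs,
    setLIntegral_map hs (by fun_prop) hLm]
  refine lintegral_congr fun x => ?_
  rw [← ENNReal.ofReal_prod_of_nonneg (fun i _ => (Real.exp_pos _).le), ← Real.exp_sum]
  congr 2
  rw [Finset.sum_sub_distrib, EuclideanSpace.real_norm_sq_eq, PiLp.inner_apply, Finset.sum_div]
  congr 1
  refine Finset.sum_congr rfl fun i _ => ?_
  simp [mul_comm]

theorem stdGaussian_map_inner {m : ℕ} (v : EuclideanSpace ℝ (Fin m)) :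
    (stdGaussian (EuclideanSpace ℝ (Fin m))).map (fun z => inner ℝ v z) =
      gaussianReal 0 (‖v‖ ^ 2).toNNReal := by
  have h := IsGaussian.map_eq_gaussianReal (μ := stdGaussian (EuclideanSpace ℝ (Fin m)))
    (innerSL ℝ v)
  rw [integral_strongDual_stdGaussian, variance_dual_stdGaussian, innerSL_apply_norm] at h
  exact h

theorem integrable_exp_inner_stdGaussian {m : ℕ} (v : EuclideanSpace ℝ (Fin m)) :
    Integrable (fun z => Real.exp (inner ℝ v z)) (stdGaussian (EuclideanSpace ℝ (Fin m))) := by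
  have h := integrable_exp_mul_gaussianReal (μ := 0) (v := (‖v‖ ^ 2).toNNReal) 1
  rw [← stdGaussian_map_inner v] at h
  have := (integrable_map_measure h.aestronglyMeasurable (by fun_prop)).1 h
  simpa [Function.comp_def] using this

theorem integral_exp_inner_stdGaussian {m : ℕ} (v : EuclideanSpace ℝ (Fin m)) :
    ∫ z, Real.exp (inner ℝ v z) ∂(stdGaussian (EuclideanSpace ℝ (Fin m)))
      = Real.exp (‖v‖ ^ 2 / 2) := by
  have h := mgf_gaussianReal (stdGaussian_map_inner v) 1
  simpa [mgf, Real.coe_toNNReal _ (sq_nonneg _)] using h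

/-- The `γ`-th power of the density is `exp (⟨γ v, z⟩ - γ ‖v‖² / 2)`. By the Gaussian moment
generating function its mean is `exp (γ (γ - 1) ‖v‖² / 2)`, and the prefactor `1 / (γ - 1)` cancels.
-/
theorem renyiDiv_stdGaussian_map_add_le {m : ℕ} (v : EuclideanSpace ℝ (Fin m)) {γ : ℝ}
    (hγ : 1 < γ) :
    renyiDiv γ ((stdGaussian (EuclideanSpace ℝ (Fin m))).map (fun z => z + v))
      (stdGaussian (EuclideanSpace ℝ (Fin m))) ≤ ((γ * (‖v‖ ^ 2 / 2) : ℝ) : EReal) := by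
  set G := stdGaussian (EuclideanSpace ℝ (Fin m))
  have hdm : Measurable fun z : EuclideanSpace ℝ (Fin m) =>
      ENNReal.ofReal (Real.exp (inner ℝ v z - ‖v‖ ^ 2 / 2)) := by fun_prop
  rw [stdGaussian_map_add, renyiDiv, if_pos (withDensity_absolutelyContinuous _ _)]
  have e : ∫⁻ x, (G.withDensity fun z => ENNReal.ofReal (Real.exp (inner ℝ v z - ‖v‖ ^ 2 / 2))).rnDeriv
      G x ^ γ ∂G = ENNReal.ofReal (Real.exp (γ * (γ - 1) * (‖v‖ ^ 2 / 2))) := by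
    have h1 := Measure.rnDeriv_withDensity G hdm
    rw [lintegral_congr_ae (h1.mono fun x hx => by
      show _ = ENNReal.ofReal (Real.exp (inner ℝ (γ • v) x) * Real.exp (- (γ * (‖v‖ ^ 2 / 2))))
      simp only [hx]
      rw [ENNReal.ofReal_rpow_of_pos (Real.exp_pos _), ← Real.exp_mul, ← Real.exp_add,
        real_inner_smul_left]
      congr 2; ring)]
    rw [← ofReal_integral_eq_lintegral_ofReal
      ((integrable_exp_inner_stdGaussian (γ • v)).mul_const _)
      (Filter.Eventually.of_forall fun x => by positivity), integral_mul_const,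
      integral_exp_inner_stdGaussian, ← Real.exp_add, norm_smul, mul_pow, Real.norm_eq_abs, sq_abs]
    congr 2; ring
  rw [e, ENNReal.log_ofReal_of_pos (Real.exp_pos _), Real.log_exp, ← EReal.coe_mul]
  apply le_of_eq
  congr 1
  have : γ - 1 ≠ 0 := by linarith
  field_simp

/-- The Gaussian mechanism followed by an arbitrary measurable map. -/
theorem renyiDiv_map_gaussian_le {m : ℕ} {Ω : Type*} [MeasurableSpace Ω]
    {f : EuclideanSpace ℝ (Fin m) → Ω} (hf : Measurable f) {σ : ℝ} (hσ : 0 < σ)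
    (a b : EuclideanSpace ℝ (Fin m)) {γ : ℝ} (hγ : 1 < γ) :
    renyiDiv γ ((stdGaussian (EuclideanSpace ℝ (Fin m))).map (fun z => f (a + σ • z)))
      ((stdGaussian (EuclideanSpace ℝ (Fin m))).map (fun z => f (b + σ • z)))
      ≤ ((γ * (‖a - b‖ ^ 2 / (2 * σ ^ 2)) : ℝ) : EReal) := by
  set G := stdGaussian (EuclideanSpace ℝ (Fin m))
  -- The shift in units of the noise: `a + σ z = b + σ (z + v)`, so both laws are images of a
  -- Gaussian and of its translate under the same map.
  set v := σ⁻¹ • (a - b) with hv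
  have hg : Measurable fun z : EuclideanSpace ℝ (Fin m) => f (b + σ • z) := hf.comp (by fun_prop)
  have e : G.map (fun z => f (a + σ • z)) = (G.map (fun z => z + v)).map (fun z => f (b + σ • z)) := by
    rw [Measure.map_map hg (by fun_prop)]
    congr 1
    funext z
    simp only [Function.comp, hv, smul_add, smul_smul, mul_inv_cancel₀ hσ.ne', one_smul]
    congr 1; abel
  have : IsProbabilityMeasure (G.map (fun z => z + v)) :=
    Measure.isProbabilityMeasure_map (by fun_prop)
  rw [e]
  refine (renyiDiv_map_le hg hγ).trans ((renyiDiv_stdGaussian_map_add_le v hγ).trans (le_of_eq ?_))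
  congr 2
  rw [hv, norm_smul, mul_pow, norm_inv, Real.norm_eq_abs, inv_pow, sq_abs]
  field_simp

/-! ## Separation numbers -/

/-- The supremum in `coarseBound`. -/
noncomputable def coarseSup {m : ℕ} (C : ℝ) (X : Finset (EuclideanSpace ℝ (Fin m))) (α : ℝ) : ℝ :=
  sSup {s : ℝ | ∃ t : ℝ, α / C ≤ t ∧ s = t * Real.sqrt (Real.log (sepNumber X t))}

theorem packingNumber_ne_top {m : ℕ} (X : Finset (EuclideanSpace ℝ (Fin m))) (ε : NNReal) :
    Metric.packingNumber ε (X : Set (EuclideanSpace ℝ (Fin m))) ≠ ⊤ :=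
  ne_top_of_le_ne_top (by simp) (Metric.packingNumber_le_encard_self _)

theorem sepNumber_le_card {m : ℕ} (X : Finset (EuclideanSpace ℝ (Fin m))) (t : ℝ) :
    sepNumber X t ≤ X.card := by
  have h := ENat.toNat_le_toNat (Metric.packingNumber_le_encard_self (ε := Real.toNNReal (t * Real.sqrt m))
    (X : Set (EuclideanSpace ℝ (Fin m)))) (by simp)
  simpa [sepNumber] using h

theorem card_le_sepNumber {m : ℕ} {X N : Finset (EuclideanSpace ℝ (Fin m))} (hN : N ⊆ X) {t : ℝ}
    (hsep : ∀ x ∈ N, ∀ y ∈ N, x ≠ y → t * Real.sqrt m < dist x y) : N.card ≤ sepNumber X t := by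
  have h1 : Metric.IsSeparated (Real.toNNReal (t * Real.sqrt m) : ℝ≥0∞)
      (N : Set (EuclideanSpace ℝ (Fin m))) := by
    intro x hx y hy hxy
    have := hsep x hx y hy hxy
    rw [edist_dist]
    exact (ENNReal.ofReal_lt_ofReal_iff (dist_pos.2 hxy)).2 this
  have h2 := ENat.toNat_le_toNat
    (h1.encard_le_packingNumber (A := (X : Set (EuclideanSpace ℝ (Fin m)))) (by exact_mod_cast hN))
    (packingNumber_ne_top X _)
  simpa [sepNumber] using h2

theorem dist_le_sqrt_of_inCube {m : ℕ} {s t : EuclideanSpace ℝ (Fin m)}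
    (hs : InCube s) (ht : InCube t) : dist s t ≤ Real.sqrt m := by
  rw [dist_eq_norm]
  exact Real.le_sqrt_of_sq_le (sq_norm_sub_le_of_inCube ht hs)

theorem sepNumber_le_one {m : ℕ} {X : Finset (EuclideanSpace ℝ (Fin m))}
    (hX : ∀ x ∈ X, InCube x) {t : ℝ} (ht : 1 ≤ t) : sepNumber X t ≤ 1 := by
  have h : Metric.packingNumber (Real.toNNReal (t * Real.sqrt m))
      (X : Set (EuclideanSpace ℝ (Fin m))) ≤ 1 := by
    refine iSup_le fun C => iSup_le fun hC => iSup_le fun hsep => ?_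
    rw [Set.encard_le_one_iff]
    intro a b ha hb
    by_contra hab
    have h1 : _ < edist a b := hsep ha hb hab
    rw [edist_dist] at h1
    have h2 : t * Real.sqrt m < dist a b :=
      (ENNReal.ofReal_lt_ofReal_iff (dist_pos.2 hab)).1 h1
    have h3 := dist_le_sqrt_of_inCube (hX a (hC ha)) (hX b (hC hb))
    nlinarith [Real.sqrt_nonneg (m : ℝ)]
  simpa [sepNumber] using ENat.toNat_le_toNat h (by simp)

/-- The content is boundedness, as a real `sSup` of an unbounded set would be `0`. For scales at
least `1` the separation number is at most `1` and the term vanishes; below `1` the term is at most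
`√(log |X|)`. -/
theorem le_coarseSup {m : ℕ} {C : ℝ} {X : Finset (EuclideanSpace ℝ (Fin m))}
    (hX : ∀ x ∈ X, InCube x) {α t : ℝ} (hαC : 0 ≤ α / C) (ht : α / C ≤ t) :
    t * Real.sqrt (Real.log (sepNumber X t)) ≤ coarseSup C X α := by
  refine le_csSup ⟨Real.sqrt (Real.log X.card), ?_⟩ ⟨t, ht, rfl⟩
  rintro _ ⟨s, hs, rfl⟩
  have hs0 : 0 ≤ s := hαC.trans hs
  rcases le_or_gt 1 s with h1 | h1
  · have : Real.log (sepNumber X s) = 0 := by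
      have := sepNumber_le_one hX h1
      interval_cases (sepNumber X s) <;> simp
    rw [this, Real.sqrt_zero, mul_zero]
    positivity
  · have h2 : Real.sqrt (Real.log (sepNumber X s)) ≤ Real.sqrt (Real.log X.card) := by
      rcases Nat.eq_zero_or_pos (sepNumber X s) with h | h
      · simp [h]
      · gcongr
        exact sepNumber_le_card X s
    nlinarith [Real.sqrt_nonneg (Real.log (sepNumber X s))]

theorem coarseSup_nonneg {m : ℕ} {C : ℝ} {X : Finset (EuclideanSpace ℝ (Fin m))} {α : ℝ}
    (hαC : 0 ≤ α / C) : 0 ≤ coarseSup C X α := by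
  refine Real.sSup_nonneg ?_
  rintro _ ⟨s, hs, rfl⟩
  exact mul_nonneg (hαC.trans hs) (Real.sqrt_nonneg _)

/-- Two points at distance `d √m` form a packing at scale `d/2`. This scale is at least `α/4`, hence
admissible for `C = 4`, and since `√(log 2) ≥ 1/2` it contributes at least `d/4`. -/
theorem dist_le_coarseSup {m : ℕ} (hm : 0 < m) {X : Finset (EuclideanSpace ℝ (Fin m))}
    (hX : ∀ x ∈ X, InCube x) {α : ℝ} (hα : 0 < α) {p q : EuclideanSpace ℝ (Fin m)}
    (hp : p ∈ X) (hq : q ∈ X) (hpq : α / 2 ≤ dist p q / Real.sqrt m) :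
    dist p q ≤ 4 * Real.sqrt m * coarseSup 4 X α := by
  classical
  have hr : 0 < Real.sqrt m := Real.sqrt_pos.2 (by exact_mod_cast hm)
  set d := dist p q / Real.sqrt m with hd
  have hdd : dist p q = d * Real.sqrt m := (div_mul_cancel₀ _ hr.ne').symm
  have hd0 : 0 < d := by linarith
  have hne : p ≠ q := by
    rintro rfl
    simp at hdd
    rcases hdd with h | h
    · linarith
    · omega
  have h1 : ({p, q} : Finset (EuclideanSpace ℝ (Fin m))).card ≤ sepNumber X (d / 2) := by
    refine card_le_sepNumber (by simp [Finset.insert_subset_iff, hp, hq]) ?_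
    have h2 : d / 2 * Real.sqrt m < dist p q := by rw [hdd]; nlinarith
    intro x hx y hy hxy
    simp only [Finset.mem_insert, Finset.mem_singleton] at hx hy
    rcases hx with rfl | rfl <;> rcases hy with rfl | rfl
    · exact absurd rfl hxy
    · exact h2
    · rwa [dist_comm]
    · exact absurd rfl hxy
  rw [Finset.card_pair hne] at h1
  have h3 := le_coarseSup hX (C := 4) (α := α) (t := d / 2) (by positivity) (by linarith)
  have h4 : (1 : ℝ) / 2 ≤ Real.sqrt (Real.log (sepNumber X (d / 2))) := by
    refine Real.le_sqrt_of_sq_le ?_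
    have h5 : Real.log 2 ≤ Real.log (sepNumber X (d / 2)) :=
      Real.log_le_log (by norm_num) (by exact_mod_cast h1)
    linarith [Real.log_two_gt_d9]
  have h6 : d / 4 ≤ coarseSup 4 X α := by nlinarith
  rw [hdd]
  nlinarith

/-! ## Gaussian width -/

/-- The support function of `S` at a standard Gaussian is dominated by a function of mean at most
`w`. -/
def GaussianWidthLE {m : ℕ} (S : Finset (EuclideanSpace ℝ (Fin m))) (w : ℝ) : Prop :=
  ∃ B : EuclideanSpace ℝ (Fin m) → ℝ, Integrable B (stdGaussian (EuclideanSpace ℝ (Fin m))) ∧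
    (∀ z, ∀ u ∈ S, inner ℝ u z ≤ B z) ∧ ∫ z, B z ∂(stdGaussian (EuclideanSpace ℝ (Fin m))) ≤ w

theorem integrable_inner_stdGaussian {m : ℕ} (v : EuclideanSpace ℝ (Fin m)) :
    Integrable (fun z => inner ℝ v z) (stdGaussian (EuclideanSpace ℝ (Fin m))) :=
  (IsGaussian.integrable_id (μ := stdGaussian (EuclideanSpace ℝ (Fin m)))).const_inner v

theorem integral_inner_stdGaussian {m : ℕ} (v : EuclideanSpace ℝ (Fin m)) :
    ∫ z, inner ℝ v z ∂(stdGaussian (EuclideanSpace ℝ (Fin m))) = 0 :=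
  integral_strongDual_stdGaussian (innerSL ℝ v)

theorem GaussianWidthLE.of_card_le_one {m : ℕ} {S : Finset (EuclideanSpace ℝ (Fin m))}
    (hS : S.card ≤ 1) : GaussianWidthLE S 0 := by
  obtain ⟨v, hv⟩ := Finset.card_le_one_iff_subset_singleton.1 hS
  refine ⟨fun z => inner ℝ v z, integrable_inner_stdGaussian v, fun z u hu => ?_,
    (integral_inner_stdGaussian v).le⟩
  rw [Finset.mem_singleton.1 (hv hu)]

/-- The maximal inequality for finitely many Gaussians. The tangent line bound `y + 1 ≤ exp y` at `y
= l ⟨u, z⟩ - c` gives an explicit dominating function: `l ⟨u, z⟩` is at most `c - 1` plus the sum of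
all the exponentials. -/
theorem gaussianWidthLE_of_norm_le {m : ℕ} (S : Finset (EuclideanSpace ℝ (Fin m))) {R : ℝ}
    (hR : 0 < R) (hS : ∀ u ∈ S, ‖u‖ ≤ R) {N : ℕ} (hN : S.card ≤ N) :
    GaussianWidthLE S (R * Real.sqrt (2 * Real.log N)) := by
  rcases Nat.lt_or_ge N 2 with hN1 | hN1
  · have h0 : Real.log N = 0 := by interval_cases N <;> simp
    rw [h0, mul_zero, Real.sqrt_zero, mul_zero]
    exact GaussianWidthLE.of_card_le_one (by omega)
  have hNr : (1 : ℝ) < N := by exact_mod_cast hN1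
  have hl : 0 < Real.log N := Real.log_pos hNr
  set q := Real.sqrt (2 * Real.log N) with hq
  have hq2 : q ^ 2 = 2 * Real.log N := Real.sq_sqrt (by positivity)
  have hq0 : 0 < q := Real.sqrt_pos.2 (by positivity)
  -- With `q² = c = 2 log N` each exponential has mean at most `exp (q² / 2 - c) = 1/N`, so the sum
  -- has mean at most `1`, and what remains is `c / l = R q`.
  set l := q / R with hl'
  have hl0 : 0 < l := by positivity
  set c := 2 * Real.log N with hc
  set G := stdGaussian (EuclideanSpace ℝ (Fin m))
  have hint : ∀ u : EuclideanSpace ℝ (Fin m), Integrable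
      (fun z => Real.exp (inner ℝ (l • u) z) * Real.exp (-c)) G :=
    fun u => (integrable_exp_inner_stdGaussian (l • u)).mul_const _
  have hexp : ∀ v : EuclideanSpace ℝ (Fin m),
      ∫ z, Real.exp (inner ℝ v z) ∂G = Real.exp (‖v‖ ^ 2 / 2) := integral_exp_inner_stdGaussian
  refine ⟨fun z => l⁻¹ * (c - 1 + ∑ u ∈ S, Real.exp (inner ℝ (l • u) z) * Real.exp (-c)),
    ?_, ?_, ?_⟩
  · exact ((integrable_const _).add (integrable_finsetSum _ fun u _ => hint u)).const_mul _
  · intro z u hu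
    have h1 : l * inner ℝ u z - c + 1 ≤ Real.exp (inner ℝ (l • u) z) * Real.exp (-c) := by
      rw [← Real.exp_add, real_inner_smul_left]
      linarith [Real.add_one_le_exp (l * inner ℝ u z + -c)]
    have h2 := Finset.single_le_sum
      (f := fun u => Real.exp (inner ℝ (l • u) z) * Real.exp (-c)) (fun u _ => by positivity) hu
    simp only at h2 ⊢
    rw [inv_mul_eq_div, le_div_iff₀ hl0]
    linarith
  · rw [integral_const_mul, integral_add (integrable_const _)
      (integrable_finsetSum _ fun u _ => hint u), integral_finsetSum _ fun u _ => hint u]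
    simp only [integral_mul_const, hexp, integral_const]
    have h1 : ∑ u ∈ S, Real.exp (‖l • u‖ ^ 2 / 2) * Real.exp (-c) ≤ 1 := by
      have : ∀ u ∈ S, Real.exp (‖l • u‖ ^ 2 / 2) * Real.exp (-c) ≤ (N : ℝ)⁻¹ := by
        intro u hu
        rw [← Real.exp_add, ← Real.exp_log (show (0 : ℝ) < N by linarith), ← Real.exp_neg]
        apply Real.exp_le_exp.2
        rw [norm_smul, Real.norm_eq_abs, abs_of_pos hl0]
        have h3 : l * ‖u‖ ≤ q := by
          calc l * ‖u‖ ≤ l * R := by gcongr; exact hS u hu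
            _ = q := by rw [hl']; field_simp
        have h4 : (l * ‖u‖) ^ 2 ≤ q ^ 2 := by gcongr
        simp only [hc]
        linarith
      refine (Finset.sum_le_sum this).trans ?_
      rw [Finset.sum_const, nsmul_eq_mul, ← div_eq_mul_inv, div_le_one (by linarith)]
      exact_mod_cast hN
    have h2 : l⁻¹ * c = R * q := by
      rw [← hq2, hl']; field_simp
    rw [← h2]
    have : (0 : ℝ) ≤ l⁻¹ := by positivity
    refine mul_le_mul_of_nonneg_left ?_ this
    simp
    linarith

/-! ## Chaining -/

theorem exists_net {m : ℕ} (T : Finset (EuclideanSpace ℝ (Fin m))) {t : ℝ} (ht : 0 ≤ t) :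
    ∃ N ⊆ T, (∀ x ∈ N, ∀ y ∈ N, x ≠ y → t * Real.sqrt m < dist x y) ∧
      ∀ x ∈ T, ∃ y ∈ N, dist x y ≤ t * Real.sqrt m := by
  classical
  set ε := Real.toNNReal (t * Real.sqrt m) with hε
  have h0 : 0 ≤ t * Real.sqrt m := by positivity
  set M := Metric.maximalSeparatedSet ε (T : Set (EuclideanSpace ℝ (Fin m))) with hM
  have hsub : M ⊆ T := Metric.maximalSeparatedSet_subset
  have hfin : M.Finite := T.finite_toSet.subset hsub
  refine ⟨hfin.toFinset, ?_, ?_, ?_⟩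
  · intro x hx
    exact_mod_cast hsub (hfin.mem_toFinset.1 hx)
  · intro x hx y hy hxy
    have h1 : _ < edist x y := Metric.isSeparated_maximalSeparatedSet (hfin.mem_toFinset.1 hx)
      (hfin.mem_toFinset.1 hy) hxy
    rw [edist_dist] at h1
    exact (ENNReal.ofReal_lt_ofReal_iff (dist_pos.2 hxy)).1 h1
  · intro x hx
    obtain ⟨y, hy, hxy⟩ := Metric.isCover_maximalSeparatedSet (packingNumber_ne_top T ε)
      (show x ∈ (T : Set (EuclideanSpace ℝ (Fin m))) from hx)
    refine ⟨y, hfin.mem_toFinset.2 hy, ?_⟩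
    have hxy' : edist x y ≤ ENNReal.ofReal (t * Real.sqrt m) := hxy
    rw [edist_dist] at hxy'
    exact (ENNReal.ofReal_le_ofReal_iff h0).1 hxy'

/-- One link of the chain per induction step. A point `u` of the net at scale `2^-(k+1)` is `p u`
plus a correction, with `p u` in a net at scale `2^-k`. There are at most as many corrections as
points in the finer net, and their norms are at most `2^-k √m`. The lower bound on `2^-k` keeps all
scales used within the range of the supremum. -/
theorem gaussianWidthLE_net {m : ℕ} (hm : 0 < m) {X T : Finset (EuclideanSpace ℝ (Fin m))}
    (hX : ∀ x ∈ X, InCube x) (hTX : T ⊆ X) {α : ℝ} (hα : 0 < α) (k : ℕ)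
    (hk : α / 4 ≤ (1 / 2 : ℝ) ^ k) (N : Finset (EuclideanSpace ℝ (Fin m))) (hNT : N ⊆ T)
    (hN : ∀ x ∈ N, ∀ y ∈ N, x ≠ y → (1 / 2 : ℝ) ^ k * Real.sqrt m < dist x y) :
    GaussianWidthLE N (k * (3 * Real.sqrt m * coarseSup 4 X α)) := by
  classical
  have hr : 0 < Real.sqrt m := Real.sqrt_pos.2 (by exact_mod_cast hm)
  induction k generalizing N with
  | zero =>
    simp only [Nat.cast_zero, zero_mul]
    -- At scale `1` a separated subset of the cube has at most one point, because the diameter of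
    -- the cube is `√m`.
    refine GaussianWidthLE.of_card_le_one (Finset.card_le_one.2 fun a ha b hb => ?_)
    by_contra hab
    have h1 := hN a ha b hb hab
    have h2 := dist_le_sqrt_of_inCube (hX a (hTX (hNT ha))) (hX b (hTX (hNT hb)))
    simp at h1
    linarith
  | succ k ih =>
    obtain ⟨N', hN'T, hN'sep, hN'cov⟩ := exists_net T (t := (1 / 2 : ℝ) ^ k) (by positivity)
    have hk' : α / 4 ≤ (1 / 2 : ℝ) ^ k := by
      refine hk.trans ?_
      rw [pow_succ]
      have : (0 : ℝ) < (1 / 2) ^ k := by positivity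
      linarith
    obtain ⟨B, hB, hBN, hBw⟩ := ih hk' N' hN'T hN'sep
    choose! p hp hpd using hN'cov
    obtain ⟨B', hB', hBN', hBw'⟩ := gaussianWidthLE_of_norm_le (N.image fun u => u - p u)
      (R := (1 / 2 : ℝ) ^ k * Real.sqrt m) (by positivity)
      (by
        intro v hv
        obtain ⟨u, hu, rfl⟩ := Finset.mem_image.1 hv
        rw [← dist_eq_norm]
        exact hpd u (hNT hu))
      (Finset.card_image_le.trans (card_le_sepNumber (hNT.trans hTX) hN))
    refine ⟨fun z => B z + B' z, hB.add hB', fun z u hu => ?_, ?_⟩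
    · have h1 := hBN z (p u) (hp u (hNT hu))
      have h2 := hBN' z (u - p u) (Finset.mem_image_of_mem _ hu)
      rw [inner_sub_left] at h2
      linarith
    · rw [integral_add hB hB']
      have h1 := le_coarseSup hX (C := 4) (α := α) (t := (1 / 2 : ℝ) ^ (k + 1)) (by positivity) hk
      set P := sepNumber X ((1 / 2 : ℝ) ^ (k + 1))
      -- Passing from scale `2^-k` to `2^-(k+1)` costs a factor `2`, and `2 √2 ≤ 3`.
      have h2 : (1 / 2 : ℝ) ^ k * Real.sqrt m * Real.sqrt (2 * Real.log P)
          ≤ 3 * Real.sqrt m * coarseSup 4 X α := by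
        rw [Real.sqrt_mul (by norm_num)]
        have h3 : Real.sqrt 2 ≤ 3 / 2 := by
          rw [Real.sqrt_le_left (by norm_num)]; norm_num
        have h4 : (1 / 2 : ℝ) ^ k = 2 * (1 / 2 : ℝ) ^ (k + 1) := by rw [pow_succ]; ring
        have h5 : 0 ≤ (1 / 2 : ℝ) ^ (k + 1) * Real.sqrt (Real.log P) := by positivity
        calc (1 / 2 : ℝ) ^ k * Real.sqrt m * (Real.sqrt 2 * Real.sqrt (Real.log P))
            = 2 * Real.sqrt m * Real.sqrt 2 * ((1 / 2 : ℝ) ^ (k + 1) * Real.sqrt (Real.log P)) := by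
              rw [h4]; ring
          _ ≤ 2 * Real.sqrt m * (3 / 2) * ((1 / 2 : ℝ) ^ (k + 1) * Real.sqrt (Real.log P)) := by
              gcongr
          _ ≤ 2 * Real.sqrt m * (3 / 2) * coarseSup 4 X α := by gcongr
          _ = _ := by ring
      push_cast
      linarith

/-- Dudley's bound, with the logarithmic number of scales made explicit. -/
theorem gaussianWidthLE_of_separated {m : ℕ} (hm : 0 < m)
    {X T : Finset (EuclideanSpace ℝ (Fin m))} (hX : ∀ x ∈ X, InCube x) (hTX : T ⊆ X) {α : ℝ}
    (hα : 0 < α) (hα1 : α ≤ 998 / 1000)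
    (hT : ∀ x ∈ T, ∀ y ∈ T, x ≠ y → α / 2 ≤ dist x y / Real.sqrt m) :
    GaussianWidthLE T (3006 * Real.sqrt m * (Real.log (1 / α) * coarseSup 4 X α)) := by
  have hr : 0 < Real.sqrt m := Real.sqrt_pos.2 (by exact_mod_cast hm)
  have hS := coarseSup_nonneg (C := 4) (X := X) (α := α) (by positivity)
  -- Since `2^n ≤ 2/α < 2^(n+1)`, the scale `2^-(n+1)` lies in `[α/4, α/2)`: large enough for the
  -- supremum, and small enough that `T` itself is strictly separated and serves as the finest net.
  obtain ⟨n, hn1, hn2⟩ := exists_nat_pow_near (x := 2 / α) (y := (2 : ℝ))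
    (by rw [le_div_iff₀ hα]; linarith) (by norm_num)
  have h2n : (0 : ℝ) < 2 ^ n := by positivity
  rw [le_div_iff₀ hα] at hn1
  rw [div_lt_iff₀ hα, pow_succ] at hn2
  have hL : 2 / 1000 ≤ Real.log (1 / α) := by
    have := Real.one_sub_inv_le_log_of_pos (show 0 < 1 / α by positivity)
    rw [one_div, inv_inv] at this
    rw [one_div]; linarith
  obtain ⟨B, hB, hBT, hBw⟩ := gaussianWidthLE_net hm hX hTX hα (n + 1)
    (by rw [one_div, inv_pow, pow_succ, mul_inv, ← one_div, div_mul_eq_mul_div, le_div_iff₀ h2n]; linarith)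
    T (Finset.Subset.refl _) (by
      intro x hx y hy hxy
      have h := hT x hx y hy hxy
      rw [le_div_iff₀ hr] at h
      refine lt_of_lt_of_le ?_ h
      refine mul_lt_mul_of_pos_right ?_ hr
      rw [one_div, inv_pow, pow_succ, mul_inv, ← one_div, div_mul_eq_mul_div, div_lt_iff₀ h2n]
      linarith)
  refine ⟨B, hB, hBT, hBw.trans ?_⟩
  have hlog : (n : ℝ) * Real.log 2 ≤ Real.log 2 + Real.log (1 / α) := by
    rw [← Real.log_pow, ← Real.log_mul (by norm_num) (by positivity)]
    refine Real.log_le_log (by positivity) ?_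
    rw [mul_one_div, le_div_iff₀ hα]; linarith
  have hl2 := Real.log_two_gt_d9
  -- With `L = log (1/α)`, `hlog` gives `n + 1 ≤ 2 L + 2`, and `2 ≤ 1000 L` because `α ≤ 998/1000`.
  have hnn : ((n : ℝ) + 1) ≤ 1002 * Real.log (1 / α) := by
    have hl2' := Real.log_two_lt_d9
    by_contra hcon
    push Not at hcon
    have : ((n : ℝ) - 1) * (1 / 2) ≤ Real.log (1 / α) := by
      rcases le_total (n : ℝ) 1 with h | h
      · nlinarith
      · nlinarith
    nlinarith
  push_cast
  calc ((n : ℝ) + 1) * (3 * Real.sqrt m * coarseSup 4 X α)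
      ≤ (1002 * Real.log (1 / α)) * (3 * Real.sqrt m * coarseSup 4 X α) := by gcongr
    _ = _ := by ring

/-! ## Nets, rounding and means -/

/-- A point of `X` farther than this from all of `T` could be added to `T`, against maximality. -/
theorem IsCoarseNet.exists_dist_le {m : ℕ} (hm : 0 < m) {X T : Finset (EuclideanSpace ℝ (Fin m))}
    {α : ℝ} (hα : 0 < α) (hT : IsCoarseNet X α T) {x : EuclideanSpace ℝ (Fin m)} (hx : x ∈ X) :
    ∃ t ∈ T, dist x t ≤ α / 2 * Real.sqrt m := by
  classical
  have hr : 0 < Real.sqrt m := Real.sqrt_pos.2 (by exact_mod_cast hm)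
  by_cases hxT : x ∈ T
  · exact ⟨x, hxT, by rw [dist_self]; positivity⟩
  by_contra hcon
  push Not at hcon
  have hfar : ∀ t ∈ T, α / 2 ≤ dist x t / Real.sqrt m := fun t ht =>
    (le_div_iff₀ hr).2 (hcon t ht).le
  refine hxT (hT.2 (y := insert x T) ⟨?_, ?_⟩ (Finset.subset_insert x T)
    (Finset.mem_insert_self x T))
  · exact Finset.insert_subset hx hT.1.1
  · intro a ha b hb hab
    rcases Finset.mem_insert.1 ha with rfl | ha' <;> rcases Finset.mem_insert.1 hb with rfl | hb'
    · exact absurd rfl hab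
    · exact hfar b hb'
    · rw [dist_comm]; exact hfar a ha'
    · exact hT.1.2 a ha' b hb' hab

theorem IsRounding.dist_le {m : ℕ} (hm : 0 < m) {X T : Finset (EuclideanSpace ℝ (Fin m))}
    {α : ℝ} (hα : 0 < α) (hT : IsCoarseNet X α T) {r : X → EuclideanSpace ℝ (Fin m)}
    (hr : IsRounding X T r) (x : X) : dist (x : EuclideanSpace ℝ (Fin m)) (r x) ≤ α / 2 * Real.sqrt m := by
  obtain ⟨t, ht, hxt⟩ := hT.exists_dist_le hm hα x.2
  exact ((hr x).2 t ht).trans hxt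

theorem meanPoint_mem {m n : ℕ} (hn : 0 < n) {K : Set (EuclideanSpace ℝ (Fin m))}
    (hK : Convex ℝ K) {D : Fin n → EuclideanSpace ℝ (Fin m)} (hD : ∀ i, D i ∈ K) :
    meanPoint D ∈ K := by
  have hn' : (n : ℝ) ≠ 0 := by positivity
  rw [meanPoint, Finset.smul_sum]
  refine hK.sum_mem (fun i _ => by positivity) ?_ fun i _ => hD i
  simp [hn']

theorem norm_meanPoint_sub_le {m n : ℕ} (hn : 0 < n) {D D' : Fin n → EuclideanSpace ℝ (Fin m)}
    {c : ℝ} (h : ∀ i, ‖D i - D' i‖ ≤ c) : ‖meanPoint D - meanPoint D'‖ ≤ c := by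
  have hn' : (0 : ℝ) < n := by positivity
  rw [meanPoint, meanPoint, ← smul_sub, ← Finset.sum_sub_distrib, norm_smul, norm_inv,
    Real.norm_of_nonneg hn'.le, inv_mul_le_iff₀ hn']
  refine (norm_sum_le _ _).trans ((Finset.sum_le_sum fun i _ => h i).trans ?_)
  simp

/-! ## Mean square errors -/

theorem sq_norm_sub_le_two_mul {F : Type*} [NormedAddCommGroup F] [InnerProductSpace ℝ F]
    (p q r : F) : ‖p - r‖ ^ 2 ≤ 2 * ‖p - q‖ ^ 2 + 2 * ‖q - r‖ ^ 2 := by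
  have h := norm_sub_le_norm_sub_add_norm_sub p q r
  nlinarith [norm_nonneg (p - r), norm_nonneg (p - q), norm_nonneg (q - r),
    sq_nonneg (‖p - q‖ - ‖q - r‖)]

/-- For `α` close to `1` there is no room for the factor `2` of the plain inequality; a small `s`
keeps the factor of the main term close to `1`. -/
theorem sq_norm_sub_le_weighted {F : Type*} [NormedAddCommGroup F] [InnerProductSpace ℝ F]
    (p q r : F) {s : ℝ} (hs : 0 < s) :
    ‖p - r‖ ^ 2 ≤ (1 + s⁻¹) * ‖p - q‖ ^ 2 + (1 + s) * ‖q - r‖ ^ 2 := by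
  have h := norm_sub_le_norm_sub_add_norm_sub p q r
  have h1 : ‖p - r‖ ^ 2 ≤ (‖p - q‖ + ‖q - r‖) ^ 2 := by gcongr
  have h2 : s * (s⁻¹ * ‖p - q‖ - ‖q - r‖) ^ 2 =
      s⁻¹ * ‖p - q‖ ^ 2 - 2 * ‖p - q‖ * ‖q - r‖ + s * ‖q - r‖ ^ 2 := by
    field_simp
    ring
  have h3 : 0 ≤ s * (s⁻¹ * ‖p - q‖ - ‖q - r‖) ^ 2 := by positivity
  linarith

theorem rms_le {Ω : Type*} [MeasurableSpace Ω] {μ : Measure Ω} {m : ℕ} (hm : 0 < m)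
    {f : Ω → EuclideanSpace ℝ (Fin m)} {c : ℝ} (hc : 0 ≤ c)
    (h : ∫⁻ z, ENNReal.ofReal (‖f z‖ ^ 2) ∂μ ≤ ENNReal.ofReal (m * c ^ 2)) :
    (∫⁻ z, ‖f z‖ₑ ^ 2 / (m : ℝ≥0∞) ∂μ) ^ (1 / 2 : ℝ) ≤ ENNReal.ofReal c := by
  have hm0 : (m : ℝ≥0∞) ≠ 0 := by exact_mod_cast hm.ne'
  have hmt : (m : ℝ≥0∞)⁻¹ ≠ ⊤ := ENNReal.inv_ne_top.2 hm0
  have h1 : ∫⁻ z, ‖f z‖ₑ ^ 2 / (m : ℝ≥0∞) ∂μ ≤ ENNReal.ofReal c ^ 2 := by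
    simp only [div_eq_mul_inv]
    rw [lintegral_mul_const' _ _ hmt, ← div_eq_mul_inv]
    refine ENNReal.div_le_of_le_mul ?_
    calc ∫⁻ z, ‖f z‖ₑ ^ 2 ∂μ = ∫⁻ z, ENNReal.ofReal (‖f z‖ ^ 2) ∂μ := by
          refine lintegral_congr fun z => ?_
          rw [ENNReal.ofReal_pow (norm_nonneg _), ofReal_norm]
      _ ≤ ENNReal.ofReal (m * c ^ 2) := h
      _ = ENNReal.ofReal c ^ 2 * m := by
          rw [ENNReal.ofReal_mul (by positivity), ENNReal.ofReal_pow hc, ENNReal.ofReal_natCast,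
            mul_comm]
  calc _ ≤ (ENNReal.ofReal c ^ 2) ^ (1 / 2 : ℝ) := by gcongr
    _ = ENNReal.ofReal c := by
        rw [← ENNReal.rpow_natCast, ← ENNReal.rpow_mul]
        norm_num

theorem lintegral_ofReal_le_const {Ω : Type*} [MeasurableSpace Ω] {μ : Measure Ω}
    [IsProbabilityMeasure μ] {f : Ω → ℝ} {c : ℝ} (h : ∀ z, f z ≤ c) :
    ∫⁻ z, ENNReal.ofReal (f z) ∂μ ≤ ENNReal.ofReal c := by
  refine (lintegral_mono fun z => ENNReal.ofReal_le_ofReal (h z)).trans ?_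
  simp

theorem lintegral_ofReal_le_affine {Ω : Type*} [MeasurableSpace Ω] {μ : Measure Ω}
    [IsProbabilityMeasure μ] {f g : Ω → ℝ} {a b c : ℝ} (ha : 0 ≤ a) (hb : 0 ≤ b) (hc : 0 ≤ c)
    (h : ∀ z, f z ≤ a + b * g z)
    (hgc : ∫⁻ z, ENNReal.ofReal (g z) ∂μ ≤ ENNReal.ofReal c) :
    ∫⁻ z, ENNReal.ofReal (f z) ∂μ ≤ ENNReal.ofReal (a + b * c) := by
  calc ∫⁻ z, ENNReal.ofReal (f z) ∂μ
      ≤ ∫⁻ z, (ENNReal.ofReal a + ENNReal.ofReal b * ENNReal.ofReal (g z)) ∂μ := by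
        refine lintegral_mono fun z => ?_
        refine (ENNReal.ofReal_le_ofReal (h z)).trans (ENNReal.ofReal_add_le.trans ?_)
        rw [ENNReal.ofReal_mul hb]
    _ = ENNReal.ofReal a + ENNReal.ofReal b * ∫⁻ z, ENNReal.ofReal (g z) ∂μ := by
        rw [lintegral_add_left measurable_const, lintegral_const_mul' _ _ ENNReal.ofReal_ne_top]
        simp
    _ ≤ ENNReal.ofReal a + ENNReal.ofReal b * ENNReal.ofReal c := by gcongr
    _ = ENNReal.ofReal (a + b * c) := by
        rw [ENNReal.ofReal_add ha (by positivity), ENNReal.ofReal_mul hb]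

theorem lintegral_sq_norm_stdGaussian {m : ℕ} :
    ∫⁻ z, ENNReal.ofReal (‖z‖ ^ 2) ∂(stdGaussian (EuclideanSpace ℝ (Fin m))) = ENNReal.ofReal m := by
  have h1 : ∀ z : EuclideanSpace ℝ (Fin m),
      ENNReal.ofReal (‖z‖ ^ 2) = ∑ i, ENNReal.ofReal (z i ^ 2) := by
    intro z
    rw [EuclideanSpace.real_norm_sq_eq, ENNReal.ofReal_sum_of_nonneg fun i _ => sq_nonneg _]
  simp only [h1]
  rw [lintegral_finsetSum _ fun i _ => by fun_prop]
  have h2 : ∀ i : Fin m, ∫⁻ z, ENNReal.ofReal (z i ^ 2)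
      ∂(stdGaussian (EuclideanSpace ℝ (Fin m))) = 1 := by
    intro i
    have h3 : (stdGaussian (EuclideanSpace ℝ (Fin m))).map (fun z => z i) = gaussianReal 0 1 := by
      have h := stdGaussian_map_inner (EuclideanSpace.single i (1 : ℝ))
      simpa [EuclideanSpace.inner_single_left] using h
    have h4 : ∫⁻ z, ENNReal.ofReal (z i ^ 2) ∂(stdGaussian (EuclideanSpace ℝ (Fin m)))
        = ∫⁻ x, ENNReal.ofReal (x ^ 2) ∂(gaussianReal 0 1) := by
      rw [← h3, lintegral_map (by fun_prop) (by fun_prop)]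
    rw [h4, ← ofReal_integral_eq_lintegral_ofReal _ (Filter.Eventually.of_forall fun x => sq_nonneg x)]
    · have h5 := variance_id_gaussianReal (μ := 0) (v := 1)
      rw [variance_of_integral_eq_zero aemeasurable_id (by simp)] at h5
      simp only [id] at h5
      rw [h5]; simp
    · exact (memLp_id_gaussianReal (μ := 0) (v := 1) 2).integrable_sq
  simp [h2]

theorem lintegral_comp_neg_stdGaussian {m : ℕ} {f : EuclideanSpace ℝ (Fin m) → ℝ≥0∞}
    (hf : Measurable f) :
    ∫⁻ z, f (-z) ∂(stdGaussian (EuclideanSpace ℝ (Fin m)))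
      = ∫⁻ z, f z ∂(stdGaussian (EuclideanSpace ℝ (Fin m))) := by
  have h := stdGaussian_map (LinearIsometryEquiv.neg ℝ (E := EuclideanSpace ℝ (Fin m)))
  conv_rhs => rw [← h]
  rw [lintegral_map hf (by fun_prop)]
  rfl

/-! ## The error of the projection -/

/-- A linear function that is at most `B z` on `T` is at most `B z` on the hull. So the squared
error is at most `σ (B z - ⟨x, z⟩)`, whose last term has mean zero. -/
theorem lintegral_hullProj_sub_le_of_width {m : ℕ} {T : Finset (EuclideanSpace ℝ (Fin m))}
    (hT : T.Nonempty) {w : ℝ} (hw : GaussianWidthLE T w) {x : EuclideanSpace ℝ (Fin m)}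
    (hx : x ∈ convexHull ℝ (T : Set (EuclideanSpace ℝ (Fin m)))) {σ : ℝ} (hσ : 0 ≤ σ) :
    ∫⁻ z, ENNReal.ofReal (‖hullProj T (x + σ • z) - x‖ ^ 2)
      ∂(stdGaussian (EuclideanSpace ℝ (Fin m))) ≤ ENNReal.ofReal (σ * w) := by
  obtain ⟨B, hB, hBT, hBw⟩ := hw
  set G := stdGaussian (EuclideanSpace ℝ (Fin m))
  have hpt : ∀ z, ‖hullProj T (x + σ • z) - x‖ ^ 2 ≤ σ * (B z - inner ℝ x z) := by
    intro z
    have h1 := sq_norm_hullProj_sub_le_inner hT (x + σ • z) hx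
    rw [add_sub_cancel_left, real_inner_smul_left, real_inner_comm, inner_sub_left] at h1
    have h2 : inner ℝ (hullProj T (x + σ • z)) z ≤ B z := by
      have hconv : Convex ℝ {u : EuclideanSpace ℝ (Fin m) | inner ℝ u z ≤ B z} := by
        have := convex_halfSpace_le (f := fun u : EuclideanSpace ℝ (Fin m) => inner ℝ u z)
          ⟨fun a b => inner_add_left a b z, fun c a => real_inner_smul_left a z c⟩ (B z)
        exact this
      exact convexHull_min (fun u hu => hBT z u hu) hconv (hullProj_mem hT _)
    exact h1.trans (mul_le_mul_of_nonneg_left (by linarith) hσ)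
  have hint : Integrable (fun z => σ * (B z - inner ℝ x z)) G :=
    (hB.sub (integrable_inner_stdGaussian x)).const_mul _
  refine (lintegral_mono fun z => ENNReal.ofReal_le_ofReal (hpt z)).trans ?_
  rw [← ofReal_integral_eq_lintegral_ofReal hint
    (Filter.Eventually.of_forall fun z => (sq_nonneg _).trans (hpt z))]
  refine ENNReal.ofReal_le_ofReal ?_
  have h0 : ∫ z, inner ℝ x z ∂G = 0 := integral_inner_stdGaussian x
  rw [integral_const_mul, integral_sub hB (integrable_inner_stdGaussian x), h0, sub_zero]
  exact mul_le_mul_of_nonneg_left hBw hσ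

/-- Pairing `z` with `-z`: one of the two squared errors is at most `49/50 m` and the other at most
`m`. The noise level is arbitrary, so no sample size condition enters. -/
theorem lintegral_hullProj_sub_le_of_separated {m : ℕ} (hm : 0 < m)
    {T : Finset (EuclideanSpace ℝ (Fin m))} (hT : T.Nonempty) (hcube : ∀ t ∈ T, InCube t)
    (hsep : ∀ s ∈ T, ∀ t ∈ T, s ≠ t → (m : ℝ) / 25 < ‖s - t‖ ^ 2)
    {a x : EuclideanSpace ℝ (Fin m)} (ha : InCube a)
    (hx : x ∈ convexHull ℝ (T : Set (EuclideanSpace ℝ (Fin m)))) (hax : ‖x - a‖ ^ 2 ≤ m / 4)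
    (σ : ℝ) :
    ∫⁻ z, ENNReal.ofReal (‖hullProj T (x + σ • z) - a‖ ^ 2)
      ∂(stdGaussian (EuclideanSpace ℝ (Fin m))) ≤ ENNReal.ofReal (99 / 100 * m) := by
  set G := stdGaussian (EuclideanSpace ℝ (Fin m))
  set f : EuclideanSpace ℝ (Fin m) → ℝ := fun z => ‖hullProj T (x + σ • z) - a‖ ^ 2 with hf
  have hfm : Measurable fun z => ENNReal.ofReal (f z) := by
    have := (continuous_hullProj hT).measurable
    simp only [hf]
    fun_prop
  have hpt : ∀ z, f z + f (-z) ≤ 2 * (99 / 100 * m) := by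
    intro z
    have hle : ∀ z, f z ≤ m := fun z =>
      sq_norm_sub_le_of_inCube ha (InCube.of_mem_convexHull hcube (hullProj_mem hT _))
    have h := sq_norm_hullProj_sub_le_or hm hT hcube hsep ha hx hax (σ • z)
    rw [sub_eq_add_neg x, ← smul_neg] at h
    rcases h with h | h
    · linarith [hle (-z), show f z ≤ 49 / 50 * m from h]
    · linarith [hle z, show f (-z) ≤ 49 / 50 * m from h]
  have h2 : 2 * ∫⁻ z, ENNReal.ofReal (f z) ∂G ≤ 2 * ENNReal.ofReal (99 / 100 * m) := by
    calc 2 * ∫⁻ z, ENNReal.ofReal (f z) ∂G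
        = ∫⁻ z, ENNReal.ofReal (f z + f (-z)) ∂G := by
          have h0 : ∀ z, ENNReal.ofReal (f z + f (-z)) = ENNReal.ofReal (f z) + ENNReal.ofReal (f (-z)) :=
            fun z => ENNReal.ofReal_add (sq_nonneg _) (sq_nonneg _)
          have h3 : ∫⁻ z, ENNReal.ofReal (f (-z)) ∂G = ∫⁻ z, ENNReal.ofReal (f z) ∂G :=
            lintegral_comp_neg_stdGaussian hfm
          simp only [h0]
          rw [lintegral_add_left hfm, h3, two_mul]
      _ ≤ ENNReal.ofReal (2 * (99 / 100 * m)) := lintegral_ofReal_le_const hpt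
      _ = 2 * ENNReal.ofReal (99 / 100 * m) := by
          rw [ENNReal.ofReal_mul (by norm_num)]; norm_num
  exact (ENNReal.mul_le_mul_iff_right (by norm_num) (by norm_num)).1 h2

/-! ## Consequences of the sample size condition -/

theorem two_thousandths_le_log {α : ℝ} (hα : 0 < α) (hα1 : α ≤ 998 / 1000) :
    2 / 1000 ≤ Real.log (1 / α) := by
  have := Real.one_sub_inv_le_log_of_pos (show 0 < 1 / α by positivity)
  rw [one_div, inv_inv] at this
  rw [one_div]; linarith

theorem log_mul_coarseSup_le {m n : ℕ} {X : Finset (EuclideanSpace ℝ (Fin m))} {α ρ : ℝ}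
    (hα : 0 < α) (hρ : 0 < ρ) (h : 10 ^ 7 * coarseBound 4 X α ρ ≤ n) :
    10 ^ 7 * (Real.log (1 / α) * coarseSup 4 X α) ≤ n * (α ^ 2 * Real.sqrt ρ) := by
  have hs : 0 < Real.sqrt ρ := Real.sqrt_pos.2 hρ
  have e : coarseBound 4 X α ρ
      = Real.log (1 / α) * coarseSup 4 X α / (α ^ 2 * Real.sqrt ρ) := by
    rw [coarseBound, coarseSup]; ring
  rw [e, mul_div_assoc', div_le_iff₀ (by positivity)] at h
  exact h

theorem noise_mul_width_le {m n : ℕ} (hn : 0 < n)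
    {X : Finset (EuclideanSpace ℝ (Fin m))} {α ρ : ℝ}
    (hα : 0 < α) (hρ : 0 < ρ) (h : 10 ^ 7 * coarseBound 4 X α ρ ≤ n) :
    Real.sqrt m / (n * Real.sqrt (2 * ρ)) *
      (3006 * Real.sqrt m * (Real.log (1 / α) * coarseSup 4 X α)) ≤ m * α ^ 2 / 1000 := by
  have h1 := log_mul_coarseSup_le hα hρ h
  set q := Real.log (1 / α) * coarseSup 4 X α
  have hs : 0 < Real.sqrt ρ := Real.sqrt_pos.2 hρ
  have hn' : (0 : ℝ) < n := by exact_mod_cast hn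
  have h2 : (1 : ℝ) ≤ Real.sqrt 2 := by rw [Real.one_le_sqrt]; norm_num
  rw [Real.sqrt_mul (by norm_num)]
  have h3 : Real.sqrt m * Real.sqrt m = m := Real.mul_self_sqrt (by positivity)
  rw [div_mul_eq_mul_div, div_le_iff₀ (by positivity)]
  have h4 : Real.sqrt m * (3006 * Real.sqrt m * q) = m * (3006 * q) := by
    linear_combination (3006 * q) * h3
  rw [h4]
  have h5 : 3006 * q ≤ α ^ 2 / 1000 * (n * Real.sqrt ρ) := by nlinarith [show 0 ≤ n * (α ^ 2 * Real.sqrt ρ) by positivity]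
  calc (m : ℝ) * (3006 * q) ≤ m * (α ^ 2 / 1000 * (n * Real.sqrt ρ)) := by gcongr
    _ = m * α ^ 2 / 1000 * (n * (1 * Real.sqrt ρ)) := by ring
    _ ≤ _ := by gcongr

/-- Large noise means small `n`: it gives `α n √ρ ≤ 3/2 √m`. The sample size condition with `log
(1/α) ≥ 2/1000` gives `20000 S ≤ α² n √ρ`, hence `S ≤ 3/40000 α √m`. -/
theorem coarseSup_le_of_noise_gt {m n : ℕ} (hn : 0 < n)
    {X : Finset (EuclideanSpace ℝ (Fin m))} {α ρ : ℝ}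
    (hα : 0 < α) (hα1 : α ≤ 998 / 1000) (hρ : 0 < ρ) (h : 10 ^ 7 * coarseBound 4 X α ρ ≤ n)
    (hσ : α / 2 < Real.sqrt m / (n * Real.sqrt (2 * ρ))) :
    coarseSup 4 X α ≤ α * Real.sqrt m / 12500 := by
  have h1 := log_mul_coarseSup_le hα hρ h
  have hS : 0 ≤ coarseSup 4 X α := coarseSup_nonneg (by positivity)
  have hL := two_thousandths_le_log hα hα1
  have hs : 0 < Real.sqrt ρ := Real.sqrt_pos.2 hρ
  have hn' : (0 : ℝ) < n := by exact_mod_cast hn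
  have h2 : Real.sqrt 2 ^ 2 = 2 := Real.sq_sqrt (by norm_num)
  have h2' : Real.sqrt 2 ≤ 3 / 2 := by rw [Real.sqrt_le_left (by norm_num)]; norm_num
  rw [Real.sqrt_mul (by norm_num), lt_div_iff₀ (by positivity)] at hσ
  have h3 : α * (n * Real.sqrt ρ) ≤ 3 / 2 * Real.sqrt m := by
    have : α * (n * Real.sqrt ρ) = Real.sqrt 2 * (α / 2 * (n * (Real.sqrt 2 * Real.sqrt ρ))) := by
      linear_combination (- (α * (n * Real.sqrt ρ)) / 2) * h2
    rw [this]
    exact mul_le_mul h2' hσ.le (by positivity) (by norm_num)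
  have h4 : 20000 * coarseSup 4 X α ≤ n * (α ^ 2 * Real.sqrt ρ) := by nlinarith
  have h5 : n * (α ^ 2 * Real.sqrt ρ) ≤ α * (3 / 2 * Real.sqrt m) := by
    calc n * (α ^ 2 * Real.sqrt ρ) = α * (α * (n * Real.sqrt ρ)) := by ring
      _ ≤ _ := by gcongr
  linarith

/-! ## Accuracy and privacy of approximate coarse projections -/

theorem IsCoarseNet.inCube {m : ℕ} {X T : Finset (EuclideanSpace ℝ (Fin m))} {α : ℝ}
    (hX : ∀ x ∈ X, InCube x) (hT : IsCoarseNet X α T) : ∀ t ∈ T, InCube t :=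
  fun t ht => hX t (hT.1.1 ht)

/-- The map `F` stands for the exact projection as well as for its Frank–Wolfe approximation, hence
the slack of `α / 1000` in the normalized norm. -/
theorem lintegral_sq_error_le {m n : ℕ} (hm : 0 < m) (hn : 0 < n)
    {X T : Finset (EuclideanSpace ℝ (Fin m))} (hX : ∀ x ∈ X, InCube x) {α ρ : ℝ} (hα : 0 < α)
    (hρ : 0 < ρ) (hT : IsCoarseNet X α T) {a x : EuclideanSpace ℝ (Fin m)} (ha : InCube a)
    (hx : x ∈ convexHull ℝ (T : Set (EuclideanSpace ℝ (Fin m))))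
    (hax : ‖x - a‖ ^ 2 ≤ α ^ 2 / 4 * m) (hcond : 10 ^ 7 * coarseBound 4 X α ρ ≤ n)
    (F : EuclideanSpace ℝ (Fin m) → EuclideanSpace ℝ (Fin m))
    (hF : ∀ z, ‖F z - hullProj T (x + (Real.sqrt m / (n * Real.sqrt (2 * ρ))) • z)‖ ^ 2
      ≤ m * α ^ 2 / 10 ^ 6) (hF1 : ∀ z, InCube (F z)) :
    ∫⁻ z, ENNReal.ofReal (‖F z - a‖ ^ 2) ∂(stdGaussian (EuclideanSpace ℝ (Fin m)))
      ≤ ENNReal.ofReal (m * α ^ 2) := by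
  set σ := Real.sqrt m / (n * Real.sqrt (2 * ρ)) with hσ
  have hTne : T.Nonempty := by
    have := convexHull_nonempty_iff.1 ⟨x, hx⟩
    exact_mod_cast this
  have hcube := hT.inCube hX
  have hm' : (0 : ℝ) < m := by exact_mod_cast hm
  have hr : 0 < Real.sqrt m := Real.sqrt_pos.2 hm'
  rcases le_or_gt 1 α with h1 | h1
  · refine lintegral_ofReal_le_const fun z => (sq_norm_sub_le_of_inCube ha (hF1 z)).trans ?_
    exact le_mul_of_one_le_right hm'.le (one_le_pow₀ h1)
  -- Near `1` the symmetry argument applies: the net is separated since `(α/2)² > 1/25`, and the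
  -- bound `99/100 m` is below `α² m ≥ 0.996 m` with room for the weights and the slack of `F`.
  rcases le_or_gt (998 / 1000) α with h2 | h2
  · have hB := lintegral_hullProj_sub_le_of_separated hm hTne hcube (fun s hs t ht hst => by
      have h := hT.1.2 s hs t ht hst
      rw [le_div_iff₀ hr, dist_eq_norm] at h
      have h3 : (α / 2 * Real.sqrt m) ^ 2 ≤ ‖s - t‖ ^ 2 := by gcongr
      rw [mul_pow, Real.sq_sqrt hm'.le] at h3
      have h4 : (1 : ℝ) / 25 < (α / 2) ^ 2 := by nlinarith
      linarith [mul_lt_mul_of_pos_right h4 hm']) ha hx (hax.trans (by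
        have h4 : α ^ 2 ≤ 1 := pow_le_one₀ hα.le h1.le
        linarith [mul_le_mul_of_nonneg_right h4 hm'.le])) σ
    refine (lintegral_ofReal_le_affine (a := (1 + (1 / 1000 : ℝ)⁻¹) * (m * α ^ 2 / 10 ^ 6))
      (b := 1 + 1 / 1000) (by positivity) (by norm_num) (by positivity) (fun z => ?_) hB).trans ?_
    · have h3 := sq_norm_sub_le_weighted (F z) (hullProj T (x + σ • z)) a
        (show (0 : ℝ) < 1 / 1000 by norm_num)
      refine h3.trans (add_le_add_left ?_ _)
      exact mul_le_mul_of_nonneg_left (hF z) (by positivity)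
    · refine ENNReal.ofReal_le_ofReal ?_
      have h4 : (0.996 : ℝ) ≤ α ^ 2 := by nlinarith
      have h5 : (0.996 : ℝ) * m ≤ m * α ^ 2 := by nlinarith
      norm_num
      linarith
  -- In units of `m α²`, rounding contributes `1/2`, noise `4/1000` and the slack of `F` `4/10^6`,
  -- in total less than `1`.
  · have hw := lintegral_hullProj_sub_le_of_width hTne
      (gaussianWidthLE_of_separated hm hX hT.1.1 hα h2.le hT.1.2) hx (σ := σ) (by positivity)
    have hw' := hw.trans (ENNReal.ofReal_le_ofReal (noise_mul_width_le hn hα hρ hcond))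
    refine (lintegral_ofReal_le_affine (a := 4 * (m * α ^ 2 / 10 ^ 6) + 2 * (α ^ 2 / 4 * m))
      (b := 4) (by positivity) (by norm_num) (by positivity) (fun z => ?_) hw').trans ?_
    · have h3 := sq_norm_sub_le_two_mul (F z) x a
      have h4 := sq_norm_sub_le_two_mul (F z) (hullProj T (x + σ • z)) x
      linarith [hF z]
    · refine ENNReal.ofReal_le_ofReal ?_
      nlinarith [show 0 < m * α ^ 2 by positivity]

/-- If the noise is not negligible then the sample size condition bounds the diameter of the net. -/
theorem exists_diam_bound {m n : ℕ} (hm : 0 < m) (hn : 0 < n)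
    {X T : Finset (EuclideanSpace ℝ (Fin m))} (hX : ∀ x ∈ X, InCube x) {α ρ : ℝ} (hα : 0 < α)
    (hρ : 0 < ρ) (hT : IsCoarseNet X α T) (hcond : 10 ^ 7 * coarseBound 4 X α ρ ≤ n)
    (hσ : α / 2 < Real.sqrt m / (n * Real.sqrt (2 * ρ))) :
    ∃ D : ℝ, (∀ p ∈ convexHull ℝ (T : Set (EuclideanSpace ℝ (Fin m))),
      ∀ q ∈ convexHull ℝ (T : Set (EuclideanSpace ℝ (Fin m))), ‖p - q‖ ^ 2 ≤ D) ∧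
      4 * D / (((10 ^ 7 + m : ℕ) : ℝ) + 2) ≤ m * α ^ 2 / 10 ^ 6 := by
  have hm' : (1 : ℝ) ≤ m := by exact_mod_cast hm
  rcases le_or_gt α (998 / 1000) with h2 | h2
  · have hS := coarseSup_le_of_noise_gt hn hα h2 hρ hcond hσ
    -- The diameter of a hull is attained at its vertices, and distinct net points are at distance
    -- at most `4 √m S ≤ m α / 3125`. The extra factor `m` in the square is absorbed by the `m` in
    -- the number of steps.
    refine ⟨(m * α / 3125) ^ 2, fun p hp q hq => ?_, ?_⟩
    · obtain ⟨s, hs, t, ht, hst⟩ := convexHull_exists_dist_ge2 hp hq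
      rw [← dist_eq_norm]
      refine pow_le_pow_left₀ dist_nonneg (hst.trans ?_) 2
      by_cases h : s = t
      · rw [h, dist_self]; positivity
      · refine (dist_le_coarseSup hm hX hα (hT.1.1 hs) (hT.1.1 ht) (hT.1.2 s hs t ht h)).trans ?_
        have h3 : Real.sqrt m * Real.sqrt m = m := Real.mul_self_sqrt (by positivity)
        calc 4 * Real.sqrt m * coarseSup 4 X α ≤ 4 * Real.sqrt m * (α * Real.sqrt m / 12500) := by
              gcongr
          _ = m * α / 3125 := by linear_combination (α / 3125) * h3
    · rw [div_le_iff₀ (by positivity)]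
      push_cast
      have h3 : 0 ≤ m * α ^ 2 := by positivity
      nlinarith [mul_le_mul_of_nonneg_left hm' h3]
  -- Here `α² ≥ 0.99`, so the diameter of the cube is good enough: `4 m / 10^7` is below `m α² /
  -- 10^6`.
  · refine ⟨m, fun p hp q hq => sq_norm_sub_le_of_inCube
      (InCube.of_mem_convexHull (hT.inCube hX) hq) (InCube.of_mem_convexHull (hT.inCube hX) hp), ?_⟩
    rw [div_le_iff₀ (by positivity)]
    push_cast
    have h3 : (0.99 : ℝ) ≤ α ^ 2 := by nlinarith
    have h4 : (0.99 : ℝ) * m ≤ m * α ^ 2 := by nlinarith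
    nlinarith [show 0 ≤ m * α ^ 2 * m by positivity]

/-- The map `F` may use `X`, `α` and `ρ` but is the same for all datasets, so it is post-processing.
The mean has sensitivity `√m / n`, and the noise level is chosen so that `(m / n²) / (2 σ²) = ρ`. -/
theorem isZCDP_gaussian {m n : ℕ} (hm : 0 < m) (hn : 0 < n)
    {X : Finset (EuclideanSpace ℝ (Fin m))} {ρ : ℝ} (hρ : 0 < ρ)
    {r : X → EuclideanSpace ℝ (Fin m)} (hr : ∀ x, InCube (r x))
    {F : EuclideanSpace ℝ (Fin m) → EuclideanSpace ℝ (Fin m)} (hF : Measurable F) :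
    IsZCDP ρ (fun D : Fin n → X => (stdGaussian (EuclideanSpace ℝ (Fin m))).map fun z =>
      F (meanPoint (fun i => r (D i)) + (Real.sqrt m / (n * Real.sqrt (2 * ρ))) • z)) := by
  have hm' : (0 : ℝ) < m := by exact_mod_cast hm
  have hn' : (0 : ℝ) < n := by exact_mod_cast hn
  refine ⟨fun D => Measure.isProbabilityMeasure_map (hF.comp (by fun_prop)).aemeasurable, ?_⟩
  rintro D D' ⟨τ, i, hτ⟩ γ hγ
  have hσ : 0 < Real.sqrt m / (n * Real.sqrt (2 * ρ)) := by positivity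
  refine (renyiDiv_map_gaussian_le hF hσ _ _ hγ).trans ?_
  rw [EReal.coe_le_coe_iff]
  refine mul_le_mul_of_nonneg_left ?_ (by linarith)
  have hdiff : meanPoint (fun i => r (D i)) - meanPoint (fun i => r (D' i))
      = (n : ℝ)⁻¹ • (r (D i) - r (D' (τ i))) := by
    rw [meanPoint, meanPoint, ← Equiv.sum_comp τ (fun j => r (D' j)), ← smul_sub,
      ← Finset.sum_sub_distrib]
    congr 1
    refine Finset.sum_eq_single_of_mem i (Finset.mem_univ i) fun j _ hj => ?_
    rw [hτ j hj, sub_self]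
  rw [hdiff, norm_smul, mul_pow, norm_inv, Real.norm_of_nonneg hn'.le, div_pow, mul_pow,
    Real.sq_sqrt hm'.le, Real.sq_sqrt (by positivity)]
  have h1 := sq_norm_sub_le_of_inCube (hr (D' (τ i))) (hr (D i))
  rw [div_le_iff₀ (by positivity)]
  calc (n : ℝ)⁻¹ ^ 2 * ‖r (D i) - r (D' (τ i))‖ ^ 2 ≤ (n : ℝ)⁻¹ ^ 2 * m := by gcongr
    _ = ρ * (2 * (m / (n ^ 2 * (2 * ρ)))) := by field_simp

theorem avgError_map_le {m n : ℕ} (hm : 0 < m) {X : Finset (EuclideanSpace ℝ (Fin m))} {α : ℝ}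
    (hα : 0 < α) {f : (Fin n → X) → EuclideanSpace ℝ (Fin m) → EuclideanSpace ℝ (Fin m)}
    (hf : ∀ D, Measurable (f D))
    (h : ∀ D : Fin n → X, ∫⁻ z, ENNReal.ofReal (‖f D z -
        meanPoint (fun i => (D i : EuclideanSpace ℝ (Fin m)))‖ ^ 2)
      ∂(stdGaussian (EuclideanSpace ℝ (Fin m))) ≤ ENNReal.ofReal (m * α ^ 2)) :
    avgError X (fun D : Fin n → X => (stdGaussian (EuclideanSpace ℝ (Fin m))).map (f D))
      ≤ ENNReal.ofReal α := by
  refine iSup_le fun D => ?_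
  rw [lintegral_map (by fun_prop) (hf D)]
  exact rms_le hm hα.le (h D)

section Rounding

variable {m n : ℕ} {X T : Finset (EuclideanSpace ℝ (Fin m))} {α : ℝ}
  {r : X → EuclideanSpace ℝ (Fin m)}

theorem meanPoint_rounded_mem (hn : 0 < n) (hr : IsRounding X T r) (D : Fin n → X) :
    meanPoint (fun i => r (D i)) ∈ convexHull ℝ (T : Set (EuclideanSpace ℝ (Fin m))) :=
  meanPoint_mem hn (convex_convexHull ℝ _) fun i => subset_convexHull ℝ _ (hr (D i)).1

theorem sq_norm_meanPoint_rounded_sub_le (hm : 0 < m) (hn : 0 < n) (hα : 0 < α)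
    (hT : IsCoarseNet X α T) (hr : IsRounding X T r) (D : Fin n → X) :
    ‖meanPoint (fun i => r (D i)) - meanPoint (fun i => (D i : EuclideanSpace ℝ (Fin m)))‖ ^ 2
      ≤ α ^ 2 / 4 * m := by
  have h : ‖meanPoint (fun i => r (D i)) - meanPoint (fun i => (D i : EuclideanSpace ℝ (Fin m)))‖
      ≤ α / 2 * Real.sqrt m := norm_meanPoint_sub_le hn fun i => by
    rw [norm_sub_rev, ← dist_eq_norm]
    exact hr.dist_le hm hα hT (D i)
  calc _ ≤ (α / 2 * Real.sqrt m) ^ 2 := by gcongr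
    _ = α ^ 2 / 4 * m := by rw [mul_pow, Real.sq_sqrt (by positivity)]; ring

theorem inCube_meanPoint (hn : 0 < n) (hX : ∀ x ∈ X, InCube x) (D : Fin n → X) :
    InCube (meanPoint (fun i => (D i : EuclideanSpace ℝ (Fin m)))) :=
  meanPoint_mem hn convex_inCube fun i => hX _ (D i).2

end Rounding

theorem cpm_isZCDP {m n : ℕ} (hm : 0 < m) (hn : 0 < n)
    {X T : Finset (EuclideanSpace ℝ (Fin m))} (hX : ∀ x ∈ X, InCube x) {α ρ : ℝ}
    (hρ : 0 < ρ) (hT : IsCoarseNet X α T) {r : X → EuclideanSpace ℝ (Fin m)}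
    (hr : IsRounding X T r) : IsZCDP ρ (fun D : Fin n → X => cpm T r ρ D) := by
  rcases isEmpty_or_nonempty (Fin n → X) with h | ⟨⟨D⟩⟩
  · exact ⟨fun D => (h.false D).elim, fun D => (h.false D).elim⟩
  · exact isZCDP_gaussian hm hn hρ (fun x => hT.inCube hX _ (hr x).1)
      (continuous_hullProj ⟨_, (hr (D ⟨0, hn⟩)).1⟩).measurable

theorem cpm_avgError_le {m n : ℕ} (hm : 0 < m) (hn : 0 < n)
    {X T : Finset (EuclideanSpace ℝ (Fin m))} (hX : ∀ x ∈ X, InCube x) {α ρ : ℝ} (hα : 0 < α)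
    (hρ : 0 < ρ) (hT : IsCoarseNet X α T) {r : X → EuclideanSpace ℝ (Fin m)}
    (hr : IsRounding X T r) (hcond : 10 ^ 7 * coarseBound 4 X α ρ ≤ n) :
    avgError X (fun D : Fin n → X => cpm T r ρ D) ≤ ENNReal.ofReal α := by
  have hne : ∀ D : Fin n → X, T.Nonempty := fun D => ⟨_, (hr (D ⟨0, hn⟩)).1⟩
  refine avgError_map_le hm hα (f := fun D => cpmOutput T r ρ D) (fun D => ?_) fun D => ?_
  · exact (continuous_hullProj (hne D)).measurable.comp (by fun_prop)
  · refine lintegral_sq_error_le hm hn hX hα hρ hT (inCube_meanPoint hn hX D)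
      (meanPoint_rounded_mem hn hr D) (sq_norm_meanPoint_rounded_sub_le hm hn hα hT hr D) hcond
      (cpmOutput T r ρ D) (fun z => ?_) fun z =>
        InCube.of_mem_convexHull (hT.inCube hX) (hullProj_mem (hne D) _)
    rw [cpmOutput, sub_self, norm_zero, zero_pow two_ne_zero]
    positivity

/-! ## Negligible noise -/

/-- Rounding and noise each contribute at most `2 (α/2)²` per coordinate, which adds up to `α²`
without any projection. -/
theorem lintegral_noisy_sub_mean_le {m : ℕ} {α σ : ℝ} (hσ : 0 ≤ σ) (hσα : σ ≤ α / 2)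
    {a x : EuclideanSpace ℝ (Fin m)} (hax : ‖x - a‖ ^ 2 ≤ α ^ 2 / 4 * m) :
    ∫⁻ z, ENNReal.ofReal (‖x + σ • z - a‖ ^ 2) ∂(stdGaussian (EuclideanSpace ℝ (Fin m)))
      ≤ ENNReal.ofReal (m * α ^ 2) := by
  refine (lintegral_ofReal_le_affine (a := 2 * (α ^ 2 / 4 * m)) (b := 2 * σ ^ 2)
    (by positivity) (by positivity) (Nat.cast_nonneg m) (fun z => ?_)
    (lintegral_sq_norm_stdGaussian (m := m)).le).trans (ENNReal.ofReal_le_ofReal ?_)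
  · have h := sq_norm_sub_le_two_mul (x + σ • z) x a
    rw [add_sub_cancel_left, norm_smul, mul_pow, Real.norm_eq_abs, sq_abs] at h
    linarith
  · have : σ ^ 2 ≤ (α / 2) ^ 2 := by gcongr
    nlinarith [show (0 : ℝ) ≤ m by positivity]

/-- The unperturbed point `x` is in the hull, so the projection moves `x + σ z` by at most `‖σ z‖`.
-/
theorem lintegral_noisy_sub_hullProj_le {m : ℕ} {α σ : ℝ} (hσ : 0 ≤ σ) (hσα : σ ≤ α / 2)
    {T : Finset (EuclideanSpace ℝ (Fin m))} (hT : T.Nonempty) {x : EuclideanSpace ℝ (Fin m)}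
    (hx : x ∈ convexHull ℝ (T : Set (EuclideanSpace ℝ (Fin m)))) :
    ∫⁻ z, ENNReal.ofReal (‖x + σ • z - hullProj T (x + σ • z)‖ ^ 2)
      ∂(stdGaussian (EuclideanSpace ℝ (Fin m))) ≤ ENNReal.ofReal (m * (α / 2) ^ 2) := by
  refine (lintegral_ofReal_le_affine (a := 0) (b := σ ^ 2)
    le_rfl (by positivity) (Nat.cast_nonneg m) (fun z => ?_)
    (lintegral_sq_norm_stdGaussian (m := m)).le).trans (ENNReal.ofReal_le_ofReal ?_)
  · have h := norm_hullProj_sub_le hT (x + σ • z) hx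
    rw [add_sub_cancel_left] at h
    have h2 : ‖x + σ • z - hullProj T (x + σ • z)‖ ^ 2 ≤ ‖σ • z‖ ^ 2 := by gcongr
    rw [norm_smul, mul_pow, Real.norm_eq_abs, sq_abs] at h2
    linarith
  · have : σ ^ 2 ≤ (α / 2) ^ 2 := by gcongr
    nlinarith [show (0 : ℝ) ≤ m by positivity]

/-! ## Reasoning about programs -/

namespace RealRAM

@[simp] theorem State.tick_nat (k : ℕ) (s : State) : (s.tick k).nat = s.nat := rfl
@[simp] theorem State.tick_real (k : ℕ) (s : State) : (s.tick k).real = s.real := rfl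
@[simp] theorem State.tick_drawn (k : ℕ) (s : State) : (s.tick k).drawn = s.drawn := rfl
@[simp] theorem State.tick_steps (k : ℕ) (s : State) : (s.tick k).steps = s.steps + k := rfl
@[simp] theorem State.writeNat_nat (r v : ℕ) (s : State) :
    (s.writeNat r v).nat = Function.update s.nat r v := rfl
@[simp] theorem State.writeNat_real (r v : ℕ) (s : State) : (s.writeNat r v).real = s.real := rfl
@[simp] theorem State.writeNat_drawn (r v : ℕ) (s : State) : (s.writeNat r v).drawn = s.drawn := rfl
@[simp] theorem State.writeNat_steps (r v : ℕ) (s : State) : (s.writeNat r v).steps = s.steps := rfl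
@[simp] theorem State.writeReal_nat (A i j : ℕ) (v : ℝ) (s : State) :
    (s.writeReal A i j v).nat = s.nat := rfl
@[simp] theorem State.writeReal_drawn (A i j : ℕ) (v : ℝ) (s : State) :
    (s.writeReal A i j v).drawn = s.drawn := rfl
@[simp] theorem State.writeReal_steps (A i j : ℕ) (v : ℝ) (s : State) :
    (s.writeReal A i j v).steps = s.steps := rfl

theorem State.writeReal_real (A i j : ℕ) (v : ℝ) (s : State) (B k l : ℕ) :
    (s.writeReal A i j v).real B k l = if B = A ∧ k = i ∧ l = j then v else s.real B k l := by
  simp only [State.writeReal, Function.update_apply]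
  by_cases h1 : B = A
  · subst h1
    by_cases h2 : k = i
    · subst h2
      by_cases h3 : l = j <;> simp [h3]
    · simp [h2]
  · simp [h1]

theorem State.writeReal_real_of_ne {A i j : ℕ} {v : ℝ} {s : State} {B : ℕ} (h : A ≠ B) :
    (s.writeReal A i j v).real B = s.real B := by
  funext k l
  rw [State.writeReal_real, if_neg]
  rintro ⟨rfl, _⟩
  exact h rfl

/-- Invariant rule for counted loops. -/
theorem Program.run_loop_induction {ω : ℕ → ℝ} {r : ℕ} {a : NatExpr} {c : Program} {s : State}
    (P : ℕ → State → Prop) (h0 : P 0 (s.tick (a.cost + 1)))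
    (hs : ∀ i < a.eval s, ∀ s', P i s' → P (i + 1) (c.run ω ((s'.writeNat r i).tick 1))) :
    P (a.eval s) ((loop r a c).run ω s) := by
  rw [Program.run]
  generalize a.eval s = k at hs
  induction k with
  | zero => simpa using h0
  | succ k ih =>
    rw [List.range_succ, List.foldl_append]
    exact hs k (Nat.lt_succ_self k) _ (ih fun i hi => hs i (hi.trans (Nat.lt_succ_self k)))

/-! ### Frame conditions -/

/-- The program writes no entry of array `A`. -/
def Program.PreservesArray (A : ℕ) : Program → Prop
  | skip => True
  | setNat _ _ => True
  | setReal B _ _ _ => B ≠ A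
  | gauss B _ _ => B ≠ A
  | seq c d => c.PreservesArray A ∧ d.PreservesArray A
  | ite _ c d => c.PreservesArray A ∧ d.PreservesArray A
  | loop _ _ c => c.PreservesArray A

/-- The program does not write register `r`. -/
def Program.PreservesReg (r : ℕ) : Program → Prop
  | skip => True
  | setNat q _ => q ≠ r
  | setReal _ _ _ _ => True
  | gauss _ _ _ => True
  | seq c d => c.PreservesReg r ∧ d.PreservesReg r
  | ite _ c d => c.PreservesReg r ∧ d.PreservesReg r
  | loop q _ c => q ≠ r ∧ c.PreservesReg r

/-- The program draws no Gaussians. -/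
def Program.IsDeterministic : Program → Prop
  | skip => True
  | setNat _ _ => True
  | setReal _ _ _ _ => True
  | gauss _ _ _ => False
  | seq c d => c.IsDeterministic ∧ d.IsDeterministic
  | ite _ c d => c.IsDeterministic ∧ d.IsDeterministic
  | loop _ _ c => c.IsDeterministic

theorem Program.PreservesArray.run_real {A : ℕ} {c : Program} (h : c.PreservesArray A) (ω : ℕ → ℝ)
    (s : State) : (c.run ω s).real A = s.real A := by
  induction c generalizing s with
  | skip => rfl
  | setNat r a => rfl
  | setReal B i j a => exact State.writeReal_real_of_ne h
  | gauss B i j => exact State.writeReal_real_of_ne h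
  | seq c d ihc ihd => rw [Program.run, ihd h.2, ihc h.1]
  | ite b c d ihc ihd =>
    rw [Program.run]
    split_ifs
    · rw [ihc h.1]; rfl
    · rw [ihd h.2]; rfl
  | loop r a c ih =>
    refine Program.run_loop_induction (fun _ s' => s'.real A = s.real A) rfl fun i _ s' hs' => ?_
    rw [ih h, ← hs']; rfl

theorem Program.PreservesReg.run_nat {r : ℕ} {c : Program} (h : c.PreservesReg r) (ω : ℕ → ℝ)
    (s : State) : (c.run ω s).nat r = s.nat r := by
  induction c generalizing s with
  | skip => rfl
  | setNat q a => exact Function.update_of_ne h.symm _ _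
  | setReal B i j a => rfl
  | gauss B i j => rfl
  | seq c d ihc ihd => rw [Program.run, ihd h.2, ihc h.1]
  | ite b c d ihc ihd =>
    rw [Program.run]
    split_ifs
    · rw [ihc h.1]; rfl
    · rw [ihd h.2]; rfl
  | loop q a c ih =>
    refine Program.run_loop_induction (fun _ s' => s'.nat r = s.nat r) rfl fun i _ s' hs' => ?_
    rw [ih h.2, ← hs']
    exact Function.update_of_ne h.1.symm _ _

theorem Program.IsDeterministic.run_drawn {c : Program} (h : c.IsDeterministic) (ω : ℕ → ℝ)
    (s : State) : (c.run ω s).drawn = s.drawn := by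
  induction c generalizing s with
  | skip => rfl
  | setNat q a => rfl
  | setReal B i j a => rfl
  | gauss B i j => exact h.elim
  | seq c d ihc ihd => rw [Program.run, ihd h.2, ihc h.1]
  | ite b c d ihc ihd =>
    rw [Program.run]
    split_ifs
    · rw [ihc h.1]; rfl
    · rw [ihd h.2]; rfl
  | loop q a c ih =>
    refine Program.run_loop_induction (fun _ s' => s'.drawn = s.drawn) rfl fun i _ s' hs' => ?_
    rw [ih h, ← hs']; rfl

/-! ### Polynomial running time -/

/-- The expression mentions only the input registers `0, 1, 2`. -/
def NatExpr.IsInput : NatExpr → Prop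
  | const _ => True
  | reg r => r < 3
  | add a b => a.IsInput ∧ b.IsInput
  | sub a b => a.IsInput ∧ b.IsInput

/-- The input registers are never written, and loop counts depend only on them. -/
def Program.HasInputLoops : Program → Prop
  | skip => True
  | setNat r _ => 3 ≤ r
  | setReal _ _ _ _ => True
  | gauss _ _ _ => True
  | seq c d => c.HasInputLoops ∧ d.HasInputLoops
  | ite _ c d => c.HasInputLoops ∧ d.HasInputLoops
  | loop r a c => 3 ≤ r ∧ a.IsInput ∧ c.HasInputLoops

theorem NatExpr.IsInput.exists_eval_le {a : NatExpr} (h : a.IsInput) :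
    ∃ k : ℕ, ∀ (V : ℕ) (s : State), 1 ≤ V → (∀ r < 3, s.nat r ≤ V) → a.eval s ≤ k * V := by
  induction a with
  | const c => exact ⟨c, fun V s hV _ => Nat.le_mul_of_pos_right c hV⟩
  | reg r => exact ⟨1, fun V s _ hs => by simpa [NatExpr.eval] using hs r h⟩
  | add a b iha ihb =>
    obtain ⟨k, hk⟩ := iha h.1
    obtain ⟨l, hl⟩ := ihb h.2
    refine ⟨k + l, fun V s hV hs => ?_⟩
    rw [add_mul]
    exact add_le_add (hk V s hV hs) (hl V s hV hs)
  | sub a b iha ihb =>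
    obtain ⟨k, hk⟩ := iha h.1
    exact ⟨k, fun V s hV hs => (Nat.sub_le _ _).trans (hk V s hV hs)⟩

theorem Program.HasInputLoops.run_nat {c : Program} (h : c.HasInputLoops) (ω : ℕ → ℝ) (s : State)
    {r : ℕ} (hr : r < 3) : (c.run ω s).nat r = s.nat r := by
  refine Program.PreservesReg.run_nat ?_ ω s
  induction c with
  | skip => trivial
  | setNat q a => exact (lt_of_lt_of_le hr h).ne'
  | setReal B i j a => trivial
  | gauss B i j => trivial
  | seq c d ihc ihd => exact ⟨ihc h.1, ihd h.2⟩
  | ite b c d ihc ihd => exact ⟨ihc h.1, ihd h.2⟩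
  | loop q a c ih => exact ⟨(lt_of_lt_of_le hr h.1).ne', ih h.2.2⟩

theorem Program.HasInputLoops.exists_steps_le {c : Program} (h : c.HasInputLoops) :
    ∃ a b : ℕ, ∀ (V : ℕ) (ω : ℕ → ℝ) (s : State), 1 ≤ V → (∀ r < 3, s.nat r ≤ V) →
      (c.run ω s).steps ≤ s.steps + a * V ^ b := by
  induction c with
  | skip => exact ⟨1, 0, fun V ω s _ _ => by simp [Program.run]⟩
  | setNat q a => exact ⟨a.cost + 1, 0, fun V ω s _ _ => by simp [Program.run]⟩
  | setReal B i j a =>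
    exact ⟨i.cost + j.cost + a.cost + 1, 0, fun V ω s _ _ => by simp [Program.run]⟩
  | gauss B i j => exact ⟨i.cost + j.cost + 1, 0, fun V ω s _ _ => by simp [Program.run]⟩
  | seq c d ihc ihd =>
    obtain ⟨a, b, hc⟩ := ihc h.1
    obtain ⟨a', b', hd⟩ := ihd h.2
    refine ⟨a + a', b + b', fun V ω s hV hs => ?_⟩
    have h1 := hc V ω s hV hs
    have h2 := hd V ω (c.run ω s) hV fun r hr => by rw [h.1.run_nat ω s hr]; exact hs r hr
    have h3 : V ^ b ≤ V ^ (b + b') := Nat.pow_le_pow_right hV (Nat.le_add_right _ _)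
    have h4 : V ^ b' ≤ V ^ (b + b') := Nat.pow_le_pow_right hV (Nat.le_add_left _ _)
    rw [Program.run, add_mul]
    have h5 := Nat.mul_le_mul_left a h3
    have h6 := Nat.mul_le_mul_left a' h4
    omega
  | ite t c d ihc ihd =>
    obtain ⟨a, b, hc⟩ := ihc h.1
    obtain ⟨a', b', hd⟩ := ihd h.2
    refine ⟨t.cost + 1 + a + a', b + b', fun V ω s hV hs => ?_⟩
    have h1 := hc V ω (s.tick (t.cost + 1)) hV hs
    have h2 := hd V ω (s.tick (t.cost + 1)) hV hs
    have h3 : V ^ b ≤ V ^ (b + b') := Nat.pow_le_pow_right hV (Nat.le_add_right _ _)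
    have h4 : V ^ b' ≤ V ^ (b + b') := Nat.pow_le_pow_right hV (Nat.le_add_left _ _)
    have h5 := Nat.mul_le_mul_left a h3
    have h6 := Nat.mul_le_mul_left a' h4
    have h7 := Nat.le_mul_of_pos_right (t.cost + 1) (Nat.pow_pos hV (n := b + b'))
    rw [State.tick_steps] at h1 h2
    rw [Program.run, add_mul, add_mul]
    split_ifs <;> omega
  | loop q e c ih =>
    obtain ⟨a, b, hc⟩ := ih h.2.2
    obtain ⟨k, hk⟩ := h.2.1.exists_eval_le
    refine ⟨e.cost + 1 + k * (1 + a), b + 1, fun V ω s hV hs => ?_⟩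
    have h1 := Program.run_loop_induction (ω := ω) (r := q) (a := e) (c := c) (s := s)
      (fun i s' => (∀ r < 3, s'.nat r = s.nat r) ∧
        s'.steps ≤ s.steps + (e.cost + 1) + i * (1 + a * V ^ b)) ⟨fun _ _ => rfl, by simp⟩
      (fun i _ s' hs' => by
        have hn : ∀ r < 3, ((s'.writeNat q i).tick 1).nat r = s.nat r := fun r hr => by
          rw [← hs'.1 r hr]
          exact Function.update_of_ne (lt_of_lt_of_le hr h.1).ne _ _
        refine ⟨fun r hr => by rw [h.2.2.run_nat _ _ hr, hn r hr], ?_⟩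
        have h2 := hc V ω ((s'.writeNat q i).tick 1) hV fun r hr => by rw [hn r hr]; exact hs r hr
        rw [State.tick_steps, State.writeNat_steps] at h2
        have h3 := hs'.2
        rw [add_mul i 1]
        omega)
    refine h1.2.trans ?_
    have hkV := hk V s hV hs
    have hVb := Nat.pow_pos hV (n := b)
    have h3 : 1 + a * V ^ b ≤ (1 + a) * V ^ b := by rw [add_mul]; omega
    have h4 : e.eval s * (1 + a * V ^ b) ≤ k * (1 + a) * V ^ (b + 1) := by
      calc e.eval s * (1 + a * V ^ b) ≤ k * V * ((1 + a) * V ^ b) := Nat.mul_le_mul hkV h3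
        _ = k * (1 + a) * V ^ (b + 1) := by ring
    have h5 := Nat.le_mul_of_pos_right (e.cost + 1) (Nat.pow_pos hV (n := b + 1))
    rw [add_mul]
    omega

/-! ### Subroutines

Register `5` counts coordinates, register `4` counts rows of array `4`. -/

/-- Entry `(0, 0)` of array `5` becomes the sum of `f` over the coordinates. -/
def accumulate (f : RealExpr) : Program :=
  .seq (.setReal 5 (.const 0) (.const 0) (.ofNat (.const 0)))
    (.loop 5 (.reg 0) (.setReal 5 (.const 0) (.const 0)
      (.add (.read 5 (.const 0) (.const 0)) f)))

/-- Row `i` of array `A` becomes `f`, coordinate by coordinate. -/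
def fillRow (A : ℕ) (i : NatExpr) (f : RealExpr) : Program :=
  .loop 5 (.reg 0) (.setReal A i (.reg 5) f)

/-- Row `0` of array `7` becomes the current row of array `4`, and its score is stored. -/
def keepRow : Program :=
  .seq (fillRow 7 (.const 0) (.read 4 (.reg 4) (.reg 5)))
    (.setReal 8 (.const 0) (.const 0) (.read 5 (.const 0) (.const 0)))

/-- Row `0` of array `7` becomes the first row of array `4` that minimizes the sum of `f`. -/
def scanRows (f : RealExpr) : Program :=
  .seq (.setNat 4 (.const 0)) (.seq (accumulate f) (.seq keepRow
    (.loop 4 (.reg 1) (.seq (accumulate f)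
      (.ite (.leReal (.read 8 (.const 0) (.const 0)) (.read 5 (.const 0) (.const 0)))
        .skip keepRow)))))

/-- The first `m` entries of row `i` of array `A` are the coordinates of `v`. -/
def State.HasRow {m : ℕ} (s : State) (A i : ℕ) (v : EuclideanSpace ℝ (Fin m)) : Prop :=
  ∀ j : Fin m, s.real A i j = v j

theorem State.HasRow.congr {m : ℕ} {s s' : State} {A i : ℕ} {v : EuclideanSpace ℝ (Fin m)}
    (h : s.HasRow A i v) (hs : s'.real A = s.real A) : s'.HasRow A i v := fun j => by
  rw [hs]; exact h j

/-- The hypothesis on `f` ranges over all states that agree with `s` off the loop counter and the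
accumulator, since `f` is evaluated in the middle of the loop. -/
theorem accumulate_run {m : ℕ} {f : RealExpr} {s : State} (hm : s.nat 0 = m) {φ : Fin m → ℝ}
    (hf : ∀ s' : State, (∀ r, r ≠ 5 → s'.nat r = s.nat r) → (∀ A, A ≠ 5 → s'.real A = s.real A) →
      ∀ j : Fin m, s'.nat 5 = j → f.eval s' = φ j) (ω : ℕ → ℝ) :
    ((accumulate f).run ω s).real 5 0 0 = ∑ j, φ j := by
  set s1 := (Program.setReal 5 (.const 0) (.const 0) (.ofNat (.const 0))).run ω s with hs1
  have h1 : s1.nat = s.nat := rfl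
  have h1' : s1.real 5 0 0 = 0 := by
    simp [hs1, Program.run, NatExpr.eval, RealExpr.eval, State.writeReal_real]
  have h1'' : ∀ A, A ≠ 5 → s1.real A = s.real A := fun A hA =>
    State.writeReal_real_of_ne hA.symm
  have key := Program.run_loop_induction (ω := ω) (r := 5) (a := .reg 0)
    (c := .setReal 5 (.const 0) (.const 0) (.add (.read 5 (.const 0) (.const 0)) f)) (s := s1)
    (fun i s' => (∀ r, r ≠ 5 → s'.nat r = s.nat r) ∧ (∀ A, A ≠ 5 → s'.real A = s.real A) ∧
      s'.real 5 0 0 = ∑ j : Fin m with j.val < i, φ j)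
    ⟨fun r _ => rfl, h1'', by simpa using h1'⟩
    (fun i hi s' hs' => by
      obtain ⟨h2, h3, h4⟩ := hs'
      have hi' : i < m := by simpa [NatExpr.eval, h1, hm] using hi
      have h5 := hf ((s'.writeNat 5 i).tick 1)
        (fun r hr => by rw [← h2 r hr]; exact Function.update_of_ne hr _ _) h3 ⟨i, hi'⟩ (by simp)
      refine ⟨fun r hr => ?_, fun A hA => ?_, ?_⟩
      · rw [← h2 r hr]; exact Function.update_of_ne hr _ _
      · rw [← h3 A hA]; exact State.writeReal_real_of_ne hA.symm
      · have h6 : (Finset.univ.filter fun j : Fin m => j.val < i + 1)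
            = insert ⟨i, hi'⟩ (Finset.univ.filter fun j : Fin m => j.val < i) := by
          ext j
          simp only [Finset.mem_filter, Finset.mem_univ, true_and, Finset.mem_insert, Fin.ext_iff]
          omega
        rw [h6, Finset.sum_insert (by simp)]
        simp [Program.run, NatExpr.eval, RealExpr.eval, State.writeReal_real, h5, h4, add_comm])
  have h0 : (NatExpr.reg 0).eval s1 = m := hm
  rw [h0] at key
  have h7 := key.2.2
  have h8 : (Finset.univ.filter fun j : Fin m => j.val < m) = Finset.univ := by
    ext j; simp
  rw [h8] at h7
  exact h7

/-- The expression `f` may read the entry about to be overwritten, which still has its old value;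
this permits in-place updates such as running sums and Frank–Wolfe steps. -/
theorem fillRow_run {m : ℕ} {A : ℕ} {i : NatExpr} {f : RealExpr} {s : State} (hm : s.nat 0 = m)
    {i₀ : ℕ} (hi : ∀ s' : State, (∀ r, r ≠ 5 → s'.nat r = s.nat r) → i.eval s' = i₀)
    {v : EuclideanSpace ℝ (Fin m)}
    (hf : ∀ s' : State, (∀ r, r ≠ 5 → s'.nat r = s.nat r) → (∀ B, B ≠ A → s'.real B = s.real B) →
      ∀ j : Fin m, s'.real A i₀ j = s.real A i₀ j → s'.nat 5 = j → f.eval s' = v j) (ω : ℕ → ℝ) :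
    ((fillRow A i f).run ω s).HasRow A i₀ v ∧
      ∀ k, k ≠ i₀ → ((fillRow A i f).run ω s).real A k = s.real A k := by
  have key := Program.run_loop_induction (ω := ω) (r := 5) (a := .reg 0)
    (c := .setReal A i (.reg 5) f) (s := s)
    (fun l s' => (∀ r, r ≠ 5 → s'.nat r = s.nat r) ∧ (∀ B, B ≠ A → s'.real B = s.real B) ∧
      (∀ k, k ≠ i₀ → s'.real A k = s.real A k) ∧
      (∀ j : Fin m, j.val < l → s'.real A i₀ j = v j) ∧
      (∀ j : Fin m, l ≤ j.val → s'.real A i₀ j = s.real A i₀ j))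
    ⟨fun r _ => rfl, fun _ _ => rfl, fun _ _ => rfl, fun j hj => absurd hj (by omega),
      fun _ _ => rfl⟩
    (fun l hl s' hs' => by
      obtain ⟨h2, h3, h4, h5, h6⟩ := hs'
      have hl' : l < m := by simpa [NatExpr.eval, hm] using hl
      have hreg : ∀ r, r ≠ 5 → ((s'.writeNat 5 l).tick 1).nat r = s.nat r := fun r hr => by
        rw [← h2 r hr]; exact Function.update_of_ne hr _ _
      have h7 := hf ((s'.writeNat 5 l).tick 1) hreg h3 ⟨l, hl'⟩ (h6 ⟨l, hl'⟩ le_rfl) (by simp)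
      have h8 := hi _ hreg
      refine ⟨hreg, fun B hB => ?_, fun k hk => ?_, fun j hj => ?_, fun j hj => ?_⟩
      · rw [← h3 B hB]; exact State.writeReal_real_of_ne hB.symm
      · funext q
        simp only [Program.run, State.tick_real, h8, State.writeReal_real, State.writeNat_real]
        rw [if_neg (by tauto), h4 k hk]
      · simp only [Program.run, State.tick_real, h8, State.writeReal_real, State.writeNat_real,
          NatExpr.eval, State.tick_nat, State.writeNat_nat, Function.update_self, true_and, h7]
        split_ifs with h9
        · rw [show (⟨l, hl'⟩ : Fin m) = j from Fin.ext h9.symm]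
        · exact h5 j (by omega)
      · simp only [Program.run, State.tick_real, h8, State.writeReal_real, State.writeNat_real,
          NatExpr.eval, State.tick_nat, State.writeNat_nat, Function.update_self, true_and]
        rw [if_neg (by omega)]
        exact h6 j (by omega))
  have h0 : (NatExpr.reg 0).eval s = m := hm
  rw [h0] at key
  exact ⟨fun j => key.2.2.2.1 j j.2, key.2.2.1⟩

end RealRAM

/-- The first index below `k` at which `g` is smallest. -/
noncomputable def firstMin (g : ℕ → ℝ) : ℕ → ℕ
  | 0 => 0
  | k + 1 => open Classical in if g (firstMin g k) ≤ g k then firstMin g k else k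

theorem firstMin_lt (g : ℕ → ℝ) {k : ℕ} (hk : 0 < k) : firstMin g k < k := by
  induction k with
  | zero => omega
  | succ k ih =>
    rw [firstMin]
    split_ifs
    · rcases Nat.eq_zero_or_pos k with rfl | h
      · simp [firstMin]
      · exact (ih h).trans (Nat.lt_succ_self k)
    · exact Nat.lt_succ_self k

theorem firstMin_le (g : ℕ → ℝ) {k i : ℕ} (hi : i < k) : g (firstMin g k) ≤ g i := by
  induction k with
  | zero => omega
  | succ k ih =>
    rw [firstMin]
    rcases Nat.lt_succ_iff_lt_or_eq.1 hi with h | rfl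
    · split_ifs with h1
      · exact ih h
      · exact (not_le.1 h1).le.trans (ih h)
    · split_ifs with h1
      · exact h1
      · exact le_rfl

/-- The Frank–Wolfe vertices depend on the noise through such an index; measurability of the
program's post-processing map rests on this. -/
theorem measurable_firstMin {Ω : Type*} [MeasurableSpace Ω] {g : Ω → ℕ → ℝ}
    (hg : ∀ i, Measurable fun z => g z i) (k : ℕ) : Measurable fun z => firstMin (g z) k := by
  induction k with
  | zero => exact measurable_const
  | succ k ih =>
    simp only [firstMin]
    refine Measurable.ite ?_ ih measurable_const
    refine measurableSet_le ?_ (hg k)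
    exact (measurable_from_prod_countable_right (f := fun p : ℕ × Ω => g p.2 p.1) hg).comp
      (ih.prodMk measurable_id)

namespace RealRAM

theorem scanRows_run {m N : ℕ} (hN : 0 < N) {f : RealExpr} {s : State} (hm : s.nat 0 = m)
    (hsN : s.nat 1 = N) {φ : ℕ → Fin m → ℝ} {t : ℕ → EuclideanSpace ℝ (Fin m)}
    (ht : ∀ k < N, s.HasRow 4 k (t k))
    (hf : ∀ s' : State, (∀ r, r ≠ 4 → r ≠ 5 → s'.nat r = s.nat r) →
      (∀ A, A ≠ 5 → A ≠ 7 → A ≠ 8 → s'.real A = s.real A) → s'.nat 4 < N →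
      ∀ j : Fin m, s'.nat 5 = j → f.eval s' = φ (s'.nat 4) j) (ω : ℕ → ℝ) :
    ((scanRows f).run ω s).HasRow 7 0 (t (firstMin (fun k => ∑ j, φ k j) N)) ∧
      ((scanRows f).run ω s).real 8 0 0 =
        ∑ j, φ (firstMin (fun k => ∑ j, φ k j) N) j := by
  set g : ℕ → ℝ := fun k => ∑ j, φ k j with hg
  have hacc : ∀ s' : State, (∀ r, r ≠ 4 → r ≠ 5 → s'.nat r = s.nat r) →
      (∀ A, A ≠ 5 → A ≠ 7 → A ≠ 8 → s'.real A = s.real A) → s'.nat 4 < N →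
      ((accumulate f).run ω s').real 5 0 0 = g (s'.nat 4) := by
    intro s' h1 h2 h3
    refine accumulate_run (by rw [h1 0 (by norm_num) (by norm_num), hm])
      (fun s'' h4 h5 j hj => ?_) ω
    rw [hf s'' (fun r hr hr' => by rw [h4 r hr', h1 r hr hr'])
      (fun A hA hA' hA'' => by rw [h5 A hA, h2 A hA hA' hA''])
      (by rw [h4 4 (by norm_num)]; exact h3) j hj, h4 4 (by norm_num)]
  have haccreg : ∀ s' : State, ∀ r, r ≠ 5 → ((accumulate f).run ω s').nat r = s'.nat r :=
    fun s' r hr => Program.PreservesReg.run_nat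
      (by simp [accumulate, Program.PreservesReg, hr.symm]) ω s'
  have haccarr : ∀ s' : State, ∀ A, A ≠ 5 → ((accumulate f).run ω s').real A = s'.real A :=
    fun s' A hA => Program.PreservesArray.run_real
      (by simp [accumulate, Program.PreservesArray, hA.symm]) ω s'
  have hkeepreg : ∀ s' : State, ∀ r, r ≠ 5 → (keepRow.run ω s').nat r = s'.nat r :=
    fun s' r hr => Program.PreservesReg.run_nat
      (by simp [keepRow, fillRow, Program.PreservesReg, hr.symm]) ω s'
  have hkeeparr : ∀ s' : State, ∀ A, A ≠ 7 → A ≠ 8 → (keepRow.run ω s').real A = s'.real A :=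
    fun s' A hA hA' => Program.PreservesArray.run_real
      (by simp [keepRow, fillRow, Program.PreservesArray, hA.symm, hA'.symm]) ω s'
  have hkeep : ∀ s' : State, s'.nat 0 = m → s'.nat 4 < N → s'.real 4 = s.real 4 →
      (keepRow.run ω s').HasRow 7 0 (t (s'.nat 4)) ∧
        (keepRow.run ω s').real 8 0 0 = s'.real 5 0 0 := by
    intro s' h1 h2 h3
    have h4 := (fillRow_run (m := m) (A := 7) (i := .const 0)
      (f := .read 4 (.reg 4) (.reg 5)) (s := s') h1 (i₀ := 0) (fun _ _ => rfl)
      (v := t (s'.nat 4)) (fun s'' h5 h6 j _ h7 => by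
        simp only [RealExpr.eval, NatExpr.eval, h7]
        rw [h5 4 (by norm_num), h6 4 (by norm_num), h3]
        exact ht _ h2 j) ω).1
    have h5 : ((fillRow 7 (.const 0) (.read 4 (.reg 4) (.reg 5))).run ω s').real 5 = s'.real 5 :=
      Program.PreservesArray.run_real (by simp [fillRow, Program.PreservesArray]) ω s'
    refine ⟨fun j => ?_, ?_⟩
    · rw [← h4 j]
      simp only [keepRow, Program.run, State.tick_real]
      rw [State.writeReal_real_of_ne (by norm_num)]
    · rw [← h5]
      simp [keepRow, Program.run, State.writeReal_real, NatExpr.eval, RealExpr.eval]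
  set s1 := (Program.setNat 4 (.const 0)).run ω s with hs1
  have h1reg : ∀ r, r ≠ 4 → s1.nat r = s.nat r := fun r hr => Function.update_of_ne hr _ _
  have h14 : s1.nat 4 = 0 := by simp [hs1, Program.run, NatExpr.eval]
  set s2 := (accumulate f).run ω s1 with hs2
  have h2acc : s2.real 5 0 0 = g 0 := by
    rw [hs2, hacc s1 (fun r hr _ => h1reg r hr) (fun _ _ _ _ => rfl) (by rw [h14]; exact hN), h14]
  have h2reg : ∀ r, r ≠ 4 → r ≠ 5 → s2.nat r = s.nat r := fun r hr hr' => by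
    rw [hs2, haccreg _ r hr', h1reg r hr]
  have h24 : s2.nat 4 = 0 := by rw [hs2, haccreg _ 4 (by norm_num), h14]
  have h2arr : ∀ A, A ≠ 5 → s2.real A = s.real A := fun A hA => haccarr s1 A hA
  set s3 := keepRow.run ω s2 with hs3
  have h3 := hkeep s2 (by rw [h2reg 0 (by norm_num) (by norm_num), hm]) (by rw [h24]; exact hN)
    (h2arr 4 (by norm_num))
  rw [h24, h2acc] at h3
  -- Row `0` is stored before the loop, which matches the default `firstMin g 0 = 0`. The loop looks
  -- at row `0` again, without effect.
  have key := Program.run_loop_induction (ω := ω) (r := 4) (a := .reg 1)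
    (c := .seq (accumulate f)
      (.ite (.leReal (.read 8 (.const 0) (.const 0)) (.read 5 (.const 0) (.const 0)))
        .skip keepRow)) (s := s3)
    (fun i s' => (∀ r, r ≠ 4 → r ≠ 5 → s'.nat r = s.nat r) ∧
      (∀ A, A ≠ 5 → A ≠ 7 → A ≠ 8 → s'.real A = s.real A) ∧
      s'.HasRow 7 0 (t (firstMin g i)) ∧ s'.real 8 0 0 = g (firstMin g i))
    ⟨fun r hr hr' => by
        rw [State.tick_nat, hs3, hkeepreg _ r hr', h2reg r hr hr'],
      fun A hA hA' hA'' => by rw [State.tick_real, hs3, hkeeparr _ A hA' hA'', h2arr A hA],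
      h3.1, h3.2⟩
    (fun i hi s' hs' => by
      obtain ⟨a1, a2, a3, a4⟩ := hs'
      have hi' : i < N := by
        have : (NatExpr.reg 1).eval s3 = N := by
          rw [NatExpr.eval, hs3, hkeepreg _ 1 (by norm_num), h2reg 1 (by norm_num) (by norm_num),
            hsN]
        rwa [this] at hi
      set u := (s'.writeNat 4 i).tick 1 with hu
      have u4 : u.nat 4 = i := by simp [hu]
      have ureg : ∀ r, r ≠ 4 → r ≠ 5 → u.nat r = s.nat r := fun r hr hr' => by
        rw [← a1 r hr hr']; exact Function.update_of_ne hr _ _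
      set w := (accumulate f).run ω u with hw
      have wacc : w.real 5 0 0 = g i := by
        rw [hw, hacc u ureg a2 (by rw [u4]; exact hi'), u4]
      have wreg : ∀ r, r ≠ 4 → r ≠ 5 → w.nat r = s.nat r := fun r hr hr' => by
        rw [hw, haccreg _ r hr', ureg r hr hr']
      have w4 : w.nat 4 = i := by rw [hw, haccreg _ 4 (by norm_num), u4]
      have warr : ∀ A, A ≠ 5 → w.real A = s'.real A := fun A hA => haccarr u A hA
      have w7 : w.HasRow 7 0 (t (firstMin g i)) := a3.congr (warr 7 (by norm_num))
      have w8 : w.real 8 0 0 = g (firstMin g i) := by rw [warr 8 (by norm_num)]; exact a4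
      rw [Program.run, Program.run, ← hw]
      have htest : (Test.leReal (.read 8 (.const 0) (.const 0)) (.read 5 (.const 0) (.const 0))).holds w
          ↔ g (firstMin g i) ≤ g i := by
        simp only [Test.holds, RealExpr.eval, NatExpr.eval, wacc, w8]
      by_cases hle : g (firstMin g i) ≤ g i
      · rw [if_pos (htest.2 hle), firstMin, if_pos hle]
        refine ⟨wreg, fun A hA hA' hA'' => ?_, w7, w8⟩
        rw [← a2 A hA hA' hA'', ← warr A hA]
        rfl
      · rw [if_neg (mt htest.1 hle), firstMin, if_neg hle]
        have hk := hkeep (w.tick (Test.cost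
            (.leReal (.read 8 (.const 0) (.const 0)) (.read 5 (.const 0) (.const 0))) + 1))
          (by rw [State.tick_nat, wreg 0 (by norm_num) (by norm_num), hm])
          (by rw [State.tick_nat, w4]; exact hi')
          (by rw [State.tick_real, warr 4 (by norm_num), a2 4 (by norm_num) (by norm_num) (by norm_num)])
        rw [State.tick_nat, w4, State.tick_real, wacc] at hk
        refine ⟨fun r hr hr' => ?_, fun A hA hA' hA'' => ?_, hk.1, hk.2⟩
        · rw [hkeepreg _ r hr', State.tick_nat, wreg r hr hr']
        · rw [hkeeparr _ A hA' hA'', State.tick_real, warr A hA, a2 A hA hA' hA''])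
  have h0 : (NatExpr.reg 1).eval s3 = N := by
    rw [NatExpr.eval, hs3, hkeepreg _ 1 (by norm_num), h2reg 1 (by norm_num) (by norm_num), hsN]
  rw [h0] at key
  exact ⟨key.2.2.1, key.2.2.2⟩

theorem gaussLoop_run {m : ℕ} {s : State} (hm : s.nat 0 = m) (ω : ℕ → ℝ) (j : Fin m) :
    ((Program.loop 5 (.reg 0) (.gauss 9 (.const 0) (.reg 5))).run ω s).real 9 0 j
      = ω (s.drawn + j) := by
  have key := Program.run_loop_induction (ω := ω) (r := 5) (a := .reg 0)
    (c := .gauss 9 (.const 0) (.reg 5)) (s := s)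
    (fun l s' => s'.drawn = s.drawn + l ∧ ∀ j : ℕ, j < l → s'.real 9 0 j = ω (s.drawn + j))
    ⟨rfl, fun j hj => absurd hj (by omega)⟩
    (fun l _ s' hs' => by
      refine ⟨by simp [Program.run, hs'.1, add_assoc], fun j hj => ?_⟩
      simp only [Program.run, State.tick_real, State.writeReal_real, NatExpr.eval, State.tick_nat,
        State.writeNat_nat, Function.update_self, true_and, State.tick_drawn, State.writeNat_drawn,
        State.writeNat_real]
      split_ifs with h
      · rw [hs'.1, h]
      · exact hs'.2 j (by omega))
  have h0 : (NatExpr.reg 0).eval s = m := hm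
  rw [h0] at key
  exact key.2 j j.2

end RealRAM

/-! ## The computations performed by the program -/

section Model

variable {m : ℕ}

/-- The first of the rows `t 0, …, t (N - 1)` that is closest to `x`. -/
noncomputable def nearestRow (t : ℕ → EuclideanSpace ℝ (Fin m)) (N : ℕ)
    (x : EuclideanSpace ℝ (Fin m)) : EuclideanSpace ℝ (Fin m) :=
  t (firstMin (fun k => ‖t k - x‖ ^ 2) N)

open Classical in
/-- The greedy net after `i` candidates. All `N` rows are initially the first candidate. -/
noncomputable def greedyNet (u : ℕ → EuclideanSpace ℝ (Fin m)) (N : ℕ) (θ : ℝ) :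
    ℕ → ℕ → EuclideanSpace ℝ (Fin m)
  | 0 => fun _ => u 0
  | i + 1 =>
    if θ ≤ ‖nearestRow (greedyNet u N θ i) N (u i) - u i‖ ^ 2 then
      Function.update (greedyNet u N θ i) i (u i)
    else greedyNet u N θ i

/-- Frank–Wolfe iterates for the projection of `w` onto the convex hull of the rows. -/
noncomputable def frankWolfe (t : ℕ → EuclideanSpace ℝ (Fin m)) (N : ℕ)
    (w : EuclideanSpace ℝ (Fin m)) : ℕ → EuclideanSpace ℝ (Fin m)
  | 0 => t 0
  | k + 1 => frankWolfe t N w k + (2 / ((k : ℝ) + 2)) •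
      (t (firstMin (fun i => inner ℝ (t i) (frankWolfe t N w k - w)) N) - frankWolfe t N w k)

open Classical in
/-- The final step of the program: skip the projection if the noise level `σ` is below `τ`. -/
noncomputable def approxProj (t : ℕ → EuclideanSpace ℝ (Fin m)) (N : ℕ) (σ τ : ℝ) (K : ℕ)
    (w : EuclideanSpace ℝ (Fin m)) : EuclideanSpace ℝ (Fin m) :=
  if σ ≤ τ then w else frankWolfe t N w K

theorem measurable_frankWolfe (t : ℕ → EuclideanSpace ℝ (Fin m)) (N k : ℕ) :
    Measurable fun w => frankWolfe t N w k := by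
  induction k with
  | zero => exact measurable_const
  | succ k ih =>
    have h1 : Measurable fun w =>
        t (firstMin (fun i => inner ℝ (t i) (frankWolfe t N w k - w)) N) :=
      (measurable_of_countable t).comp (measurable_firstMin (fun i => by fun_prop) N)
    have h2 := h1.sub ih
    exact ih.add (h2.const_smul (2 / ((k : ℝ) + 2)))

theorem measurable_approxProj (t : ℕ → EuclideanSpace ℝ (Fin m)) (N : ℕ) (σ τ : ℝ) (K : ℕ) :
    Measurable (approxProj t N σ τ K) := by
  unfold approxProj
  split_ifs
  · exact measurable_id
  · exact measurable_frankWolfe t N K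

/-! ### Correctness of the greedy net and of the Frank–Wolfe iterates. -/

theorem nearestRow_mem (t : ℕ → EuclideanSpace ℝ (Fin m)) {N : ℕ} (hN : 0 < N)
    (x : EuclideanSpace ℝ (Fin m)) : ∃ k < N, nearestRow t N x = t k :=
  ⟨_, firstMin_lt _ hN, rfl⟩

theorem norm_nearestRow_sub_le (t : ℕ → EuclideanSpace ℝ (Fin m)) {N k : ℕ} (hk : k < N)
    (x : EuclideanSpace ℝ (Fin m)) : ‖nearestRow t N x - x‖ ^ 2 ≤ ‖t k - x‖ ^ 2 :=
  firstMin_le (fun k => ‖t k - x‖ ^ 2) hk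

/-- Unused rows repeat `u 0`, so the array always has `N` valid rows and no net size is stored. By
the second clause row `0` and the rows from `i` on still hold `u 0`, so overwriting row `i` loses no
net point. The last clause is strict, which is what maximality requires. -/
theorem greedyNet_spec {u : ℕ → EuclideanSpace ℝ (Fin m)} {N : ℕ} {θ : ℝ} (hθ : 0 < θ)
    {i : ℕ} (hi : i ≤ N) :
    (∀ k, greedyNet u N θ i k = u 0 ∨ ∃ j < i, greedyNet u N θ i k = u j) ∧
    (∀ k, k = 0 ∨ i ≤ k → greedyNet u N θ i k = u 0) ∧
    (∀ k < N, ∀ l < N, greedyNet u N θ i k ≠ greedyNet u N θ i l →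
      θ ≤ ‖greedyNet u N θ i k - greedyNet u N θ i l‖ ^ 2) ∧
    (∀ j < i, ∃ k < N, ‖greedyNet u N θ i k - u j‖ ^ 2 < θ) := by
  induction i with
  | zero => exact ⟨fun k => Or.inl rfl, fun k _ => rfl, fun k _ l _ h => absurd rfl h, fun j hj => absurd hj (by omega)⟩
  | succ i ih =>
    obtain ⟨h1, h2, h3, h4⟩ := ih (by omega)
    set t := greedyNet u N θ i with ht
    rw [greedyNet, ← ht]
    split_ifs with hfar
    · have hfar' : ∀ k < N, θ ≤ ‖t k - u i‖ ^ 2 := fun k hk =>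
        hfar.trans (norm_nearestRow_sub_le t hk (u i))
      -- The first candidate already occupies row `0`, so it is never far from the net.
      have hi0 : i ≠ 0 := by
        rintro rfl
        have := hfar' 0 (by omega)
        rw [h2 0 (Or.inl rfl), sub_self, norm_zero] at this
        norm_num at this
        linarith
      refine ⟨fun k => ?_, fun k hk => ?_, fun k hk l hl hkl => ?_, fun j hj => ?_⟩
      · by_cases hki : k = i
        · subst hki
          exact Or.inr ⟨k, by omega, Function.update_self _ _ _⟩
        · rw [Function.update_of_ne hki]
          exact (h1 k).imp_right fun ⟨j, hj, e⟩ => ⟨j, by omega, e⟩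
      · have hki : k ≠ i := by rintro rfl; omega
        rw [Function.update_of_ne hki]
        exact h2 k (by omega)
      · by_cases hki : k = i <;> by_cases hli : l = i
        · exact absurd (by rw [hki, hli]) hkl
        · rw [hki, Function.update_self, Function.update_of_ne hli, norm_sub_rev]
          exact hfar' l hl
        · rw [hli, Function.update_self, Function.update_of_ne hki]
          exact hfar' k hk
        · rw [Function.update_of_ne hki, Function.update_of_ne hli] at hkl ⊢
          exact h3 k hk l hl hkl
      · by_cases hji : j = i
        · subst hji
          exact ⟨j, by omega, by rw [Function.update_self, sub_self, norm_zero]; simpa using hθ⟩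
        · obtain ⟨k, hk, hkj⟩ := h4 j (by omega)
          by_cases hki : k = i
          · refine ⟨0, by omega, ?_⟩
            rw [Function.update_of_ne (Ne.symm hi0), h2 0 (Or.inl rfl), ← h2 k (Or.inr hki.ge)]
            exact hkj
          · exact ⟨k, hk, by rw [Function.update_of_ne hki]; exact hkj⟩
    · refine ⟨fun k => (h1 k).imp_right fun ⟨j, hj, e⟩ => ⟨j, by omega, e⟩,
        fun k hk => h2 k (by omega), h3, fun j hj => ?_⟩
      by_cases hji : j = i
      · subst hji
        obtain ⟨k, hk, e⟩ := nearestRow_mem t (show 0 < N by omega) (u j)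
        exact ⟨k, hk, by rw [← e]; exact not_le.1 hfar⟩
      · exact h4 j (by omega)

theorem isCoarseNet_greedyNet [DecidableEq (EuclideanSpace ℝ (Fin m))] (hm : 0 < m)
    {X : Finset (EuclideanSpace ℝ (Fin m))}
    {u : ℕ → EuclideanSpace ℝ (Fin m)} {N : ℕ} (hN : 0 < N) (huX : ∀ k < N, u k ∈ X)
    (hXu : ∀ x ∈ X, ∃ k < N, u k = x) {α : ℝ} (hα : 0 < α) :
    IsCoarseNet X α ((Finset.range N).image (greedyNet u N (α * α * m / 4) N)) := by
  have hm' : (0 : ℝ) < m := by exact_mod_cast hm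
  have hr : 0 < Real.sqrt m := Real.sqrt_pos.2 hm'
  set θ := α * α * m / 4 with hθ
  have hθe : θ = (α / 2 * Real.sqrt m) ^ 2 := by rw [mul_pow, Real.sq_sqrt hm'.le, hθ]; ring
  have hle : ∀ x y : EuclideanSpace ℝ (Fin m), α / 2 ≤ dist x y / Real.sqrt m ↔ θ ≤ ‖x - y‖ ^ 2 := by
    intro x y
    rw [le_div_iff₀ hr, dist_eq_norm, hθe]
    exact (pow_le_pow_iff_left₀ (by positivity) (norm_nonneg _) two_ne_zero).symm
  obtain ⟨h1, h2, h3, h4⟩ := greedyNet_spec (u := u) (N := N) (θ := θ) (by positivity) le_rfl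
  refine ⟨⟨?_, ?_⟩, ?_⟩
  · intro x hx
    obtain ⟨k, hk, rfl⟩ := Finset.mem_image.1 hx
    rcases h1 k with e | ⟨j, hj, e⟩
    · rw [e]; exact huX 0 hN
    · rw [e]; exact huX j hj
  · intro x hx y hy hxy
    obtain ⟨k, hk, rfl⟩ := Finset.mem_image.1 hx
    obtain ⟨l, hl, rfl⟩ := Finset.mem_image.1 hy
    exact (hle _ _).2 (h3 k (Finset.mem_range.1 hk) l (Finset.mem_range.1 hl) hxy)
  -- Every point of a larger separated set is strictly closer than the separation to some net point,
  -- which also lies in that set; so the two coincide.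
  · rintro S ⟨hSX, hS⟩ hTS x hx
    obtain ⟨j, hj, rfl⟩ := hXu x (hSX hx)
    obtain ⟨k, hk, hkj⟩ := h4 j hj
    have hkT := Finset.mem_image_of_mem (greedyNet u N θ N) (Finset.mem_range.2 hk)
    by_cases he : greedyNet u N θ N k = u j
    · rw [← he]; exact hkT
    · exact absurd ((hle _ _).1 (hS _ (hTS hkT) _ hx he)) (not_le.2 hkj)

theorem sq_norm_frankWolfe_sub_hullProj_le [DecidableEq (EuclideanSpace ℝ (Fin m))]
    {t : ℕ → EuclideanSpace ℝ (Fin m)} {N : ℕ} (hN : 0 < N)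
    {T : Finset (EuclideanSpace ℝ (Fin m))} (hT : T = (Finset.range N).image t) {D : ℝ}
    (hD : ∀ p ∈ convexHull ℝ (T : Set (EuclideanSpace ℝ (Fin m))),
      ∀ q ∈ convexHull ℝ (T : Set (EuclideanSpace ℝ (Fin m))), ‖p - q‖ ^ 2 ≤ D)
    (w : EuclideanSpace ℝ (Fin m)) (k : ℕ) :
    ‖frankWolfe t N w k - hullProj T w‖ ^ 2 ≤ 4 * D / (k + 2) := by
  have htT : ∀ k < N, t k ∈ T := fun k hk => by
    rw [hT]; exact Finset.mem_image_of_mem t (Finset.mem_range.2 hk)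
  have hne : T.Nonempty := ⟨_, htT 0 hN⟩
  refine sq_norm_frankWolfe_sub_le (convex_convexHull ℝ _) hD (hullProj_mem hne w)
    (fun q hq => inner_sub_hullProj_nonpos hne w hq) (fun k => frankWolfe t N w k)
    (fun k => t (firstMin (fun i => inner ℝ (t i) (frankWolfe t N w k - w)) N))
    (subset_convexHull ℝ _ (htT 0 hN))
    (fun k => subset_convexHull ℝ _ (htT _ (firstMin_lt _ hN))) (fun k => rfl) (fun k => ?_) k
  -- Minimizing a linear function over the rows minimizes it over their hull, so the selected row
  -- does at least as well as the projection.
  set y := frankWolfe t N w k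
  set b := inner ℝ (t (firstMin (fun i => inner ℝ (t i) (y - w)) N)) (y - w)
  have hconv : Convex ℝ {q : EuclideanSpace ℝ (Fin m) | b ≤ inner ℝ q (y - w)} :=
    convex_halfSpace_ge (f := fun q : EuclideanSpace ℝ (Fin m) => inner ℝ q (y - w))
      ⟨fun a b => inner_add_left a b _, fun c a => real_inner_smul_left a _ c⟩ b
  refine convexHull_min (fun q hq => ?_) hconv (hullProj_mem hne w)
  rw [hT] at hq
  obtain ⟨i, hi, rfl⟩ := Finset.mem_image.1 (Finset.mem_coe.1 hq)
  exact firstMin_le (fun i => inner ℝ (t i) (y - w)) (Finset.mem_range.1 hi)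

theorem frankWolfe_mem {t : ℕ → EuclideanSpace ℝ (Fin m)} {N : ℕ} (hN : 0 < N)
    {K : Set (EuclideanSpace ℝ (Fin m))} (hK : Convex ℝ K) (ht : ∀ k < N, t k ∈ K)
    (w : EuclideanSpace ℝ (Fin m)) (k : ℕ) : frankWolfe t N w k ∈ K := by
  induction k with
  | zero => exact ht 0 hN
  | succ k ih =>
    have h2 : (2 : ℝ) / ((k : ℝ) + 2) ≤ 1 := by
      rw [div_le_one (by positivity)]; linarith [k.cast_nonneg (α := ℝ)]
    exact hK.add_smul_sub_mem ih (ht _ (firstMin_lt _ hN)) ⟨by positivity, h2⟩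

theorem sum_sub_mul_sub (x y : EuclideanSpace ℝ (Fin m)) :
    ∑ j, (x j - y j) * (x j - y j) = ‖x - y‖ ^ 2 := by
  rw [EuclideanSpace.real_norm_sq_eq]
  exact Finset.sum_congr rfl fun j _ => by simp [sq]

end Model

/-! ## The program -/

namespace RealRAM

/-- The squared difference of the current entries of array `4` and of row `3` of array `A`. -/
def sqDiff (A : ℕ) : RealExpr :=
  .mul (.sub (.read 4 (.reg 4) (.reg 5)) (.read A (.reg 3) (.reg 5)))
    (.sub (.read 4 (.reg 4) (.reg 5)) (.read A (.reg 3) (.reg 5)))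

/-- The squared separation `α² m / 4`. -/
def sqSeparation : RealExpr :=
  .div (.mul (.mul (.read 2 (.const 0) (.const 0)) (.read 2 (.const 0) (.const 0)))
    (.ofNat (.reg 0))) (.ofNat (.const 4))

/-- The noise level `√m / (n √(2ρ))`. -/
def noiseLevel : RealExpr :=
  .div (.sqrt (.ofNat (.reg 0))) (.mul (.ofNat (.reg 2))
    (.sqrt (.mul (.ofNat (.const 2)) (.read 2 (.const 0) (.const 1)))))

def netInit : Program := .loop 3 (.reg 1) (fillRow 4 (.reg 3) (.read 0 (.const 0) (.reg 5)))

def netStep : Program :=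
  .seq (scanRows (sqDiff 0)) (.ite (.leReal sqSeparation (.read 8 (.const 0) (.const 0)))
    (fillRow 4 (.reg 3) (.read 0 (.reg 3) (.reg 5))) .skip)

/-- Store a maximal separated subset of the universe in array `4`. -/
def netProgram : Program := .seq netInit (.loop 3 (.reg 1) netStep)

def roundStep : Program :=
  .seq (scanRows (sqDiff 1)) (fillRow 6 (.const 0)
    (.add (.read 6 (.const 0) (.reg 5)) (.read 7 (.const 0) (.reg 5))))

/-- Add the rounded data points to row `0` of array `6`. -/
def roundProgram : Program := .loop 3 (.reg 2) roundStep

/-- Divide row `0` of array `6` by `n` and add the noise. -/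
def noiseProgram : Program :=
  .seq (.loop 5 (.reg 0) (.gauss 9 (.const 0) (.reg 5)))
    (fillRow 6 (.const 0) (.add (.div (.read 6 (.const 0) (.reg 5)) (.ofNat (.reg 2)))
      (.mul noiseLevel (.read 9 (.const 0) (.reg 5)))))

def frankWolfeStep : Program :=
  .seq (scanRows (.mul (.read 4 (.reg 4) (.reg 5))
      (.sub (.read 3 (.const 0) (.reg 5)) (.read 6 (.const 0) (.reg 5)))))
    (fillRow 3 (.const 0) (.add (.read 3 (.const 0) (.reg 5))
      (.mul (.div (.ofNat (.const 2)) (.add (.ofNat (.reg 3)) (.ofNat (.const 2))))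
        (.sub (.read 7 (.const 0) (.reg 5)) (.read 3 (.const 0) (.reg 5))))))

/-- `K + m` steps of the Frank–Wolfe method. -/
def frankWolfeProgram (K : ℕ) : Program :=
  .seq (fillRow 3 (.const 0) (.read 4 (.const 0) (.reg 5)))
    (.loop 3 (.add (.const K) (.reg 0)) frankWolfeStep)

def projProgram (K : ℕ) : Program :=
  .ite (.leReal noiseLevel (.div (.read 2 (.const 0) (.const 0)) (.ofNat (.const 2))))
    (fillRow 3 (.const 0) (.read 6 (.const 0) (.reg 5))) (frankWolfeProgram K)

/-- Approximate coarse projection mechanism. -/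
def coarseProjectionProgram (K : ℕ) : Program :=
  .seq netProgram (.seq roundProgram (.seq noiseProgram (projProgram K)))

theorem coarseProjectionProgram_hasInputLoops (K : ℕ) :
    (coarseProjectionProgram K).HasInputLoops := by
  simp [coarseProjectionProgram, netProgram, netInit, netStep, roundProgram, roundStep,
    noiseProgram, projProgram, frankWolfeProgram, frankWolfeStep, scanRows, keepRow, accumulate,
    fillRow, Program.HasInputLoops, NatExpr.IsInput]

section Spec

variable {m N : ℕ} {s : State} {ω : ℕ → ℝ}

theorem netInit_run (hm : s.nat 0 = m) (hsN : s.nat 1 = N) {u : EuclideanSpace ℝ (Fin m)}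
    (hu : s.HasRow 0 0 u) : ∀ k < N, (netInit.run ω s).HasRow 4 k u := by
  have key := Program.run_loop_induction (ω := ω) (r := 3) (a := .reg 1)
    (c := fillRow 4 (.reg 3) (.read 0 (.const 0) (.reg 5))) (s := s)
    (fun i s' => s'.nat 0 = m ∧ s'.real 0 = s.real 0 ∧ ∀ k < i, s'.HasRow 4 k u)
    ⟨hm, rfl, fun k hk => absurd hk (by omega)⟩
    (fun i _ s' hs' => by
      obtain ⟨h1, h2, h3⟩ := hs'
      set w := (s'.writeNat 3 i).tick 1 with hw
      have w3 : w.nat 3 = i := by simp [hw]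
      have w0 : w.nat 0 = m := by simp [hw, h1]
      have h4 := fillRow_run (A := 4) (i := .reg 3) (f := .read 0 (.const 0) (.reg 5)) w0 (i₀ := i)
        (fun s'' h => by rw [NatExpr.eval, h 3 (by norm_num), w3]) (v := u)
        (fun s'' _ h j _ h5 => by
          simp only [RealExpr.eval, NatExpr.eval, h5]
          rw [h 0 (by norm_num), ← hu j, ← h2]
          rfl) ω
      refine ⟨?_, ?_, fun k hk => ?_⟩
      · rw [Program.PreservesReg.run_nat (by simp [fillRow, Program.PreservesReg]), w0]
      · rw [Program.PreservesArray.run_real (by simp [fillRow, Program.PreservesArray]), ← h2]; rfl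
      · by_cases hki : k = i
        · subst hki; exact h4.1
        · intro j
          rw [h4.2 k hki]
          exact h3 k (by omega) j)
  have h0 : (NatExpr.reg 1).eval s = N := hsN
  rw [h0] at key
  exact key.2.2

theorem scanRows_preservesReg (f : RealExpr) {r : ℕ} (h4 : r ≠ 4) (h5 : r ≠ 5) :
    (scanRows f).PreservesReg r := by
  simp [scanRows, accumulate, keepRow, fillRow, Program.PreservesReg, h4.symm, h5.symm]

theorem scanRows_preservesArray (f : RealExpr) {A : ℕ} (h5 : A ≠ 5) (h7 : A ≠ 7) (h8 : A ≠ 8) :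
    (scanRows f).PreservesArray A := by
  simp [scanRows, accumulate, keepRow, fillRow, Program.PreservesArray, h5.symm, h7.symm, h8.symm]

theorem fillRow_preservesReg (A : ℕ) (i : NatExpr) (f : RealExpr) {r : ℕ} (h5 : r ≠ 5) :
    (fillRow A i f).PreservesReg r := by
  simp [fillRow, Program.PreservesReg, h5.symm]

theorem fillRow_preservesArray {A : ℕ} (i : NatExpr) (f : RealExpr) {B : ℕ} (h : A ≠ B) :
    (fillRow A i f).PreservesArray B := by
  simp [fillRow, Program.PreservesArray, h]

/-- A scan with the squared distance to a row of array `A` finds the nearest row of array `4`. -/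
theorem scanRows_sqDiff_run (hN : 0 < N) (hm : s.nat 0 = m) (hsN : s.nat 1 = N)
    {t : ℕ → EuclideanSpace ℝ (Fin m)} (ht : ∀ k < N, s.HasRow 4 k (t k)) {A : ℕ} (hA5 : A ≠ 5)
    (hA7 : A ≠ 7) (hA8 : A ≠ 8) {x : EuclideanSpace ℝ (Fin m)} (hx : s.HasRow A (s.nat 3) x) :
    ((scanRows (sqDiff A)).run ω s).HasRow 7 0 (nearestRow t N x) ∧
      ((scanRows (sqDiff A)).run ω s).real 8 0 0 = ‖nearestRow t N x - x‖ ^ 2 := by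
  have h := scanRows_run hN (f := sqDiff A) hm hsN
    (φ := fun k j => (t k j - x j) * (t k j - x j)) ht
    (fun s' h1 h2 h3 j h4 => by
      simp only [sqDiff, RealExpr.eval, NatExpr.eval, h4]
      rw [h2 4 (by norm_num) (by norm_num) (by norm_num), h2 A hA5 hA7 hA8,
        h1 3 (by norm_num) (by norm_num), ht _ h3 j, hx j]) ω
  simp only [sum_sub_mul_sub] at h
  exact h

theorem netProgram_run (hN : 0 < N) (hm : s.nat 0 = m) (hsN : s.nat 1 = N)
    {u : ℕ → EuclideanSpace ℝ (Fin m)} (hu : ∀ k < N, s.HasRow 0 k (u k)) {α : ℝ}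
    (hα : s.real 2 0 0 = α) :
    ∀ k < N, (netProgram.run ω s).HasRow 4 k (greedyNet u N (α * α * m / 4) N k) := by
  set θ := α * α * m / 4 with hθ
  set s1 := netInit.run ω s with hs1
  have s1reg : ∀ r, r < 3 → s1.nat r = s.nat r := fun r hr =>
    Program.PreservesReg.run_nat (by
      simp [netInit, fillRow, Program.PreservesReg]; omega) ω s
  have s1arr : ∀ A, A ≠ 4 → s1.real A = s.real A := fun A hA =>
    Program.PreservesArray.run_real (by
      simp [netInit, fillRow, Program.PreservesArray, hA.symm]) ω s
  have key := Program.run_loop_induction (ω := ω) (r := 3) (a := .reg 1) (c := netStep) (s := s1)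
    (fun i s' => s'.nat 0 = m ∧ s'.nat 1 = N ∧ s'.real 0 = s.real 0 ∧ s'.real 2 = s.real 2 ∧
      ∀ k < N, s'.HasRow 4 k (greedyNet u N θ i k))
    ⟨by rw [State.tick_nat, s1reg 0 (by norm_num), hm],
      by rw [State.tick_nat, s1reg 1 (by norm_num), hsN], s1arr 0 (by norm_num),
      s1arr 2 (by norm_num), fun k hk => netInit_run hm hsN (hu 0 hN) k hk⟩
    (fun i hi s' hs' => by
      obtain ⟨a0, a1, a2, a3, a4⟩ := hs'
      have hi' : i < N := by
        have : (NatExpr.reg 1).eval s1 = N := by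
          rw [NatExpr.eval, s1reg 1 (by norm_num), hsN]
        rwa [this] at hi
      set w := (s'.writeNat 3 i).tick 1 with hw
      have w3 : w.nat 3 = i := by simp [hw]
      have w0 : w.nat 0 = m := by simp [hw, a0]
      have w1 : w.nat 1 = N := by simp [hw, a1]
      have hwu : w.HasRow 0 i (u i) := (hu i hi').congr a2
      have hscan := scanRows_sqDiff_run (ω := ω) hN w0 w1 (t := greedyNet u N θ i) a4 (A := 0)
        (by norm_num) (by norm_num) (by norm_num) (x := u i) (by rw [w3]; exact hwu)
      set z := (scanRows (sqDiff 0)).run ω w with hz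
      have z0 : z.nat 0 = m := by
        rw [hz, (scanRows_preservesReg _ (by norm_num) (by norm_num)).run_nat, w0]
      have z1 : z.nat 1 = N := by
        rw [hz, (scanRows_preservesReg _ (by norm_num) (by norm_num)).run_nat, w1]
      have z3 : z.nat 3 = i := by
        rw [hz, (scanRows_preservesReg _ (by norm_num) (by norm_num)).run_nat, w3]
      have zarr : ∀ A, A ≠ 5 → A ≠ 7 → A ≠ 8 → z.real A = s'.real A := fun A h5 h7 h8 =>
        (scanRows_preservesArray _ h5 h7 h8).run_real ω w
      have z4 : ∀ k < N, z.HasRow 4 k (greedyNet u N θ i k) := fun k hk =>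
        (a4 k hk).congr (zarr 4 (by norm_num) (by norm_num) (by norm_num))
      have htest : (Test.leReal sqSeparation (.read 8 (.const 0) (.const 0))).holds z ↔
          θ ≤ ‖nearestRow (greedyNet u N θ i) N (u i) - u i‖ ^ 2 := by
        simp only [Test.holds, sqSeparation, RealExpr.eval, NatExpr.eval, hscan.2, z0]
        rw [zarr 2 (by norm_num) (by norm_num) (by norm_num), a3, hα, hθ]
        norm_num
      rw [netStep, Program.run, Program.run, ← hz]
      rw [greedyNet]
      split_ifs with c1 c2 c2
      · set z' := z.tick (Test.cost (.leReal sqSeparation (.read 8 (.const 0) (.const 0))) + 1)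
        have hfill := fillRow_run (A := 4) (i := .reg 3) (f := .read 0 (.reg 3) (.reg 5))
          (s := z') (m := m) z0 (i₀ := i)
          (fun s'' h => by rw [NatExpr.eval, h 3 (by norm_num)]; exact z3) (v := u i)
          (fun s'' h1 h2 j _ h5 => by
            simp only [RealExpr.eval, NatExpr.eval, h5]
            rw [h2 0 (by norm_num), h1 3 (by norm_num), ← hwu j]
            show z.real 0 (z.nat 3) j = _
            rw [z3, zarr 0 (by norm_num) (by norm_num) (by norm_num)]
            rfl) ω
        refine ⟨?_, ?_, ?_, ?_, fun k hk => ?_⟩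
        · rw [(fillRow_preservesReg _ _ _ (by norm_num)).run_nat]; exact z0
        · rw [(fillRow_preservesReg _ _ _ (by norm_num)).run_nat]; exact z1
        · rw [(fillRow_preservesArray _ _ (by norm_num)).run_real, ← a2]
          exact zarr 0 (by norm_num) (by norm_num) (by norm_num)
        · rw [(fillRow_preservesArray _ _ (by norm_num)).run_real, ← a3]
          exact zarr 2 (by norm_num) (by norm_num) (by norm_num)
        · by_cases hki : k = i
          · subst hki
            rw [Function.update_self]
            exact hfill.1
          · rw [Function.update_of_ne hki]
            intro j
            rw [hfill.2 k hki]
            exact z4 k hk j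
      · exact absurd (htest.1 c1) c2
      · exact absurd (htest.2 c2) c1
      · exact ⟨z0, z1, (zarr 0 (by norm_num) (by norm_num) (by norm_num)).trans a2,
          (zarr 2 (by norm_num) (by norm_num) (by norm_num)).trans a3, z4⟩)
  have h0 : (NatExpr.reg 1).eval s1 = N := by rw [NatExpr.eval, s1reg 1 (by norm_num), hsN]
  rw [h0] at key
  exact key.2.2.2.2

theorem roundProgram_run {n : ℕ} (hN : 0 < N) (hm : s.nat 0 = m) (hsN : s.nat 1 = N)
    (hn : s.nat 2 = n) {t : ℕ → EuclideanSpace ℝ (Fin m)} (ht : ∀ k < N, s.HasRow 4 k (t k))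
    {x : ℕ → EuclideanSpace ℝ (Fin m)} (hx : ∀ i < n, s.HasRow 1 i (x i))
    (h6 : s.HasRow 6 0 (0 : EuclideanSpace ℝ (Fin m))) :
    (roundProgram.run ω s).HasRow 6 0 (∑ i ∈ Finset.range n, nearestRow t N (x i)) := by
  have key := Program.run_loop_induction (ω := ω) (r := 3) (a := .reg 2) (c := roundStep) (s := s)
    (fun i s' => s'.nat 0 = m ∧ s'.nat 1 = N ∧ s'.real 1 = s.real 1 ∧ s'.real 4 = s.real 4 ∧
      s'.HasRow 6 0 (∑ i ∈ Finset.range i, nearestRow t N (x i)))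
    ⟨hm, hsN, rfl, rfl, by rw [Finset.range_zero, Finset.sum_empty]; exact h6⟩
    (fun i hi s' hs' => by
      obtain ⟨a0, a1, a2, a3, a4⟩ := hs'
      have hi' : i < n := by simpa [NatExpr.eval, hn] using hi
      set w := (s'.writeNat 3 i).tick 1 with hw
      have w3 : w.nat 3 = i := by simp [hw]
      have w0 : w.nat 0 = m := by simp [hw, a0]
      have w1 : w.nat 1 = N := by simp [hw, a1]
      have hwx : w.HasRow 1 i (x i) := (hx i hi').congr a2
      have hscan := scanRows_sqDiff_run (ω := ω) hN w0 w1 (t := t)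
        (fun k hk => (ht k hk).congr a3) (A := 1)
        (by norm_num) (by norm_num) (by norm_num) (x := x i) (by rw [w3]; exact hwx)
      set z := (scanRows (sqDiff 1)).run ω w with hz
      have z0 : z.nat 0 = m := by
        rw [hz, (scanRows_preservesReg _ (by norm_num) (by norm_num)).run_nat, w0]
      have z1 : z.nat 1 = N := by
        rw [hz, (scanRows_preservesReg _ (by norm_num) (by norm_num)).run_nat, w1]
      have zarr : ∀ A, A ≠ 5 → A ≠ 7 → A ≠ 8 → z.real A = s'.real A := fun A h5 h7 h8 =>
        (scanRows_preservesArray _ h5 h7 h8).run_real ω w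
      have z6 := a4.congr (zarr 6 (by norm_num) (by norm_num) (by norm_num))
      have hfill := fillRow_run (A := 6) (i := .const 0)
        (f := .add (.read 6 (.const 0) (.reg 5)) (.read 7 (.const 0) (.reg 5)))
        z0 (i₀ := 0) (fun _ _ => rfl)
        (v := ∑ i ∈ Finset.range (i + 1), nearestRow t N (x i))
        (fun s'' h1 h2 j h3 h5 => by
          simp only [RealExpr.eval, NatExpr.eval, h5]
          rw [h3, z6 j, h2 7 (by norm_num), hscan.1 j, Finset.sum_range_succ, PiLp.add_apply]) ω
      rw [roundStep, Program.run, ← hz]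
      refine ⟨?_, ?_, ?_, ?_, hfill.1⟩
      · rw [(fillRow_preservesReg _ _ _ (by norm_num)).run_nat]; exact z0
      · rw [(fillRow_preservesReg _ _ _ (by norm_num)).run_nat]; exact z1
      · rw [(fillRow_preservesArray _ _ (by norm_num)).run_real, ← a2]
        exact zarr 1 (by norm_num) (by norm_num) (by norm_num)
      · rw [(fillRow_preservesArray _ _ (by norm_num)).run_real, ← a3]
        exact zarr 4 (by norm_num) (by norm_num) (by norm_num))
  have h0 : (NatExpr.reg 2).eval s = n := hn
  rw [h0] at key
  exact key.2.2.2.2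

theorem noiseLevel_eval {n : ℕ} (hm : s.nat 0 = m) (hn : s.nat 2 = n) {ρ : ℝ}
    (hρ : s.real 2 0 1 = ρ) :
    noiseLevel.eval s = Real.sqrt m / (n * Real.sqrt (2 * ρ)) := by
  simp [noiseLevel, RealExpr.eval, NatExpr.eval, hm, hn, hρ]

theorem noiseProgram_run {n : ℕ} (hm : s.nat 0 = m) (hn : s.nat 2 = n) {ρ : ℝ}
    (hρ : s.real 2 0 1 = ρ) (hd : s.drawn = 0) {v : EuclideanSpace ℝ (Fin m)}
    (hv : s.HasRow 6 0 v) :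
    (noiseProgram.run ω s).HasRow 6 0 ((n : ℝ)⁻¹ • v +
      (Real.sqrt m / (n * Real.sqrt (2 * ρ))) • WithLp.toLp 2 fun j : Fin m => ω j) := by
  set w := (Program.loop 5 (.reg 0) (.gauss 9 (.const 0) (.reg 5))).run ω s with hw
  have h9 : ∀ j : Fin m, w.real 9 0 j = ω j := fun j => by
    rw [hw, gaussLoop_run hm, hd, zero_add]
  have wreg : ∀ r, r ≠ 5 → w.nat r = s.nat r := fun r hr =>
    Program.PreservesReg.run_nat (by simp [Program.PreservesReg, hr.symm]) ω s
  have warr : ∀ A, A ≠ 9 → w.real A = s.real A := fun A hA =>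
    Program.PreservesArray.run_real (by simp [Program.PreservesArray, hA.symm]) ω s
  refine (fillRow_run (s := w) (by rw [wreg 0 (by norm_num), hm]) (fun _ _ => rfl)
    (fun s' h1 h2 j h3 h4 => ?_) ω).1
  have h5 : noiseLevel.eval s' = Real.sqrt m / (n * Real.sqrt (2 * ρ)) :=
    noiseLevel_eval (by rw [h1 0 (by norm_num), wreg 0 (by norm_num), hm])
      (by rw [h1 2 (by norm_num), wreg 2 (by norm_num), hn])
      (by rw [h2 2 (by norm_num), warr 2 (by norm_num), hρ])
  simp only [RealExpr.eval, NatExpr.eval, h4, h5]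
  rw [h3, warr 6 (by norm_num), hv j, h2 9 (by norm_num), h9 j, h1 2 (by norm_num),
    wreg 2 (by norm_num), hn]
  simp only [PiLp.add_apply, PiLp.smul_apply, smul_eq_mul]
  rw [div_eq_inv_mul]

theorem frankWolfeProgram_run {K : ℕ} (hN : 0 < N) (hm : s.nat 0 = m) (hsN : s.nat 1 = N)
    {t : ℕ → EuclideanSpace ℝ (Fin m)} (ht : ∀ k < N, s.HasRow 4 k (t k))
    {w : EuclideanSpace ℝ (Fin m)} (hw : s.HasRow 6 0 w) :
    ((frankWolfeProgram K).run ω s).HasRow 3 0 (frankWolfe t N w (K + m)) := by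
  set s1 := (fillRow 3 (.const 0) (.read 4 (.const 0) (.reg 5))).run ω s with hs1
  have h1 : s1.HasRow 3 0 (t 0) := (fillRow_run hm (fun _ _ => rfl)
    (fun s' h1 h2 j h3 h4 => by
      simp only [RealExpr.eval, NatExpr.eval, h4]
      rw [h2 4 (by norm_num), ht 0 hN j]) ω).1
  have s1reg : ∀ r, r ≠ 5 → s1.nat r = s.nat r := fun r hr =>
    (fillRow_preservesReg _ _ _ hr).run_nat ω s
  have s1arr : ∀ A, 3 ≠ A → s1.real A = s.real A := fun A hA =>
    (fillRow_preservesArray _ _ hA).run_real ω s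
  have key := Program.run_loop_induction (ω := ω) (r := 3) (a := .add (.const K) (.reg 0))
    (c := frankWolfeStep) (s := s1)
    (fun i s' => s'.nat 0 = m ∧ s'.nat 1 = N ∧ s'.real 4 = s.real 4 ∧ s'.real 6 = s.real 6 ∧
      s'.HasRow 3 0 (frankWolfe t N w i))
    ⟨by rw [State.tick_nat, s1reg 0 (by norm_num), hm],
      by rw [State.tick_nat, s1reg 1 (by norm_num), hsN], s1arr 4 (by norm_num),
      s1arr 6 (by norm_num), h1⟩
    (fun i _ s' hs' => by
      obtain ⟨a0, a1, a2, a3, a4⟩ := hs'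
      set v := (s'.writeNat 3 i).tick 1 with hv
      have v3 : v.nat 3 = i := by simp [hv]
      have v0 : v.nat 0 = m := by simp [hv, a0]
      have v1 : v.nat 1 = N := by simp [hv, a1]
      have v4 : ∀ k < N, v.HasRow 4 k (t k) := fun k hk => (ht k hk).congr a2
      have v6 : v.HasRow 6 0 w := hw.congr a3
      have vy : v.HasRow 3 0 (frankWolfe t N w i) := a4
      set y := frankWolfe t N w i with hy
      have hscan := (scanRows_run hN (f := .mul (.read 4 (.reg 4) (.reg 5))
          (.sub (.read 3 (.const 0) (.reg 5)) (.read 6 (.const 0) (.reg 5)))) v0 v1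
        (φ := fun k j => t k j * (y j - w j)) v4
        (fun s'' h1 h2 h3 j h4 => by
          simp only [RealExpr.eval, NatExpr.eval, h4]
          rw [h2 4 (by norm_num) (by norm_num) (by norm_num), v4 _ h3 j,
            h2 3 (by norm_num) (by norm_num) (by norm_num), vy j,
            h2 6 (by norm_num) (by norm_num) (by norm_num), v6 j]) ω).1
      have hinner : ∀ k, ∑ j, t k j * (y j - w j) = inner ℝ (t k) (y - w) := fun k => by
        rw [PiLp.inner_apply]
        exact Finset.sum_congr rfl fun j _ => by simp [mul_comm]
      simp only [hinner] at hscan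
      rw [frankWolfeStep, Program.run]
      set z := (scanRows (.mul (.read 4 (.reg 4) (.reg 5))
          (.sub (.read 3 (.const 0) (.reg 5)) (.read 6 (.const 0) (.reg 5))))).run ω v with hz
      have zreg : ∀ r, r ≠ 4 → r ≠ 5 → z.nat r = v.nat r := fun r h4 h5 =>
        (scanRows_preservesReg _ h4 h5).run_nat ω v
      have zarr : ∀ A, A ≠ 5 → A ≠ 7 → A ≠ 8 → z.real A = s'.real A := fun A h5 h7 h8 =>
        (scanRows_preservesArray _ h5 h7 h8).run_real ω v
      have zy := a4.congr (zarr 3 (by norm_num) (by norm_num) (by norm_num))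
      have hfill := fillRow_run (A := 3) (i := .const 0)
        (f := .add (.read 3 (.const 0) (.reg 5))
          (.mul (.div (.ofNat (.const 2)) (.add (.ofNat (.reg 3)) (.ofNat (.const 2))))
          (.sub (.read 7 (.const 0) (.reg 5)) (.read 3 (.const 0) (.reg 5)))))
        (s := z) (m := m) (by rw [zreg 0 (by norm_num) (by norm_num), v0]) (i₀ := 0)
        (fun _ _ => rfl) (v := frankWolfe t N w (i + 1))
        (fun s'' h1 h2 j h3 h5 => by
          simp only [RealExpr.eval, NatExpr.eval, h5]
          rw [h3, zy j, h2 7 (by norm_num), hscan j, h1 3 (by norm_num),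
            zreg 3 (by norm_num) (by norm_num), v3, frankWolfe]
          simp [hy]) ω
      refine ⟨?_, ?_, ?_, ?_, hfill.1⟩
      · rw [(fillRow_preservesReg _ _ _ (by norm_num)).run_nat,
          zreg 0 (by norm_num) (by norm_num), v0]
      · rw [(fillRow_preservesReg _ _ _ (by norm_num)).run_nat,
          zreg 1 (by norm_num) (by norm_num), v1]
      · rw [(fillRow_preservesArray _ _ (by norm_num)).run_real, ← a2]
        exact zarr 4 (by norm_num) (by norm_num) (by norm_num)
      · rw [(fillRow_preservesArray _ _ (by norm_num)).run_real, ← a3]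
        exact zarr 6 (by norm_num) (by norm_num) (by norm_num))
  have h0 : (NatExpr.add (.const K) (.reg 0)).eval s1 = K + m := by
    simp only [NatExpr.eval]
    rw [s1reg 0 (by norm_num), hm]
  rw [h0] at key
  exact key.2.2.2.2

theorem projProgram_run {n K : ℕ} (hN : 0 < N) (hm : s.nat 0 = m) (hsN : s.nat 1 = N)
    (hn : s.nat 2 = n) {α ρ : ℝ} (hα : s.real 2 0 0 = α) (hρ : s.real 2 0 1 = ρ)
    {t : ℕ → EuclideanSpace ℝ (Fin m)} (ht : ∀ k < N, s.HasRow 4 k (t k))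
    {w : EuclideanSpace ℝ (Fin m)} (hw : s.HasRow 6 0 w) :
    ((projProgram K).run ω s).HasRow 3 0
      (approxProj t N (Real.sqrt m / (n * Real.sqrt (2 * ρ))) (α / 2) (K + m) w) := by
  have htest : (Test.leReal noiseLevel (.div (.read 2 (.const 0) (.const 0)) (.ofNat (.const 2)))).holds s
      ↔ Real.sqrt m / (n * Real.sqrt (2 * ρ)) ≤ α / 2 := by
    simp [Test.holds, RealExpr.eval, NatExpr.eval, noiseLevel_eval hm hn hρ, hα]
  rw [projProgram, Program.run, approxProj]
  split_ifs with c1 c2 c2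
  · refine (fillRow_run (by exact hm) (fun _ _ => rfl) (fun s' h1 h2 j h3 h4 => ?_) ω).1
    simp only [RealExpr.eval, NatExpr.eval, h4]
    rw [h2 6 (by norm_num)]
    exact hw j
  · exact absurd (htest.1 c1) c2
  · exact absurd (htest.2 c2) c1
  · exact frankWolfeProgram_run (s := s.tick _) hN hm hsN ht hw

end Spec

end RealRAM

/-! ## The law of the output of the program -/

/-- The points of the universe in the order `e`, extended by zero. -/
noncomputable def universeRow {m : ℕ} {X : Finset (EuclideanSpace ℝ (Fin m))}
    (e : Fin X.card ≃ X) (k : ℕ) : EuclideanSpace ℝ (Fin m) :=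
  if h : k < X.card then e ⟨k, h⟩ else 0

/-- The rows of the net computed by the program. -/
noncomputable def programNet {m : ℕ} {X : Finset (EuclideanSpace ℝ (Fin m))}
    (e : Fin X.card ≃ X) (α : ℝ) : ℕ → EuclideanSpace ℝ (Fin m) :=
  greedyNet (universeRow e) X.card (α * α * m / 4) X.card

/-- The rounding map computed by the program. -/
noncomputable def programRounding {m : ℕ} {X : Finset (EuclideanSpace ℝ (Fin m))}
    (e : Fin X.card ≃ X) (α : ℝ) (x : X) : EuclideanSpace ℝ (Fin m) :=
  nearestRow (programNet e α) X.card x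

section

variable {m n : ℕ} {X : Finset (EuclideanSpace ℝ (Fin m))}

theorem universeRow_mem (e : Fin X.card ≃ X) {k : ℕ} (hk : k < X.card) : universeRow e k ∈ X := by
  rw [universeRow, dif_pos hk]; exact (e ⟨k, hk⟩).2

theorem exists_universeRow_eq (e : Fin X.card ≃ X) {x : EuclideanSpace ℝ (Fin m)} (hx : x ∈ X) :
    ∃ k < X.card, universeRow e k = x := by
  refine ⟨e.symm ⟨x, hx⟩, (e.symm ⟨x, hx⟩).2, ?_⟩
  rw [universeRow, dif_pos (e.symm ⟨x, hx⟩).2]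
  simp

theorem isCoarseNet_programNet [DecidableEq (EuclideanSpace ℝ (Fin m))] (hm : 0 < m)
    (hX : 0 < X.card) (e : Fin X.card ≃ X) {α : ℝ} (hα : 0 < α) :
    IsCoarseNet X α ((Finset.range X.card).image (programNet e α)) :=
  isCoarseNet_greedyNet hm hX (fun _ hk => universeRow_mem e hk)
    (fun _ hx => exists_universeRow_eq e hx) hα

theorem isRounding_programRounding [DecidableEq (EuclideanSpace ℝ (Fin m))] (hX : 0 < X.card)
    (e : Fin X.card ≃ X) (α : ℝ) :
    IsRounding X ((Finset.range X.card).image (programNet e α)) (programRounding e α) := by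
  intro x
  refine ⟨Finset.mem_image_of_mem _ (Finset.mem_range.2 (firstMin_lt _ hX)), fun y hy => ?_⟩
  obtain ⟨k, hk, rfl⟩ := Finset.mem_image.1 hy
  rw [dist_comm, dist_comm (x : EuclideanSpace ℝ (Fin m)), dist_eq_norm, dist_eq_norm]
  exact (pow_le_pow_iff_left₀ (norm_nonneg _) (norm_nonneg _) two_ne_zero).1
    (norm_nearestRow_sub_le (programNet e α) (Finset.mem_range.1 hk) x)

-- The four phases are linked by frame conditions: each later phase finds the inputs, the net and
-- the running mean as left by the earlier ones.
open RealRAM in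
theorem progOutput_eq {K : ℕ} (hX : 0 < X.card) (e : Fin X.card ≃ X) (α ρ : ℝ) (D : Fin n → X)
    (ω : ℕ → ℝ) :
    progOutput (coarseProjectionProgram K) e α ρ D ω =
      approxProj (programNet e α) X.card (Real.sqrt m / (n * Real.sqrt (2 * ρ))) (α / 2) (K + m)
        (meanPoint (fun i => programRounding e α (D i)) +
          (Real.sqrt m / (n * Real.sqrt (2 * ρ))) • WithLp.toLp 2 fun j : Fin m => ω j) := by
  set s := initialState e α ρ D with hs
  have s0 : s.nat 0 = m := rfl
  have s1 : s.nat 1 = X.card := rfl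
  have s2 : s.nat 2 = n := rfl
  have sd : s.drawn = 0 := rfl
  have sα : s.real 2 0 0 = α := by simp [hs, initialState]
  have sρ : s.real 2 0 1 = ρ := by simp [hs, initialState]
  have su : ∀ k < X.card, s.HasRow 0 k (universeRow e k) := fun k hk j => by
    simp [hs, initialState, universeRow, hk]
  have sx : ∀ i < n, s.HasRow 1 i
      (if h : i < n then (D ⟨i, h⟩ : EuclideanSpace ℝ (Fin m)) else 0) := fun i hi j => by
    simp [hs, initialState, hi]
  -- Array `6` is the accumulator of the rounded data, and `roundProgram` relies on its initial
  -- value zero.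
  have s6 : s.real 6 = fun _ _ => 0 := by
    funext i j; simp [hs, initialState]
  set a := netProgram.run ω s with ha
  have areg : ∀ r, r < 3 → a.nat r = s.nat r := fun r hr => Program.HasInputLoops.run_nat
    (by simp [netProgram, netInit, netStep, scanRows, keepRow, accumulate, fillRow,
      Program.HasInputLoops, NatExpr.IsInput]) ω s hr
  have aarr : ∀ A, A ≠ 4 → A ≠ 5 → A ≠ 7 → A ≠ 8 → a.real A = s.real A := fun A h4 h5 h7 h8 =>
    Program.PreservesArray.run_real (by simp [netProgram, netInit, netStep, scanRows, keepRow,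
      accumulate, fillRow, Program.PreservesArray, h4.symm, h5.symm, h7.symm, h8.symm]) ω s
  -- Nothing is drawn before the noise phase, so the noise consists of the first `m` entries of the
  -- tape.
  have ad : a.drawn = s.drawn := Program.IsDeterministic.run_drawn
    (by simp [netProgram, netInit, netStep, scanRows, keepRow, accumulate, fillRow,
      Program.IsDeterministic]) ω s
  have a4 : ∀ k < X.card, a.HasRow 4 k (programNet e α k) := netProgram_run hX s0 s1 su sα
  set b := roundProgram.run ω a with hb
  have breg : ∀ r, r < 3 → b.nat r = a.nat r := fun r hr => Program.HasInputLoops.run_nat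
    (by simp [roundProgram, roundStep, scanRows, keepRow, accumulate, fillRow,
      Program.HasInputLoops, NatExpr.IsInput]) ω a hr
  have barr : ∀ A, A ≠ 5 → A ≠ 6 → A ≠ 7 → A ≠ 8 → b.real A = a.real A := fun A h5 h6 h7 h8 =>
    Program.PreservesArray.run_real (by simp [roundProgram, roundStep, scanRows, keepRow,
      accumulate, fillRow, Program.PreservesArray, h5.symm, h6.symm, h7.symm, h8.symm]) ω a
  have bd : b.drawn = a.drawn := Program.IsDeterministic.run_drawn
    (by simp [roundProgram, roundStep, scanRows, keepRow, accumulate, fillRow,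
      Program.IsDeterministic]) ω a
  have b6 := roundProgram_run (ω := ω) (s := a) (n := n) hX (by rw [areg 0 (by norm_num), s0])
    (by rw [areg 1 (by norm_num), s1]) (by rw [areg 2 (by norm_num), s2]) a4
    (fun i hi => (sx i hi).congr (aarr 1 (by norm_num) (by norm_num) (by norm_num) (by norm_num)))
    (fun j => by
      rw [aarr 6 (by norm_num) (by norm_num) (by norm_num) (by norm_num), s6]; rfl)
  set c := noiseProgram.run ω b with hc
  have creg : ∀ r, r < 3 → c.nat r = b.nat r := fun r hr => Program.HasInputLoops.run_nat
    (by simp [noiseProgram, fillRow, Program.HasInputLoops, NatExpr.IsInput]) ω b hr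
  have carr : ∀ A, A ≠ 6 → A ≠ 9 → c.real A = b.real A := fun A h6 h9 =>
    Program.PreservesArray.run_real (by simp [noiseProgram, fillRow, Program.PreservesArray,
      h6.symm, h9.symm]) ω b
  have b2 : b.real 2 = s.real 2 := by
    rw [barr 2 (by norm_num) (by norm_num) (by norm_num) (by norm_num),
      aarr 2 (by norm_num) (by norm_num) (by norm_num) (by norm_num)]
  have c6 := noiseProgram_run (ω := ω) (s := b) (n := n)
    (by rw [breg 0 (by norm_num), areg 0 (by norm_num), s0])
    (by rw [breg 2 (by norm_num), areg 2 (by norm_num), s2]) (by rw [b2, sρ])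
    (by rw [bd, ad, sd]) b6
  have hout := projProgram_run (ω := ω) (s := c) (n := n) (K := K) hX
    (by rw [creg 0 (by norm_num), breg 0 (by norm_num), areg 0 (by norm_num), s0])
    (by rw [creg 1 (by norm_num), breg 1 (by norm_num), areg 1 (by norm_num), s1])
    (by rw [creg 2 (by norm_num), breg 2 (by norm_num), areg 2 (by norm_num), s2])
    (by rw [carr 2 (by norm_num) (by norm_num), b2, sα])
    (by rw [carr 2 (by norm_num) (by norm_num), b2, sρ])
    (fun k hk => (a4 k hk).congr (by
      rw [carr 4 (by norm_num) (by norm_num),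
        barr 4 (by norm_num) (by norm_num) (by norm_num) (by norm_num)]))
    c6
  have hmean : (n : ℝ)⁻¹ • ∑ i ∈ Finset.range n, nearestRow (programNet e α) X.card
      (if h : i < n then (D ⟨i, h⟩ : EuclideanSpace ℝ (Fin m)) else 0)
      = meanPoint (fun i => programRounding e α (D i)) := by
    rw [meanPoint, Finset.sum_range]
    simp [programRounding]
  rw [hmean] at hout
  ext j
  exact hout j

/-- The preimage of a box is a cylinder over the first `m` coordinates, on which the infinite
product measure is a finite product. -/
theorem gaussianTape_map_prefix (m : ℕ) :
    gaussianTape.map (fun ω => (WithLp.toLp 2 fun j : Fin m => ω j : EuclideanSpace ℝ (Fin m)))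
      = stdGaussian (EuclideanSpace ℝ (Fin m)) := by
  have hpi : gaussianTape.map (fun ω (j : Fin m) => ω j)
      = Measure.pi fun _ : Fin m => gaussianReal 0 1 := by
    refine (Measure.pi_eq fun t ht => ?_).symm
    rw [Measure.map_apply (by fun_prop) (MeasurableSet.univ_pi ht)]
    have hpre : (fun (ω : ℕ → ℝ) (j : Fin m) => ω j) ⁻¹' Set.univ.pi t
        = Set.pi (Finset.range m) fun i => if h : i < m then t ⟨i, h⟩ else Set.univ := by
      ext ω
      simp only [Set.mem_preimage, Set.mem_pi, Set.mem_univ, true_imp_iff, Finset.coe_range,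
        Set.mem_Iio]
      constructor
      · intro h i hi
        rw [dif_pos hi]
        exact h ⟨i, hi⟩
      · intro h i
        have := h i i.2
        rwa [dif_pos i.2] at this
    rw [hpre, gaussianTape, Measure.infinitePi_pi _ (fun i hi => by
      rw [dif_pos (Finset.mem_range.1 hi)]; exact ht _), Finset.prod_range]
    simp
  rw [← map_pi_eq_stdGaussian, ← hpi, Measure.map_map (by fun_prop) (by fun_prop)]
  rfl

theorem progMechanism_eq {K : ℕ} (hX : 0 < X.card) (e : Fin X.card ≃ X) (α ρ : ℝ)
    (D : Fin n → X) :
    progMechanism (RealRAM.coarseProjectionProgram K) e α ρ D =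
      (stdGaussian (EuclideanSpace ℝ (Fin m))).map fun z =>
        approxProj (programNet e α) X.card (Real.sqrt m / (n * Real.sqrt (2 * ρ))) (α / 2) (K + m)
          (meanPoint (fun i => programRounding e α (D i)) +
            (Real.sqrt m / (n * Real.sqrt (2 * ρ))) • z) := by
  have hF : Measurable fun z : EuclideanSpace ℝ (Fin m) =>
      approxProj (programNet e α) X.card (Real.sqrt m / (n * Real.sqrt (2 * ρ))) (α / 2) (K + m)
        (meanPoint (fun i => programRounding e α (D i)) +
          (Real.sqrt m / (n * Real.sqrt (2 * ρ))) • z) :=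
    (measurable_approxProj _ _ _ _ _).comp (by fun_prop)
  rw [progMechanism, ← gaussianTape_map_prefix, Measure.map_map hF (by fun_prop)]
  congr 1
  funext ω
  exact progOutput_eq hX e α ρ D ω

theorem lintegral_gaussianTape_prefix {f : EuclideanSpace ℝ (Fin m) → ℝ≥0∞} (hf : Measurable f) :
    ∫⁻ ω, f (WithLp.toLp 2 fun j : Fin m => ω j) ∂gaussianTape
      = ∫⁻ z, f z ∂(stdGaussian (EuclideanSpace ℝ (Fin m))) := by
  rw [← gaussianTape_map_prefix, lintegral_map hf (by fun_prop)]

end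

theorem theorem1 :
    ∃ C K : ℝ, 0 < C ∧ 0 < K ∧
      -- the exact mechanism, for every choice of the net and of the rounding map
      (∀ (m n : ℕ), 0 < m → 0 < n →
        ∀ (X : Finset (EuclideanSpace ℝ (Fin m))), (∀ x ∈ X, ∀ j, x j ∈ Set.Icc (0 : ℝ) 1) →
        ∀ (α ρ : ℝ), 0 < α → 0 < ρ →
        ∀ (T : Finset (EuclideanSpace ℝ (Fin m))) (r : X → EuclideanSpace ℝ (Fin m)),
          IsCoarseNet X α T → IsRounding X T r →
          IsZCDP ρ (fun D : Fin n → X => cpm T r ρ D) ∧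
          (K * coarseBound C X α ρ ≤ n →
            avgError X (fun D : Fin n → X => cpm T r ρ D) ≤ ENNReal.ofReal α)) ∧
      -- its implementation, by one program whose running time is polynomial
      (∃ (c : RealRAM.Program) (a b : ℕ),
        ∀ (m n : ℕ), 0 < m → 0 < n →
        ∀ (X : Finset (EuclideanSpace ℝ (Fin m))), (∀ x ∈ X, ∀ j, x j ∈ Set.Icc (0 : ℝ) 1) →
        ∀ (e : Fin X.card ≃ X) (α ρ : ℝ), 0 < α → 0 < ρ →
          (∀ (D : Fin n → X) (ω : ℕ → ℝ), runTime c e α ρ D ω ≤ a * (X.card + n + m) ^ b) ∧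
          IsZCDP ρ (fun D : Fin n → X => progMechanism c e α ρ D) ∧
          (K * coarseBound C X α ρ ≤ n →
            avgError X (fun D : Fin n → X => progMechanism c e α ρ D) ≤ ENNReal.ofReal α) ∧
          -- on the same noise, the program computes the exact mechanism to within `α / 2`
          (K * coarseBound C X α ρ ≤ n →
            ∃ (T : Finset (EuclideanSpace ℝ (Fin m))) (r : X → EuclideanSpace ℝ (Fin m)),
              IsCoarseNet X α T ∧ IsRounding X T r ∧
              ∀ D : Fin n → X,
                (∫⁻ ω, ‖progOutput c e α ρ D ω -
                    cpmOutput T r ρ D (WithLp.toLp 2 fun j : Fin m => ω j)‖ₑ ^ 2 / (m : ℝ≥0∞)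
                  ∂gaussianTape) ^ (1 / 2 : ℝ) ≤ ENNReal.ofReal (α / 2))) := by
  classical
  refine ⟨4, 10 ^ 7, by norm_num, by norm_num, ?_, ?_⟩
  · intro m n hm hn X hX α ρ hα hρ T r hT hr
    exact ⟨cpm_isZCDP hm hn hX hρ hT hr, cpm_avgError_le hm hn hX hα hρ hT hr⟩
  obtain ⟨a, b, hab⟩ := (RealRAM.coarseProjectionProgram_hasInputLoops (10 ^ 7)).exists_steps_le
  refine ⟨RealRAM.coarseProjectionProgram (10 ^ 7), a, b, ?_⟩
  intro m n hm hn X hX e α ρ hα hρ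
  refine ⟨fun D ω => ?_, ?_⟩
  · have h := hab (X.card + n + m) ω (initialState e α ρ D) (by omega) (fun r hr => by
      interval_cases r <;> simp [initialState] <;> omega)
    simpa [runTime, initialState] using h
  -- Over an empty universe there are no datasets, because `n > 0`; the empty net serves.
  rcases Nat.eq_zero_or_pos X.card with hX0 | hX0
  · obtain rfl := Finset.card_eq_zero.1 hX0
    have hD : ∀ D : Fin n → (∅ : Finset (EuclideanSpace ℝ (Fin m))), False := fun D =>
      absurd (D ⟨0, hn⟩).2 (Finset.notMem_empty _)
    refine ⟨⟨fun D => (hD D).elim, fun D => (hD D).elim⟩, fun _ => iSup_le fun D => (hD D).elim,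
      fun _ => ⟨∅, fun x => x, ⟨⟨Finset.Subset.refl _, fun x hx => absurd hx (Finset.notMem_empty _)⟩,
        fun S hS _ => hS.1⟩, fun x => absurd x.2 (Finset.notMem_empty _), fun D => (hD D).elim⟩⟩
  set T := (Finset.range X.card).image (programNet e α) with hTdef
  set r := programRounding e α with hrdef
  set σ := Real.sqrt m / (n * Real.sqrt (2 * ρ)) with hσ
  have hσ0 : 0 ≤ σ := by positivity
  have hT : IsCoarseNet X α T := isCoarseNet_programNet hm hX0 e hα
  have hr : IsRounding X T r := isRounding_programRounding hX0 e α
  have hTne : T.Nonempty := ⟨_, Finset.mem_image_of_mem _ (Finset.mem_range.2 hX0)⟩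
  set F := approxProj (programNet e α) X.card σ (α / 2) (10 ^ 7 + m) with hF
  have hFm : Measurable F := measurable_approxProj _ _ _ _ _
  have hmech : (fun D : Fin n → X => progMechanism (RealRAM.coarseProjectionProgram (10 ^ 7)) e α ρ D)
      = fun D : Fin n → X => (stdGaussian (EuclideanSpace ℝ (Fin m))).map fun z =>
        F (meanPoint (fun i => r (D i)) + σ • z) := by
    funext D
    exact progMechanism_eq hX0 e α ρ D
  rw [hmech]
  -- Only the large noise branch runs Frank–Wolfe, and exactly there the diameter bound is
  -- available.
  have hclose : 10 ^ 7 * coarseBound 4 X α ρ ≤ n → α / 2 < σ → ∀ w,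
      ‖F w - hullProj T w‖ ^ 2 ≤ m * α ^ 2 / 10 ^ 6 := by
    intro hcond hbig w
    obtain ⟨Δ, hΔ, hΔ'⟩ := exists_diam_bound hm hn hX hα hρ hT hcond hbig
    have h := sq_norm_frankWolfe_sub_hullProj_le hX0 hTdef hΔ w (10 ^ 7 + m)
    rw [hF, approxProj, if_neg (not_le.2 hbig)]
    exact h.trans hΔ'
  refine ⟨isZCDP_gaussian hm hn hρ (fun x => hT.inCube hX _ (hr x).1) hFm, fun hcond => ?_,
    fun hcond => ⟨T, r, hT, hr, fun D => ?_⟩⟩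
  · refine avgError_map_le hm hα (f := fun D z => F (meanPoint (fun i => r (D i)) + σ • z))
      (fun D => hFm.comp (by fun_prop)) fun D => ?_
    have hax := sq_norm_meanPoint_rounded_sub_le hm hn hα hT hr D
    rcases le_or_gt σ (α / 2) with hs | hs
    · simp only [hF, approxProj, if_pos hs]
      exact lintegral_noisy_sub_mean_le hσ0 hs hax
    · refine lintegral_sq_error_le hm hn hX hα hρ hT (inCube_meanPoint hn hX D)
        (meanPoint_rounded_mem hn hr D) hax hcond _ (fun z => hclose hcond hs _) fun z => ?_
      simp only [hF, approxProj, if_neg (not_le.2 hs)]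
      exact frankWolfe_mem hX0 convex_inCube (fun k hk => hT.inCube hX _
        (Finset.mem_image_of_mem _ (Finset.mem_range.2 hk))) _ _
  · refine rms_le hm (by positivity) ?_
    have hproj : Measurable (hullProj T) := (continuous_hullProj hTne).measurable
    simp only [progOutput_eq hX0, cpmOutput]
    have hf : Measurable fun z => ENNReal.ofReal (‖F (meanPoint (fun i => r (D i)) + σ • z) -
        hullProj T (meanPoint (fun i => r (D i)) + σ • z)‖ ^ 2) := by fun_prop
    refine (lintegral_gaussianTape_prefix hf).trans_le ?_
    -- With small noise the distance to the projection has root mean square at most `σ`; otherwise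
    -- Frank–Wolfe is within `α / 1000` for every noise vector.
    rcases le_or_gt σ (α / 2) with hs | hs
    · simp only [hF, approxProj, if_pos hs]
      exact lintegral_noisy_sub_hullProj_le hσ0 hs hTne (meanPoint_rounded_mem hn hr D)
    · refine lintegral_ofReal_le_const fun z => (hclose hcond hs _).trans ?_
      nlinarith [show 0 ≤ m * α ^ 2 by positivity]
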